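/- **Setting.** Let $K_i\subset\mathbb{CP}^1$ ($i\in I$) be a family of pairwise disjoint closed round disks, let $'$ be an involution of $I$ that interchanges a subset $I_+$ with its complement, and let $\varphi_i$ be fraction-linear maps (lifted to $SL_2(\mathbb C)$, to fix the signs of pull-backs of half-forms) with $\varphi_{i'}=\varphi_i^{-1}$, which map $\partial K_i$ onto $\partial K_{i'}$ and the interior of $K_i$ onto the exterior of $K_{i'}$. These data define a curve $\bar M$. A bundle $\mathcal L$ on $\bar M$ is given by functions $\psi_i$, holomorphic and without zeros near $\partial K_i$, with $\psi_{i'}\circ\varphi_i=\psi_i^{-1}$; $\mathcal L^{-1}$ is given by $\psi_i^{-1}$. The index $\operatorname{ind}\psi_i$ is the winding number of $\psi_i$ along $\partial K_i$; $\mathcal L$ has finite degree if $\operatorname{ind}\psi_i=0$ for all but finitely many $i$. Let $l_{ij}$ be the conformal distance between $\partial K_i$ and $\partial K_j$, that is, the $l>0$ such that the tube between these circles is conformally equivalent to $S^1\times[0,l]$, where $S^1$ has length $2\pi$. Let $L_2(\partial K_i)$ be the Hilbert space of $L_2$ half-forms $f(z)\,dz^{1/2}$ on $\partial K_i$ (it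 is invariant under fraction-linear maps), and $L_2(\partial K_i)=L_2^+(\partial K_i)\oplus L_2^-(\partial K_i)$ the decomposition into half-forms that extend holomorphically inside, respectively outside, $K_i$. Put $\mathcal H^\pm=\bigoplus_{l_2}L_2^\pm(\partial K_i)$. Let $\mathbf K\colon\mathcal H^-\to\mathcal H^+$ be the operator with zero diagonal blocks whose block $L_2^-(\partial K_i)\to L_2^+(\partial K_j)$, $i\ne j$, is given by the Cauchy kernel $\frac1{2\pi i}\frac{dx^{1/2}dy^{1/2}}{x-y}$. If $\operatorname{ind}\psi_i=0$, let $$\Pi_{\varphi_i,\psi_i}\colon L_2^+(\partial K_i)\oplus L_2^+(\partial K_{i'})\to L_2^-(\partial K_i)\oplus L_2^-(\partial K_{i'})$$ be the operator with $(f_+,g_+)\mapsto(f_-,g_-)$ iff $\varphi_i^*(g_++g_-)=\psi_i\,(f_++f_-)$; if $\operatorname{ind}\psi_i\ne0$, let it be any bounded operator between these spaces such that the set of pairs $(f_++f_-,\,g_++g_-)$ with $(f_-,g_-)=\Pi_{\varphi_i,\psi_i}(f_+,g_+)$ is comparable with the set of pairs $(f,g)$ with $\varphi_i^*g=\psi_if$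 (their intersection has finite codimension in both). Let $\Pi_{\{\psi\}}=\bigoplus_{i\in I_+}\Pi_{\varphi_i,\psi_i}\colon\mathcal H^+\to\mathcal H^-$. The bundle $\mathcal L$ is *Hilbert–Schmidt* if both $\Pi_{\{\psi\}}\mathbf K$ and $\Pi_{\{\psi^{-1}\}}\mathbf K$ are Hilbert–Schmidt operators; for possibly unbounded $\mathbf K$, $\Pi_{\{\psi\}}$ this means that there is a Hilbert–Schmidt operator on $\mathcal H^-$ that coincides with the composition on each summand $L_2^-(\partial K_j)$. The curve $\bar M$ is *Hilbert–Schmidt* if it is so with the trivial bundle ($\psi_i\equiv1$). For a function $\psi$ of index $0$ on the unit circle the Riemann norm $|\psi|_{\mathbf R}$ is the norm of $p^{-1}$, where $p$ is the (invertible) projection $(f,\psi f)\mapsto(f_+,(\psi f)_-)$ from $V_\psi=\{(f,\psi f)\}\subset L_2(S^1)\oplus L_2(S^1)$ to $L_2^+(S^1)\oplus L_2^-(S^1)$; for $\psi_i$ on $\partial K_i$ it is defined via a fraction-linear isomorphism of $K_i$ with the unit disk. **Theorem.** 1. Let $\mathcal L$ be of finite degree. If $$\sum_{i\ne j}\left(|\psi_i|_{\mathbf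 R}^2+|\psi_i^{-1}|_{\mathbf R}^2\right)e^{-l_{ij}}<\infty$$ (the finitely many indices $i$ with $\operatorname{ind}\psi_i\neq0$ being excluded from the summation, with $j$ running over all of $I$), then $\mathcal L$ is Hilbert–Schmidt. 2. Suppose that all but finitely many of the functions $\psi_i$ are constant. Then $\mathcal L$ is Hilbert–Schmidt if and only if $$\sum_{i\neq j}\left(|\psi_i|^2+|\psi_i|^{-2}\right)e^{-l_{ij}}<\infty ,$$ where the indices $i$ with non-constant $\psi_i$ are excluded from the summation (and $j$ runs over all of $I$). 3. The curve $\bar M$ is Hilbert–Schmidt if and only if $\sum_{i\ne j}e^{-l_{ij}}<\infty$. 4. If there is a Hilbert–Schmidt bundle of finite degree on $\bar M$, then $\bar M$ is Hilbert–Schmidt. 5. For $i\neq j$ the singular values of the block $L_2^-(\partial K_i)\to L_2^+(\partial K_j)$ of $\mathbf K$ are $e^{-sl_{ij}}$, $s\in\mathbb Z+\frac12$, $s>0$: there are orthonormal bases $(u_n)_{n\ge0}$ of $L_2^-(\partial K_i)$ and $(v_n)_{n\ge0}$ of $L_2^+(\partial K_j)$ such that the block maps $u_n$ to $e^{-(n+1/2)l_{ij}}v_n$.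 -/

import Mathlib

open MeasureTheory

open scoped MatrixGroups Topology

noncomputable section

namespace HalfForm

/-! ### The Riemann sphere and fraction-linear maps -/

/-- The Riemann sphere `ℂP¹ = ℂ ∪ {∞}`. -/
abbrev Sphere : Type := OnePoint ℂ

/-- The fraction-linear map `x ↦ (a x + b) / (c x + d)` of the Riemann sphere. -/
def moebius (g : SL(2, ℂ)) (x : Sphere) : Sphere := (g : GL (Fin 2) ℂ) • x

/-- A map from `ℂ` to the Riemann sphere is holomorphic at `z` if, near `z`, it is an analytic
function read in one of the affine charts `u ↦ g • u` of the sphere. -/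
def HolomorphicToSphereAt (h : ℂ → Sphere) (z : ℂ) : Prop :=
  ∃ (g : SL(2, ℂ)) (u : ℂ → ℂ), AnalyticAt ℂ u z ∧ ∀ᶠ w in 𝓝 z, h w = moebius g (u w : Sphere)

/-- The tube `U` bounded by the disjoint simple closed curves `γ₁`, `γ₂` is conformally equivalent
to the tube `S¹ × [0, l]` of circumference `2π` and length `l`. The latter is written as the annulus
`1 ≤ |w| ≤ e ^ l`, with `w = exp (y + i x)` for `(x, y) ∈ S¹ × [0, l]`. -/
def IsConformalTube (U γ₁ γ₂ : Set Sphere) (l : ℝ) : Prop :=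
  0 < l ∧ ∃ h : ℂ → Sphere,
    ContinuousOn h {w | 1 ≤ ‖w‖ ∧ ‖w‖ ≤ Real.exp l} ∧
    Set.InjOn h {w | 1 ≤ ‖w‖ ∧ ‖w‖ ≤ Real.exp l} ∧
    (∀ w, 1 < ‖w‖ → ‖w‖ < Real.exp l → HolomorphicToSphereAt h w) ∧
    h '' {w | 1 < ‖w‖ ∧ ‖w‖ < Real.exp l} = U ∧
    h '' {w | ‖w‖ = 1} = γ₁ ∧
    h '' {w | ‖w‖ = Real.exp l} = γ₂

/-- The conformal distance between `γ₁` and `γ₂`, which bound the tube `U`: the length `l` of the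
tube `S¹ × [0, l]` that is conformally equivalent to `U` (there is exactly one such `l`). -/
def conformalDistance (U γ₁ γ₂ : Set Sphere) : ℝ := sSup {l | IsConformalTube U γ₁ γ₂ l}

/-! ### Half-forms on the unit circle -/

/-- The point `z = exp (2 π i t)` of the unit circle. -/
def unitPt (t : UnitAddCircle) : ℂ := (AddCircle.toCircle t : ℂ)

/-- The Hilbert space of `L₂` half-forms `f(z) dz^{1/2}` on the unit circle; such a half-form is
represented by `f`, as a function of `t` with `z = exp (2 π i t)`. As a section of `Ω^{1/2} ⊗ μ`,
the half-form `z ^ k dz^{1/2}` is, up to a constant, `exp (2 π i (k + 1/2) t) dt^{1/2}`. -/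
abbrev L2 : Type := Lp ℂ 2 (AddCircle.haarAddCircle : Measure UnitAddCircle)

/-- The half-forms that extend holomorphically inside the unit circle: the Fourier frequencies
`k + 1/2` are positive. -/
def Lplus : Submodule ℂ L2 :=
  (Submodule.span ℂ {f : L2 | ∃ k : ℤ, 0 ≤ k ∧ f = fourierLp 2 k}).topologicalClosure

/-- The half-forms that extend holomorphically outside the unit circle (including `∞`): the Fourier
frequencies `k + 1/2` are negative. -/
def Lminus : Submodule ℂ L2 :=
  (Submodule.span ℂ {f : L2 | ∃ k : ℤ, k < 0 ∧ f = fourierLp 2 k}).topologicalClosure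

instance : CompleteSpace Lplus :=
  inferInstanceAs (CompleteSpace (Submodule.topologicalClosure _))

instance : CompleteSpace Lminus :=
  inferInstanceAs (CompleteSpace (Submodule.topologicalClosure _))

/-- The `+`-part of a half-form. -/
def plusPart : L2 →L[ℂ] Lplus := Lplus.orthogonalProjectionOnto

/-- The `-`-part of a half-form. -/
def minusPart : L2 →L[ℂ] Lminus := Lminus.orthogonalProjectionOnto

/-! ### The Riemann norm -/

/-- The space `V_ψ` of pairs `(f, ψ f)` of half-forms on the unit circle. -/
def multGraph (ψ : UnitAddCircle → ℂ) : Submodule ℂ (WithLp 2 (L2 × L2)) where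
  carrier := {p | ∀ᵐ t ∂AddCircle.haarAddCircle, p.snd t = ψ t * p.fst t}
  zero_mem' := by
    have h0 := Lp.coeFn_zero ℂ 2 (AddCircle.haarAddCircle : Measure UnitAddCircle)
    filter_upwards [h0] with t ht
    change (0 : L2) t = ψ t * (0 : L2) t
    rw [ht]; simp
  add_mem' := by
    intro p q hp hq
    filter_upwards [hp, hq, Lp.coeFn_add p.fst q.fst, Lp.coeFn_add p.snd q.snd] with t h1 h2 h3 h4
    change (p.snd + q.snd) t = ψ t * (p.fst + q.fst) t
    rw [h3, h4]; simp only [Pi.add_apply, h1, h2]; ring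
  smul_mem' := by
    intro c p hp
    filter_upwards [hp, Lp.coeFn_smul c p.fst, Lp.coeFn_smul c p.snd] with t h1 h3 h4
    change (c • p.snd) t = ψ t * (c • p.fst) t
    rw [h3, h4]; simp only [Pi.smul_apply, h1, smul_eq_mul]; ring

/-- The projection `p : V_ψ → L₂⁺ ⊕ L₂⁻`, `(f, g) ↦ (f₊, g₋)`. -/
def riemannMap (ψ : UnitAddCircle → ℂ) : multGraph ψ →L[ℂ] WithLp 2 (Lplus × Lminus) :=
  ((WithLp.prodContinuousLinearEquiv 2 ℂ Lplus Lminus).symm : Lplus × Lminus →L[ℂ] _) ∘L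
    (plusPart.prodMap minusPart) ∘L
    ((WithLp.prodContinuousLinearEquiv 2 ℂ L2 L2) : WithLp 2 (L2 × L2) →L[ℂ] L2 × L2) ∘L
    (multGraph ψ).subtypeL

/-- The Riemann norm of `ψ`: the operator norm of `p⁻¹` (used for `ψ` of index `0`, when `p` is
invertible). -/
def riemannNorm (ψ : UnitAddCircle → ℂ) : ℝ := ‖(riemannMap ψ).inverse‖

/-! ### Hilbert-Schmidt operators, comparable subspaces -/

/-- A bounded operator between Hilbert spaces is Hilbert-Schmidt if `∑ ‖T e‖ ^ 2 < ∞`, the sum over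
a Hilbert basis. -/
def IsHilbertSchmidt {E F : Type*} [NormedAddCommGroup E] [InnerProductSpace ℂ E]
    [NormedAddCommGroup F] [InnerProductSpace ℂ F] (T : E →L[ℂ] F) : Prop :=
  ∃ (w : Set E) (b : HilbertBasis w ℂ E), Summable fun e : w => ‖T (b e)‖ ^ 2

/-- Two subspaces are comparable if their intersection has finite codimension in both. -/
def Comparable {E : Type*} [AddCommGroup E] [Module ℂ E] (V W : Submodule ℂ E) : Prop :=
  FiniteDimensional ℂ (V ⧸ (V ⊓ W).submoduleOf V) ∧
    FiniteDimensional ℂ (W ⧸ (V ⊓ W).submoduleOf W)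

/-! ### Model curves -/

/-- The data that define a curve: a family of disjoint closed disks `K i` on the Riemann sphere, an
involution of the index set without fixed points (it interchanges `pos` and its complement), and
fraction-linear identifications `φ i` of `∂K i` with `∂K i'`.

Each disk is given together with a fraction-linear isomorphism `chart i` of the closed unit disk
with it. The maps `φ i` are taken in `SL(2, ℂ)` to fix the signs of the pull-backs of
half-forms. -/
structure ModelCurve (I : Type*) where
  /-- the involution -/
  inv : I → I
  inv_inv : ∀ i, inv (inv i) = i
  /-- the subset `I₊`, which the involution interchanges with its complement -/
  pos : Set I
  inv_mem_pos : ∀ i, inv i ∈ pos ↔ i ∉ pos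
  /-- a fraction-linear isomorphism of the unit disk with `K i` -/
  chart : I → SL(2, ℂ)
  disjoint : Pairwise fun i j =>
    Disjoint ((fun z : ℂ => moebius (chart i) (z : Sphere)) '' {z | ‖z‖ ≤ 1})
      ((fun z : ℂ => moebius (chart j) (z : Sphere)) '' {z | ‖z‖ ≤ 1})
  /-- the identification of `∂K i` with `∂K i'` -/
  φ : I → SL(2, ℂ)
  φ_inv : ∀ i, φ (inv i) = (φ i)⁻¹
  φ_circle : ∀ i, moebius (φ i) '' ((fun z : ℂ => moebius (chart i) (z : Sphere)) '' {z | ‖z‖ = 1})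
    = (fun z : ℂ => moebius (chart (inv i)) (z : Sphere)) '' {z | ‖z‖ = 1}
  /-- `φ i` reverses the orientation of the circles: it sends the interior of `K i` to the exterior
  of `K i'` -/
  φ_disk : ∀ i, moebius (φ i) '' ((fun z : ℂ => moebius (chart i) (z : Sphere)) '' {z | ‖z‖ < 1})
    = ((fun z : ℂ => moebius (chart (inv i)) (z : Sphere)) '' {z | ‖z‖ ≤ 1})ᶜ

namespace ModelCurve

variable {I : Type*} (C : ModelCurve I)

/-- The closed disk `K i`. -/
def disk (i : I) : Set Sphere := (fun z : ℂ => moebius (C.chart i) (z : Sphere)) '' {z | ‖z‖ ≤ 1}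

/-- The circle `∂K i`. -/
def circle (i : I) : Set Sphere := (fun z : ℂ => moebius (C.chart i) (z : Sphere)) '' {z | ‖z‖ = 1}

/-- The point of `∂K i` with parameter `t`. -/
def circlePt (i : I) (t : UnitAddCircle) : Sphere := moebius (C.chart i) (unitPt t : Sphere)

/-- The conformal distance `l i j` between `∂K i` and `∂K j`. -/
def l (i j : I) : ℝ := conformalDistance (C.disk i ∪ C.disk j)ᶜ (C.circle i) (C.circle j)

/-- For `x = (a z + b) / (c z + d)` (the chart of `K j`) and `y = (a' w + b') / (c' w + d')` (the
chart of `K i`), with `z`, `w` on the unit circle, this is `(x - y) (c z + d) (c' w + d')`, written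
without denominators. -/
def cauchyDenom (i j : I) (t s : UnitAddCircle) : ℂ :=
  (C.chart j 0 0 * unitPt t + C.chart j 0 1) * (C.chart i 1 0 * unitPt s + C.chart i 1 1) -
    (C.chart i 0 0 * unitPt s + C.chart i 0 1) * (C.chart j 1 0 * unitPt t + C.chart j 1 1)

/-- For a half-form `f` on `∂K i`, the half-form
`(2 π i)⁻¹ ∫ f(y) (x - y)⁻¹ dx^{1/2} dy^{1/2}`, `x ∈ ∂K j`. Half-forms on `∂K i` and on `∂K j` are
pulled back to the unit circle by the charts; by `dx^{1/2} = (c z + d)⁻¹ dz^{1/2}`,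
`dy^{1/2} = (c' w + d')⁻¹ dw^{1/2}` and `dw = 2 π i w ds` for `w = exp (2 π i s)` the integral takes
the form below. -/
def cauchyIntegral (i j : I) (f : L2) (t : UnitAddCircle) : ℂ :=
  ∫ s, f s * unitPt s / C.cauchyDenom i j t s ∂AddCircle.haarAddCircle

theorem norm_unitPt (t : UnitAddCircle) : ‖unitPt t‖ = 1 := Circle.norm_coe _

theorem continuous_unitPt : Continuous unitPt := by
  unfold unitPt
  exact continuous_subtype_val.comp AddCircle.continuous_toCircle

theorem moebius_eq_of_cross {g h : SL(2, ℂ)} {z w : ℂ}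
    (e : (g 0 0 * z + g 0 1) * (h 1 0 * w + h 1 1) - (h 0 0 * w + h 0 1) * (g 1 0 * z + g 1 1) = 0) :
    moebius g (z : Sphere) = moebius h (w : Sphere) := by
  have hg := g.det_coe
  have hh := h.det_coe
  rw [Matrix.det_fin_two] at hg hh
  unfold moebius
  rw [OnePoint.smul_some_eq_ite, OnePoint.smul_some_eq_ite]
  simp only [Matrix.SpecialLinearGroup.coe_GL_coe_matrix]
  by_cases h1 : g 1 0 * z + g 1 1 = 0
  · have h2 : h 1 0 * w + h 1 1 = 0 := by
      by_contra h2
      have h3 : g 0 0 * z + g 0 1 = 0 := by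
        rw [h1, mul_zero, sub_zero] at e
        exact (mul_eq_zero.1 e).resolve_right h2
      have : (1 : ℂ) = 0 := by linear_combination (g 0 0) * h1 - (g 1 0) * h3 - hg
      exact one_ne_zero this
    simp [h1, h2]
  · have h2 : h 1 0 * w + h 1 1 ≠ 0 := by
      intro h2
      have h3 : h 0 0 * w + h 0 1 = 0 := by
        rw [h2, mul_zero, zero_sub, neg_eq_zero] at e
        exact (mul_eq_zero.1 e).resolve_right h1
      have : (1 : ℂ) = 0 := by linear_combination (h 0 0) * h2 - (h 1 0) * h3 - hh
      exact one_ne_zero this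
    simp only [h1, h2, if_false]
    congr 1
    rw [div_eq_div_iff h1 h2]
    linear_combination e

theorem cauchyDenom_ne_zero {i j : I} (hij : i ≠ j) (t s : UnitAddCircle) :
    C.cauchyDenom i j t s ≠ 0 := by
  intro h
  have e := moebius_eq_of_cross h
  refine Set.disjoint_left.1 (C.disjoint hij) ⟨unitPt s, (norm_unitPt s).le, rfl⟩
    ⟨unitPt t, (norm_unitPt t).le, e⟩

theorem continuous_cauchyIntegral {i j : I} (hij : i ≠ j) (f : L2) :
    Continuous (C.cauchyIntegral i j f) := by
  have hc : Continuous fun p : UnitAddCircle × UnitAddCircle =>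
      unitPt p.2 / C.cauchyDenom i j p.1 p.2 := by
    refine (continuous_unitPt.comp continuous_snd).div ?_ fun p => C.cauchyDenom_ne_zero hij _ _
    have h1 := continuous_unitPt.comp (continuous_fst (X := UnitAddCircle) (Y := UnitAddCircle))
    have h2 := continuous_unitPt.comp (continuous_snd (X := UnitAddCircle) (Y := UnitAddCircle))
    simp only [Function.comp_def] at h1 h2
    unfold cauchyDenom
    fun_prop
  obtain ⟨M, hM⟩ := (isCompact_range hc).isBounded.exists_norm_le
  have hf : Integrable f (AddCircle.haarAddCircle : Measure UnitAddCircle) :=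
    (Lp.memLp f).integrable (by norm_num)
  unfold cauchyIntegral
  simp only [mul_div_assoc]
  refine continuous_of_dominated (bound := fun s => ‖f s‖ * M) ?_ ?_ (hf.norm.mul_const M) ?_
  · intro t
    exact hf.1.mul (hc.comp (Continuous.prodMk_right t)).aestronglyMeasurable
  · intro t
    refine Filter.Eventually.of_forall fun s => ?_
    rw [norm_mul]
    exact mul_le_mul_of_nonneg_left (hM _ ⟨(t, s), rfl⟩) (norm_nonneg _)
  · refine Filter.Eventually.of_forall fun s => ?_
    exact continuous_const.mul (hc.comp (Continuous.prodMk_left s))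

theorem memLp_cauchyIntegral {i j : I} (hij : i ≠ j) (f : L2) :
    MemLp (C.cauchyIntegral i j f) 2 (AddCircle.haarAddCircle : Measure UnitAddCircle) :=
  ((ContinuousMap.mk _ (C.continuous_cauchyIntegral hij f)).memLp _ ℂ)

open Classical in
/-- The block `L₂⁻(∂K i) → L₂⁺(∂K j)` of the operator `𝐊` with Cauchy kernel, whose diagonal blocks
are removed. -/
def cauchyBlock (i j : I) (f : Lminus) : Lplus :=
  if h : i = j then 0 else plusPart ((C.memLp_cauchyIntegral h f).toLp (C.cauchyIntegral i j f))

/-! ### Bundles given by gluing conditions -/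

/-- The gluing functions `ψ i` of a bundle `ℒ`: nowhere vanishing, holomorphic near `∂K i`, with
`ψ i' ∘ φ i = (ψ i)⁻¹`. -/
structure Bundle where
  /-- the gluing functions -/
  ψ : I → Sphere → ℂ
  analytic : ∀ i, AnalyticOnNhd ℂ (fun z : ℂ => ψ i (moebius (C.chart i) (z : Sphere))) {z | ‖z‖ = 1}
  ne_zero : ∀ i, ∀ x ∈ C.circle i, ψ i x ≠ 0
  inv_eq : ∀ i, ∀ x ∈ C.circle i, ψ (C.inv i) (moebius (C.φ i) x) = (ψ i x)⁻¹

namespace Bundle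

variable {C}

/-- The dual bundle `ℒ⁻¹`, with gluing functions `(ψ i)⁻¹`. -/
def dual (L : C.Bundle) : C.Bundle where
  ψ i x := (L.ψ i x)⁻¹
  analytic i := (L.analytic i).inv fun z hz => L.ne_zero i _ ⟨z, hz, rfl⟩
  ne_zero i x hx := inv_ne_zero (L.ne_zero i x hx)
  inv_eq i x hx := by rw [L.inv_eq i x hx]

/-- The function `ψ i` on `∂K i`, in terms of the parameter of the circle. -/
def onCircle (L : C.Bundle) (i : I) (t : UnitAddCircle) : ℂ := L.ψ i (C.circlePt i t)

/-- The index of `ψ i`: the winding number `(2 π i)⁻¹ ∮ dψ / ψ` along `∂K i`. -/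
def index (L : C.Bundle) (i : I) : ℂ :=
  (2 * Real.pi * Complex.I)⁻¹ *
    ∮ z in C((0 : ℂ), 1), logDeriv (fun z : ℂ => L.ψ i (moebius (C.chart i) (z : Sphere))) z

/-- All but finitely many of the gluing functions have index `0`. -/
def FiniteDegree (L : C.Bundle) : Prop := {i | L.index i ≠ 0}.Finite

/-- The function `ψ i` is constant. -/
def IsConstAt (L : C.Bundle) (i : I) : Prop := ∃ c : ℂ, ∀ x ∈ C.circle i, L.ψ i x = c

/-- The value of `ψ i` at a point of `∂K i`, i.e. the value of `ψ i` if `ψ i` is constant. -/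
def constVal (L : C.Bundle) (i : I) : ℂ := L.onCircle i 0

/-- The pairs `(f, g)` of half-forms on `∂K i` and `∂K i'` (pulled back to the unit circle by the
charts) that satisfy the gluing condition `φ_i^* g = ψ_i f`. In the charts, `φ i` is the
fraction-linear map `σ = (chart i')⁻¹ ∘ φ i ∘ chart i` with lower row `(c, d)`, and the half-form
`g(w) dw^{1/2}` is pulled back to `g(σ z) (c z + d)⁻¹ dz^{1/2}`. -/
def gluedPairs (L : C.Bundle) (i : I) : Submodule ℂ (L2 × L2) where
  carrier := {p | ∃ f g : UnitAddCircle → ℂ,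
    p.1 =ᵐ[AddCircle.haarAddCircle] f ∧ p.2 =ᵐ[AddCircle.haarAddCircle] g ∧
    ∀ t s, C.circlePt (C.inv i) s = moebius (C.φ i) (C.circlePt i t) →
      g s * (((C.chart (C.inv i))⁻¹ * C.φ i * C.chart i) 1 0 * unitPt t +
        ((C.chart (C.inv i))⁻¹ * C.φ i * C.chart i) 1 1)⁻¹ = L.onCircle i t * f t}
  zero_mem' := ⟨0, 0, Lp.coeFn_zero _ _ _, Lp.coeFn_zero _ _ _, by simp⟩
  add_mem' := by
    rintro p q ⟨f, g, h1, h2, h3⟩ ⟨f', g', h1', h2', h3'⟩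
    refine ⟨f + f', g + g', (Lp.coeFn_add _ _).trans (h1.add h1'),
      (Lp.coeFn_add _ _).trans (h2.add h2'), fun t s h => ?_⟩
    simp only [Pi.add_apply, add_mul, mul_add, h3 t s h, h3' t s h]
  smul_mem' := by
    rintro c p ⟨f, g, h1, h2, h3⟩
    refine ⟨c • f, c • g, (Lp.coeFn_smul _ _).trans (h1.const_smul c),
      (Lp.coeFn_smul _ _).trans (h2.const_smul c), fun t s h => ?_⟩
    simp only [Pi.smul_apply, smul_eq_mul]
    linear_combination c * h3 t s h

end Bundle

/-- The graph of an operator `P : L₂⁺(∂K i) ⊕ L₂⁺(∂K i') → L₂⁻(∂K i) ⊕ L₂⁻(∂K i')`, as the set of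
the pairs of half-forms `(f₊ + f₋, g₊ + g₋)` with `(f₋, g₋) = P (f₊, g₊)`. -/
def operatorGraph (P : Lplus × Lplus →L[ℂ] Lminus × Lminus) : Submodule ℂ (L2 × L2) :=
  LinearMap.range ((Lplus.subtype.prodMap Lplus.subtype) +
    (Lminus.subtype.prodMap Lminus.subtype) ∘ₗ (P : Lplus × Lplus →ₗ[ℂ] Lminus × Lminus))

namespace Bundle

variable {C}

/-- `P` is the operator `Π_{φ_i, ψ_i}`: if `ind ψ_i = 0`, its graph is the space of pairs of
half-forms that satisfy the gluing condition (so `P` is unique); otherwise it is an arbitrary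
bounded operator whose graph is comparable with this space. -/
def IsGluingOperator (L : C.Bundle) (i : I) (P : Lplus × Lplus →L[ℂ] Lminus × Lminus) : Prop :=
  (L.index i = 0 → operatorGraph P = L.gluedPairs i) ∧
    (L.index i ≠ 0 → Comparable (operatorGraph P) (L.gluedPairs i))

open Classical in
/-- The operator `Π_{ψ} 𝐊` on the Hilbert sum of the spaces `L₂⁻(∂K i)` is Hilbert-Schmidt, where
`Π_{ψ}` is the direct sum of `Π_{φ_i, ψ_i}`, `i ∈ I₊`. The operators `Π_{ψ}` and `𝐊` are given by
their blocks and need not be bounded: what is required is a Hilbert-Schmidt operator `T` that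
coincides with `Π_{ψ} 𝐊` on each of the summands `L₂⁻(∂K j)` (so `T` is unique, given `Π_{ψ}`). -/
def PiCauchyIsHilbertSchmidt (L : C.Bundle) : Prop :=
  ∃ P : I → (Lplus × Lplus →L[ℂ] Lminus × Lminus), (∀ i ∈ C.pos, L.IsGluingOperator i (P i)) ∧
    ∃ T : lp (fun _ : I => Lminus) 2 →L[ℂ] lp (fun _ : I => Lminus) 2, IsHilbertSchmidt T ∧
      ∀ (j : I) (f : Lminus), ∀ i ∈ C.pos,
        (T (lp.single 2 j f) i, T (lp.single 2 j f) (C.inv i)) =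
          P i (C.cauchyBlock j i f, C.cauchyBlock j (C.inv i) f)

/-- The bundle `ℒ` (or the curve with the bundle `ℒ`) is Hilbert-Schmidt: both `Π_{ψ} 𝐊` and
`Π_{ψ⁻¹} 𝐊` are Hilbert-Schmidt operators. -/
def IsHilbertSchmidt (L : C.Bundle) : Prop :=
  L.PiCauchyIsHilbertSchmidt ∧ L.dual.PiCauchyIsHilbertSchmidt

end Bundle

/-- The trivial bundle, with gluing functions `1`. -/
def trivialBundle : C.Bundle where
  ψ _ _ := 1
  analytic _ := analyticOnNhd_const
  ne_zero _ _ _ := one_ne_zero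
  inv_eq _ _ _ := by simp

/-- The curve is Hilbert-Schmidt: it is so with the trivial bundle. -/
def IsHilbertSchmidt : Prop := C.trivialBundle.IsHilbertSchmidt

end ModelCurve

end HalfForm

end

noncomputable section
namespace HalfForm

open Metric

/-! ### The unit circle -/

/-! Fraction-linear maps preserving the unit circle act on half-forms by unitary operators (`pull`),
and these either preserve or interchange L₂⁺ and L₂⁻, according to the coset of SU(1,1). This
reduces both factors of Π𝐊 to explicit models.

The Cauchy factor. For disjoint disks the transition matrix between the charts is A·T·B with A, B in
SU(1,1) and T the map z ↦ e^l / z (`exists_tube_decomposition`): a Hermitian form of signature (1,1)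
is diagonalized together with |x|² − |y|². Between concentric circles the Cauchy kernel is diagonal
in the powers of z, so the block has singular values e^{-(n+1/2)l} (`exists_svd`). The number l is
the conformal distance, since another tube length L satisfies L ≤ l (`tube_length_le`). With q =
e^{-l} the squared Hilbert–Schmidt norm of the block is q/(1 − q²): at least q, at most 2q when q ≤
1/2, and always finite. Sums of block norms and weighted sums of e^{-l} therefore converge together
if the weights are 0 or at least 1.

The gluing factor. A nowhere vanishing analytic function on the circle is z^k exp(a) exp(b), with a
and b multipliers of L₂⁺ and L₂⁻ (`exists_factorization`). If k = 0, f is determined by f₊ and (ψf)₋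
(`Factors.exists_solve`). Since φ* interchanges L₂⁺ and L₂⁻, the gluing condition φ*g = ψf says φ*g₊
= (ψf)₋ and φ*g₋ = (ψf)₊. Thus Π is, up to unitary maps, (f₊, (ψf)₋) ↦ (f₋, (ψf)₊), and its norm is
bounded by the Riemann norm. If k ≠ 0, multiplication by z^k alters these conditions by finite-rank
terms, so a bounded comparable operator exists.

Statement 1 follows by summing over rows; the finitely many exceptional rows are finite because the
Riemann norm is at least 1, so the hypothesis already forces the sum of e^{-l} to converge. For
constant ψ = c the two components of Π are multiples of isometries, with factors |c|⁻¹ and |c|; the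
estimate becomes an equality of norms, which gives 2, and 3 is the case c = 1.

For 4, apply Π_ψ and Π_{ψ⁻¹} to the same vector x = (f₊, g₊), getting (f, g) and (f', g'). The
factors ψ and ψ⁻¹ cancel: f f' = φ*g · φ*g'. Let x be the image under 𝐊 of the top singular vector
of the larger of the blocks into ∂K_i and ∂K_{i'}. After a change of coordinate the integral of one
side is the square c² of its leading coefficient, with |c|² = e^{-l}, while the other side is small
if Π_ψ x and Π_{ψ⁻¹} x are. Hence e^{-l} is at most 6 times the sum of the squared norms of these
two vectors (`sq_norm_le_of_mul_eq`), and summation over the blocks gives the claim. -/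

/-- The Haar probability measure of the unit circle. -/
abbrev haar : Measure UnitAddCircle := AddCircle.haarAddCircle

theorem norm_unitPt' (t : UnitAddCircle) : ‖unitPt t‖ = 1 := Circle.norm_coe _

theorem unitPt_ne_zero (t : UnitAddCircle) : unitPt t ≠ 0 := Circle.coe_ne_zero _

theorem continuous_unitPt' : Continuous unitPt :=
  continuous_subtype_val.comp AddCircle.continuous_toCircle

theorem conj_unitPt (t : UnitAddCircle) : (starRingEnd ℂ) (unitPt t) = (unitPt t)⁻¹ := by
  rw [Complex.inv_def, Complex.normSq_eq_norm_sq, norm_unitPt']; simp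

theorem fourier_eq_zpow (k : ℤ) (t : UnitAddCircle) : fourier k t = unitPt t ^ k := by
  rw [fourier_apply, unitPt, AddCircle.toCircle_zsmul, Circle.coe_zpow]

theorem unitPt_coe (x : ℝ) :
    unitPt (x : UnitAddCircle) = Complex.exp (2 * Real.pi * x * Complex.I) := by
  have := fourier_coe_apply (T := 1) (n := 1) (x := x)
  rw [fourier_eq_zpow, zpow_one] at this
  rw [this]; congr 1; push_cast; ring

theorem unitPt_injective : Function.Injective unitPt := fun _ _ h =>
  AddCircle.injective_toCircle one_ne_zero (Subtype.ext h)

/-- The parameter of a point of the unit circle. -/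
def circleParam (w : ℂ) : UnitAddCircle := ((Complex.arg w / (2 * Real.pi) : ℝ) : UnitAddCircle)

theorem unitPt_circleParam {w : ℂ} (hw : ‖w‖ = 1) : unitPt (circleParam w) = w := by
  have h := Complex.norm_mul_exp_arg_mul_I w
  rw [hw, Complex.ofReal_one, one_mul] at h
  rw [circleParam, unitPt_coe]
  conv_rhs => rw [← h]
  congr 1
  have : (Real.pi : ℂ) ≠ 0 := by exact_mod_cast Real.pi_ne_zero
  push_cast; field_simp

theorem measurable_circleParam : Measurable circleParam :=
  AddCircle.measurable_mk'.comp (Complex.measurable_arg.div_const _)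

theorem integral_unitPt (F : ℂ → ℂ) :
    ∫ t, F (unitPt t) ∂haar = Real.circleAverage F 0 1 := by
  rw [AddCircle.integral_haarAddCircle, ← AddCircle.intervalIntegral_preimage 1 0, zero_add,
    Real.circleAverage_def]
  have := intervalIntegral.integral_comp_mul_left (a := 0) (b := 1)
    (fun θ => F (circleMap 0 1 θ)) (c := 2 * Real.pi) (by positivity)
  rw [mul_zero, mul_one] at this
  rw [inv_one, one_smul, ← this]
  refine intervalIntegral.integral_congr fun x _ => ?_
  simp only [unitPt_coe, circleMap, Complex.ofReal_one, one_mul, zero_add]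
  congr 2; push_cast; ring

theorem integral_unitPt_of_differentiable {F : ℂ → ℂ}
    (hF : ∀ z, ‖z‖ ≤ 1 → DifferentiableAt ℂ F z) : ∫ t, F (unitPt t) ∂haar = F 0 := by
  rw [integral_unitPt]
  refine circleAverage_of_differentiable_on_off_countable Set.countable_empty ?_ ?_
  · intro z hz
    rw [abs_one, mem_closedBall_zero_iff] at hz
    exact (hF z hz).continuousAt.continuousWithinAt
  · rintro z ⟨hz, -⟩
    rw [abs_one, mem_ball_zero_iff] at hz
    exact hF z hz.le

/-- Since dt = dz / (2πi z), the integral is a contour integral of the derivative of G over a closed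
curve. -/
theorem integral_unitPt_of_primitive {F G : ℂ → ℂ}
    (hF : ∀ z, ‖z‖ = 1 → HasDerivAt G (F z / z) z) : ∫ t, F (unitPt t) ∂haar = 0 := by
  rw [integral_unitPt, Real.circleAverage_eq_circleIntegral one_ne_zero,
    circleIntegral.integral_eq_zero_of_hasDerivWithinAt zero_le_one (f := G), smul_zero]
  intro z hz
  have := (hF z (by simpa using hz)).hasDerivWithinAt (s := sphere 0 1)
  simpa [div_eq_inv_mul] using this

/-- Trigonometric polynomials are dense in the continuous functions, so Fourier coefficients
determine a finite measure. This is how the change of variables formula for fraction-linear maps is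
obtained. -/
theorem ext_haar_of_fourier (ν : Measure UnitAddCircle) [IsFiniteMeasure ν]
    (h : ∀ k : ℤ, ∫ t, unitPt t ^ k ∂ν = ∫ t, unitPt t ^ k ∂haar) : ν = haar := by
  have key : ∀ f : C(UnitAddCircle, ℂ), ∫ t, f t ∂ν = ∫ t, f t ∂haar := by
    have hint : ∀ (m : Measure UnitAddCircle) [IsFiniteMeasure m] (f : C(UnitAddCircle, ℂ)),
        Integrable f m := fun m _ f => f.continuous.integrable_of_hasCompactSupport
          (HasCompactSupport.of_compactSpace _)
    have hcont : ∀ (m : Measure UnitAddCircle) [IsFiniteMeasure m],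
        Continuous fun f : C(UnitAddCircle, ℂ) => ∫ t, f t ∂m := fun m _ => by
      have : (fun f : C(UnitAddCircle, ℂ) => ∫ t, f t ∂m) =
          fun f => ∫ t, (ContinuousMap.toLp (E := ℂ) 1 m ℂ f) t ∂m := by
        funext f
        exact (integral_congr_ae (ContinuousMap.coeFn_toLp m f)).symm
      rw [this]
      exact continuous_integral.comp (ContinuousMap.toLp (E := ℂ) 1 m ℂ).continuous
    have hcl : IsClosed {f : C(UnitAddCircle, ℂ) | ∫ t, f t ∂ν = ∫ t, f t ∂haar} :=
      isClosed_eq (hcont ν) (hcont haar)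
    intro f
    have hf : f ∈ (Submodule.span ℂ (Set.range (@fourier 1))).topologicalClosure := by
      rw [span_fourier_closure_eq_top]; trivial
    refine closure_minimal (fun g hg => ?_) hcl hf
    induction hg using Submodule.span_induction with
    | mem x hx =>
      obtain ⟨k, rfl⟩ := hx
      simpa only [Set.mem_ofPred_eq, fourier_eq_zpow] using h k
    | zero => simp
    | add x y _ _ hx hy =>
      simp only [Set.mem_ofPred_eq, ContinuousMap.add_apply] at *
      rw [integral_add (hint _ _) (hint _ _), integral_add (hint _ _) (hint _ _), hx, hy]
    | smul a x _ hx =>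
      simp only [Set.mem_ofPred_eq, ContinuousMap.smul_apply] at *
      rw [integral_smul, integral_smul, hx]
  refine ext_of_forall_integral_eq_of_IsFiniteMeasure fun f => ?_
  have := key ⟨fun t => (f t : ℂ), Complex.continuous_ofReal.comp f.continuous⟩
  simp only [ContinuousMap.coe_mk] at this
  rw [integral_complex_ofReal, integral_complex_ofReal] at this
  exact_mod_cast this

/-! ### Fraction-linear maps that preserve the unit circle -/

/-- The numerator of a fraction-linear map. -/
def num (A : SL(2, ℂ)) (z : ℂ) : ℂ := A 0 0 * z + A 0 1

/-- The denominator of a fraction-linear map. -/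
def den (A : SL(2, ℂ)) (z : ℂ) : ℂ := A 1 0 * z + A 1 1

/-- The fraction-linear automorphisms of the unit disk: the group `SU(1, 1)`. -/
def DiskAut (A : SL(2, ℂ)) : Prop :=
  A 0 0 = (starRingEnd ℂ) (A 1 1) ∧ A 0 1 = (starRingEnd ℂ) (A 1 0)

/-- The fraction-linear maps that interchange the unit disk and its exterior. -/
def DiskSwap (A : SL(2, ℂ)) : Prop :=
  A 0 0 = -(starRingEnd ℂ) (A 1 1) ∧ A 0 1 = -(starRingEnd ℂ) (A 1 0)

/-- The fraction-linear maps that preserve the unit circle. -/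
def CircleAut (A : SL(2, ℂ)) : Prop := DiskAut A ∨ DiskSwap A

theorem det_eq (A : SL(2, ℂ)) : A 0 0 * A 1 1 - A 0 1 * A 1 0 = 1 := by
  have := A.det_coe; rwa [Matrix.det_fin_two] at this

theorem mul_entries (A B : SL(2, ℂ)) (i j : Fin 2) :
    (A * B) i j = A i 0 * B 0 j + A i 1 * B 1 j := by
  rw [Matrix.SpecialLinearGroup.coe_mul, Matrix.mul_apply, Fin.sum_univ_two]

theorem inv_entries (A : SL(2, ℂ)) :
    A⁻¹ 0 0 = A 1 1 ∧ A⁻¹ 0 1 = -A 0 1 ∧ A⁻¹ 1 0 = -A 1 0 ∧ A⁻¹ 1 1 = A 0 0 := by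
  rw [Matrix.SpecialLinearGroup.coe_inv, Matrix.adjugate_fin_two]
  simp

theorem DiskAut.inv {A : SL(2, ℂ)} (hA : DiskAut A) : DiskAut A⁻¹ := by
  obtain ⟨h1, h2, h3, h4⟩ := inv_entries A
  unfold DiskAut
  rw [h1, h2, h3, h4, hA.1, hA.2]; simp

theorem DiskSwap.inv {A : SL(2, ℂ)} (hA : DiskSwap A) : DiskSwap A⁻¹ := by
  obtain ⟨h1, h2, h3, h4⟩ := inv_entries A
  unfold DiskSwap
  rw [h1, h2, h3, h4, hA.1, hA.2]; simp

theorem DiskAut.circleAut {A : SL(2, ℂ)} (hA : DiskAut A) : CircleAut A := Or.inl hA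

theorem DiskSwap.circleAut {A : SL(2, ℂ)} (hA : DiskSwap A) : CircleAut A := Or.inr hA

theorem CircleAut.inv {A : SL(2, ℂ)} (hA : CircleAut A) : CircleAut A⁻¹ :=
  hA.imp DiskAut.inv DiskSwap.inv

theorem DiskAut.num_eq {A : SL(2, ℂ)} (hA : DiskAut A) {z : ℂ} (hz : ‖z‖ = 1) :
    num A z = z * (starRingEnd ℂ) (den A z) := by
  have : z * (starRingEnd ℂ) z = 1 := by
    rw [Complex.mul_conj, Complex.normSq_eq_norm_sq, hz]; simp
  simp only [num, den, hA.1, hA.2, map_add, map_mul]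
  linear_combination -(starRingEnd ℂ) (A 1 0) * this

theorem DiskSwap.num_eq {A : SL(2, ℂ)} (hA : DiskSwap A) {z : ℂ} (hz : ‖z‖ = 1) :
    num A z = -(z * (starRingEnd ℂ) (den A z)) := by
  have : z * (starRingEnd ℂ) z = 1 := by
    rw [Complex.mul_conj, Complex.normSq_eq_norm_sq, hz]; simp
  simp only [num, den, hA.1, hA.2, map_add, map_mul]
  linear_combination (starRingEnd ℂ) (A 1 0) * this

/-- The sign records the coset of SU(1,1), so that computations on the circle are made once for
both. -/
theorem CircleAut.exists_sign {A : SL(2, ℂ)} (hA : CircleAut A) :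
    ∃ ε : ℂ, ε * ε = 1 ∧ ‖ε‖ = 1 ∧
      ∀ z : ℂ, ‖z‖ = 1 → num A z = ε * (z * (starRingEnd ℂ) (den A z)) := by
  rcases hA with hA | hA
  · exact ⟨1, by simp, by simp, fun z hz => by rw [hA.num_eq hz, one_mul]⟩
  · exact ⟨-1, by simp, by simp, fun z hz => by rw [hA.num_eq hz, neg_one_mul]⟩

theorem det_num_den (A : SL(2, ℂ)) (z : ℂ) : A 0 0 * den A z - A 1 0 * num A z = 1 := by
  unfold num den; linear_combination det_eq A

theorem CircleAut.den_ne_zero {A : SL(2, ℂ)} (hA : CircleAut A) {z : ℂ} (hz : ‖z‖ = 1) :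
    den A z ≠ 0 := by
  obtain ⟨ε, -, -, h⟩ := hA.exists_sign
  intro h0
  have h1 := h z hz
  have h2 := det_num_den A z
  rw [h1, h0] at h2
  simp at h2

theorem CircleAut.norm_num {A : SL(2, ℂ)} (hA : CircleAut A) {z : ℂ} (hz : ‖z‖ = 1) :
    ‖num A z‖ = ‖den A z‖ := by
  obtain ⟨ε, -, he, h⟩ := hA.exists_sign
  rw [h z hz, norm_mul, norm_mul, he, hz, RCLike.norm_conj, one_mul, one_mul]

theorem CircleAut.num_ne_zero {A : SL(2, ℂ)} (hA : CircleAut A) {z : ℂ} (hz : ‖z‖ = 1) :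
    num A z ≠ 0 := by
  rw [← norm_ne_zero_iff, hA.norm_num hz, norm_ne_zero_iff]; exact hA.den_ne_zero hz

/-- The action of a fraction-linear map on the parameter of the unit circle. -/
def circleAct (A : SL(2, ℂ)) (t : UnitAddCircle) : UnitAddCircle :=
  circleParam (num A (unitPt t) / den A (unitPt t))

theorem CircleAut.unitPt_circleAct {A : SL(2, ℂ)} (hA : CircleAut A) (t : UnitAddCircle) :
    unitPt (circleAct A t) = num A (unitPt t) / den A (unitPt t) := by
  have hz := norm_unitPt' t
  rw [circleAct, unitPt_circleParam]
  rw [norm_div, hA.norm_num hz, div_self]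
  exact norm_ne_zero_iff.2 (hA.den_ne_zero hz)

theorem continuous_num (A : SL(2, ℂ)) : Continuous (num A) := by unfold num; fun_prop

theorem continuous_den (A : SL(2, ℂ)) : Continuous (den A) := by unfold den; fun_prop

theorem measurable_circleAct (A : SL(2, ℂ)) : Measurable (circleAct A) :=
  measurable_circleParam.comp
    (((continuous_num A).comp continuous_unitPt').measurable.div
      ((continuous_den A).comp continuous_unitPt').measurable)

theorem den_mul (A B : SL(2, ℂ)) {z : ℂ} (hz : den B z ≠ 0) :
    den (A * B) z = den A (num B z / den B z) * den B z := by
  have : den A (num B z / den B z) * den B z = A 1 0 * num B z + A 1 1 * den B z := by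
    rw [den]; field_simp
  rw [this]; simp only [num, den, mul_entries]; ring

theorem num_mul (A B : SL(2, ℂ)) {z : ℂ} (hz : den B z ≠ 0) :
    num (A * B) z = num A (num B z / den B z) * den B z := by
  have : num A (num B z / den B z) * den B z = A 0 0 * num B z + A 0 1 * den B z := by
    rw [num]; field_simp
  rw [this]; simp only [num, den, mul_entries]; ring

theorem den_one (z : ℂ) : den 1 z = 1 := by simp [den]

theorem num_one (z : ℂ) : num 1 z = z := by simp [num]

theorem CircleAut.circleAct_mul {A B : SL(2, ℂ)} (hB : CircleAut B)
    (t : UnitAddCircle) : circleAct (A * B) t = circleAct A (circleAct B t) := by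
  have hz := norm_unitPt' t
  have hd := hB.den_ne_zero hz
  unfold circleAct
  rw [num_mul A B hd, den_mul A B hd, mul_div_mul_right _ _ hd]
  have := hB.unitPt_circleAct t
  rw [circleAct] at this
  rw [this]

theorem circleAct_one (t : UnitAddCircle) : circleAct 1 t = t := by
  apply unitPt_injective
  rw [circleAct, num_one, den_one, div_one, unitPt_circleParam (norm_unitPt' t)]

theorem CircleAut.circleAct_inv_circleAct {A : SL(2, ℂ)} (hA : CircleAut A) (t : UnitAddCircle) :
    circleAct A⁻¹ (circleAct A t) = t := by
  rw [← hA.circleAct_mul, inv_mul_cancel, circleAct_one]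

theorem CircleAut.circleAct_circleAct_inv {A : SL(2, ℂ)} (hA : CircleAut A) (t : UnitAddCircle) :
    circleAct A (circleAct A⁻¹ t) = t := by
  rw [← hA.inv.circleAct_mul, mul_inv_cancel, circleAct_one]

theorem hasDerivAt_num_div_den (A : SL(2, ℂ)) {z : ℂ} (hz : den A z ≠ 0) :
    HasDerivAt (fun z => num A z / den A z) ((den A z ^ 2)⁻¹) z := by
  have h1 : HasDerivAt (num A) (A 0 0) z := by
    exact (((hasDerivAt_id z).const_mul (A 0 0)).add_const (A 0 1)).congr_deriv (mul_one _)
  have h2 : HasDerivAt (den A) (A 1 0) z := by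
    exact (((hasDerivAt_id z).const_mul (A 1 0)).add_const (A 1 1)).congr_deriv (mul_one _)
  refine (h1.div h2 hz).congr_deriv ?_
  rw [show A 0 0 * den A z - num A z * A 1 0 = 1 by linear_combination det_num_den A z, one_div]

/-- On the circle the conjugate of the denominator is ε · num / z; the Jacobian |den|⁻² thereby
becomes a rational function of z, accessible to contour integration. -/
theorem CircleAut.inv_normSq_den {A : SL(2, ℂ)} {ε : ℂ} (he : ε * ε = 1)
    (h : ∀ z : ℂ, ‖z‖ = 1 → num A z = ε * (z * (starRingEnd ℂ) (den A z)))
    {z : ℂ} (hz : ‖z‖ = 1) (hn : num A z ≠ 0) :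
    (((‖den A z‖ ^ 2)⁻¹ : ℝ) : ℂ) = ε * z / (num A z * den A z) := by
  have h1 : ((‖den A z‖ ^ 2 : ℝ) : ℂ) = den A z * (starRingEnd ℂ) (den A z) := by
    rw [Complex.mul_conj, Complex.normSq_eq_norm_sq]
  have hz0 : z ≠ 0 := by rintro rfl; simp at hz
  have he0 : ε ≠ 0 := by rintro rfl; simp at he
  have h2 := h z hz
  push_cast
  rw [← Complex.ofReal_pow, h1]
  have h3 : (starRingEnd ℂ) (den A z) = ε * num A z / z := by
    rw [h2]; field_simp; linear_combination -(starRingEnd ℂ) (den A z) * he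
  rw [h3]
  by_cases hd : den A z = 0
  · simp [hd]
  field_simp
  linear_combination -he

theorem norm_lt_of_diskAut {c d : ℂ} (h : ‖d‖ ^ 2 - ‖c‖ ^ 2 = 1) {z : ℂ} (hz : ‖z‖ ≤ 1) :
    c * z + d ≠ 0 := by
  intro h0
  have h1 : ‖d‖ = ‖c‖ * ‖z‖ := by
    rw [← norm_mul, eq_neg_of_add_eq_zero_right h0, norm_neg]
  have h2 : ‖d‖ ≤ ‖c‖ := by rw [h1]; exact mul_le_of_le_one_right (norm_nonneg _) hz
  nlinarith [norm_nonneg d, norm_nonneg c]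

/-- A Poisson kernel: on the circle 1/|cz + d|² is d/(cz + d) minus the conjugate of cz/(cz + d).
Both fractions are holomorphic on the closed disk, with values 1 and 0 at the centre. -/
theorem integral_inv_normSq {c d : ℂ} (h : ‖d‖ ^ 2 - ‖c‖ ^ 2 = 1) :
    ∫ t, (((‖c * unitPt t + d‖ ^ 2)⁻¹ : ℝ) : ℂ) ∂haar = 1 := by
  have hdiff : ∀ z : ℂ, ‖z‖ ≤ 1 → DifferentiableAt ℂ (fun z => d / (c * z + d)) z := fun z hz =>
    (differentiableAt_const _).div (by fun_prop) (norm_lt_of_diskAut h hz)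
  have hdiff' : ∀ z : ℂ, ‖z‖ ≤ 1 → DifferentiableAt ℂ (fun z => c * z / (c * z + d)) z :=
    fun z hz => (by fun_prop : DifferentiableAt ℂ (fun z => c * z) z).div (by fun_prop)
      (norm_lt_of_diskAut h hz)
  have hd0 : d ≠ 0 := by rintro rfl; simp at h; nlinarith [norm_nonneg c]
  have i1 := integral_unitPt_of_differentiable hdiff
  have i2 := integral_unitPt_of_differentiable hdiff'
  simp only [mul_zero, zero_add, zero_div, div_self hd0] at i1 i2
  have hint : ∀ G : ℂ → ℂ, (∀ z, ‖z‖ ≤ 1 → DifferentiableAt ℂ G z) →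
      Integrable (fun t => G (unitPt t)) haar := fun G hG => by
    have : Continuous fun t => G (unitPt t) := continuous_iff_continuousAt.2 fun t =>
      ContinuousAt.comp (hG _ (norm_unitPt' t).le).continuousAt continuous_unitPt'.continuousAt
    exact this.integrable_of_hasCompactSupport (HasCompactSupport.of_compactSpace _)
  have i3 : ∫ t, (starRingEnd ℂ) (c * unitPt t / (c * unitPt t + d)) ∂haar = 0 := by
    rw [integral_conj, i2, map_zero]
  rw [← i1, ← sub_zero (∫ t, d / (c * unitPt t + d) ∂haar), ← i3, ← integral_sub (hint _ hdiff)
    (by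
      have := (Complex.conjLIE.toContinuousLinearEquiv.toContinuousLinearMap).integrable_comp
        (hint _ hdiff')
      simpa using this)]
  refine integral_congr_ae (Filter.Eventually.of_forall fun t => ?_)
  have hz := norm_unitPt' t
  have hne := norm_lt_of_diskAut h hz.le
  have hne' : (starRingEnd ℂ) (c * unitPt t + d) ≠ 0 := (map_ne_zero _).2 hne
  have h1 : ((‖c * unitPt t + d‖ ^ 2 : ℝ) : ℂ) =
      (c * unitPt t + d) * (starRingEnd ℂ) (c * unitPt t + d) := by
    rw [Complex.mul_conj, Complex.normSq_eq_norm_sq]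
  have h2 : d * (starRingEnd ℂ) d - c * (starRingEnd ℂ) c = 1 := by
    rw [Complex.mul_conj, Complex.mul_conj, Complex.normSq_eq_norm_sq, Complex.normSq_eq_norm_sq]
    exact_mod_cast h
  have h3 : unitPt t * (starRingEnd ℂ) (unitPt t) = 1 := by
    rw [Complex.mul_conj, Complex.normSq_eq_norm_sq, hz]; simp
  simp only [Complex.ofReal_inv, h1, map_div₀]
  rw [inv_eq_one_div, div_sub_div _ _ hne hne', div_left_inj' (mul_ne_zero hne hne')]
  simp only [map_add, map_mul]
  linear_combination -h2 + c * (starRingEnd ℂ) c * h3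

theorem DiskAut.normSq {A : SL(2, ℂ)} (hA : DiskAut A) : ‖A 1 1‖ ^ 2 - ‖A 1 0‖ ^ 2 = 1 := by
  have := det_eq A
  rw [hA.1, hA.2, mul_comm, mul_comm ((starRingEnd ℂ) (A 1 0)), Complex.mul_conj, Complex.mul_conj,
    Complex.normSq_eq_norm_sq, Complex.normSq_eq_norm_sq] at this
  exact_mod_cast this

theorem DiskSwap.normSq {A : SL(2, ℂ)} (hA : DiskSwap A) : ‖A 1 0‖ ^ 2 - ‖A 1 1‖ ^ 2 = 1 := by
  have := det_eq A
  rw [hA.1, hA.2, mul_comm, mul_comm (-(starRingEnd ℂ) (A 1 0)), mul_neg, mul_neg,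
    Complex.mul_conj, Complex.mul_conj,
    Complex.normSq_eq_norm_sq, Complex.normSq_eq_norm_sq] at this
  have h : -‖A 1 1‖ ^ 2 - -‖A 1 0‖ ^ 2 = 1 := by exact_mod_cast this
  linarith

theorem CircleAut.integral_inv_normSq_den {A : SL(2, ℂ)} (hA : CircleAut A) :
    ∫ t, (((‖den A (unitPt t)‖ ^ 2)⁻¹ : ℝ) : ℂ) ∂haar = 1 := by
  rcases hA with hA | hA
  · exact integral_inv_normSq hA.normSq
  -- For a swap the denominator has its zero inside the disk; it is replaced by the numerator, which
  -- has the same modulus on the circle.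
  · have h := hA.normSq
    rw [← RCLike.norm_conj (A 1 0), ← RCLike.norm_conj (A 1 1)] at h
    rw [← integral_inv_normSq h]
    refine integral_congr_ae (Filter.Eventually.of_forall fun t => ?_)
    simp only
    congr 3
    rw [← hA.circleAut.norm_num (norm_unitPt' t), num, hA.1, hA.2, ← norm_neg]
    congr 1; ring

/-- With σ = num/den and σ' = den⁻², the integrand is z times the derivative of (ε/k) σ^k. -/
theorem CircleAut.integral_zpow {A : SL(2, ℂ)} (hA : CircleAut A) {k : ℤ} (hk : k ≠ 0) :
    ∫ t, unitPt (circleAct A t) ^ k * (((‖den A (unitPt t)‖ ^ 2)⁻¹ : ℝ) : ℂ) ∂haar = 0 := by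
  obtain ⟨ε, he, -, h⟩ := hA.exists_sign
  have hk' : (k : ℂ) ≠ 0 := by exact_mod_cast hk
  rw [← integral_unitPt_of_primitive (F := fun z => (num A z / den A z) ^ k *
    (ε * z / (num A z * den A z))) (G := fun z => ε / k * (num A z / den A z) ^ k)]
  · refine integral_congr_ae (Filter.Eventually.of_forall fun t => ?_)
    simp only
    rw [CircleAut.inv_normSq_den he h (norm_unitPt' t) (hA.num_ne_zero (norm_unitPt' t)),
      hA.unitPt_circleAct]
  · intro z hz
    have hd := hA.den_ne_zero hz
    have hn := hA.num_ne_zero hz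
    have hz0 : z ≠ 0 := by rintro rfl; simp at hz
    have h1 := ((hasDerivAt_zpow k (num A z / den A z) (Or.inl (div_ne_zero hn hd))).comp z
      (hasDerivAt_num_div_den A hd)).const_mul (ε / k)
    refine h1.congr_deriv ?_
    rw [zpow_sub_one₀ (div_ne_zero hn hd)]
    field_simp

theorem CircleAut.continuous_inv_den {A : SL(2, ℂ)} (hA : CircleAut A) :
    Continuous fun t : UnitAddCircle => (den A (unitPt t))⁻¹ :=
  ((continuous_den A).comp continuous_unitPt').inv₀ fun t => hA.den_ne_zero (norm_unitPt' t)

/-- Change of variables with Jacobian |den|⁻², checked on Fourier coefficients: the zeroth is the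
Poisson integral, the others have primitives. It is the reason why pull-back of half-forms is
isometric. -/
theorem CircleAut.map_withDensity {A : SL(2, ℂ)} (hA : CircleAut A) :
    (haar.withDensity fun t => ‖(den A (unitPt t))⁻¹‖ₑ ^ 2).map (circleAct A) = haar := by
  have hm : Measurable fun t : UnitAddCircle => ‖(den A (unitPt t))⁻¹‖₊ ^ 2 :=
    (hA.continuous_inv_den.nnnorm.pow 2).measurable
  have hfin : IsFiniteMeasure (haar.withDensity fun t => ‖(den A (unitPt t))⁻¹‖ₑ ^ 2) := by
    refine isFiniteMeasure_withDensity ?_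
    have hc : Continuous fun t : UnitAddCircle => ‖(den A (unitPt t))⁻¹‖₊ ^ 2 :=
      hA.continuous_inv_den.nnnorm.pow 2
    obtain ⟨M, hM⟩ := (isCompact_range hc).bddAbove
    refine ne_of_lt (lt_of_le_of_lt (lintegral_mono (g := fun _ => (M : ENNReal)) fun t => ?_) ?_)
    · have := hM ⟨t, rfl⟩
      simp only [enorm_eq_nnnorm] at this ⊢
      exact_mod_cast this
    · rw [lintegral_const, measure_univ, mul_one]; exact ENNReal.coe_lt_top
  refine ext_haar_of_fourier _ fun k => ?_
  rw [integral_map (measurable_circleAct A).aemeasurable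
    ((continuous_unitPt'.measurable.pow_const k).aestronglyMeasurable)]
  have e : (haar.withDensity fun t => ‖(den A (unitPt t))⁻¹‖ₑ ^ 2) =
      haar.withDensity fun t => ((‖(den A (unitPt t))⁻¹‖₊ ^ 2 : NNReal) : ENNReal) := by
    congr 1
  rw [e, integral_withDensity_eq_integral_smul hm]
  have e2 : ∀ t, (‖(den A (unitPt t))⁻¹‖₊ ^ 2 : NNReal) • unitPt (circleAct A t) ^ k =
      unitPt (circleAct A t) ^ k * (((‖den A (unitPt t)‖ ^ 2)⁻¹ : ℝ) : ℂ) := fun t => by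
    rw [NNReal.smul_def, Complex.real_smul, mul_comm]; simp
  simp only [e2]
  by_cases hk : k = 0
  · subst hk
    simp only [zpow_zero, one_mul]
    rw [hA.integral_inv_normSq_den]; simp
  · rw [hA.integral_zpow hk, integral_unitPt_of_primitive (F := fun z => z ^ k)
      (G := fun z => (k : ℂ)⁻¹ * z ^ k)]
    intro z hz
    have hz0 : z ≠ 0 := by rintro rfl; simp at hz
    have hk' : (k : ℂ) ≠ 0 := by exact_mod_cast hk
    refine ((hasDerivAt_zpow k z (Or.inl hz0)).const_mul (k : ℂ)⁻¹).congr_deriv ?_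
    rw [zpow_sub_one₀ hz0]; field_simp

theorem CircleAut.lintegral_comp {A : SL(2, ℂ)} (hA : CircleAut A)
    {f : UnitAddCircle → ENNReal} (hf : Measurable f) :
    ∫⁻ t, ‖(den A (unitPt t))⁻¹‖ₑ ^ 2 * f (circleAct A t) ∂haar = ∫⁻ t, f t ∂haar := by
  conv_rhs => rw [← hA.map_withDensity]
  rw [lintegral_map hf (measurable_circleAct A)]
  exact (lintegral_withDensity_eq_lintegral_mul _
    ((hA.continuous_inv_den.enorm.measurable).pow_const 2)
    (hf.comp (measurable_circleAct A))).symm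

/-- The Jacobian never vanishes, so preimages of null sets are null; this makes composition well
defined on classes of functions. -/
theorem CircleAut.quasiMeasurePreserving {A : SL(2, ℂ)} (hA : CircleAut A) :
    Measure.QuasiMeasurePreserving (circleAct A) haar haar := by
  refine ⟨measurable_circleAct A, ?_⟩
  refine Measure.AbsolutelyContinuous.mk fun s hs h0 => ?_
  rw [Measure.map_apply (measurable_circleAct A) hs]
  have := hA.lintegral_comp (f := s.indicator 1) (measurable_one.indicator hs)
  rw [lintegral_indicator_one hs, h0] at this
  have := (lintegral_eq_zero_iff (((hA.continuous_inv_den.enorm.measurable).pow_const 2).mul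
      ((measurable_one.indicator hs).comp (measurable_circleAct A)))).1 this
  rw [measure_eq_zero_iff_ae_notMem]
  filter_upwards [this] with t ht hts
  have hd := hA.den_ne_zero (norm_unitPt' t)
  simp only [Pi.zero_apply, Pi.mul_apply, Function.comp_apply, Set.mem_preimage] at ht hts
  rw [Set.indicator_of_mem hts] at ht
  simp [hd] at ht

end HalfForm
end

noncomputable section
namespace HalfForm

/-! ### Fourier coefficients of half-forms -/

theorem coeFn_fourierLp_two (k : ℤ) :
    (fourierLp 2 k : L2) =ᵐ[haar] fun t => unitPt t ^ k := by
  filter_upwards [coeFn_fourierLp (T := 1) 2 k] with t ht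
  rw [ht, fourier_eq_zpow]

theorem inner_fourierLp (k : ℤ) (f : L2) :
    inner ℂ (fourierLp 2 k : L2) f = ∫ t, unitPt t ^ (-k) * f t ∂haar := by
  rw [L2.inner_def]
  refine integral_congr_ae ?_
  filter_upwards [coeFn_fourierLp_two k] with t ht
  rw [ht, RCLike.inner_apply, map_zpow₀, conj_unitPt, mul_comm, inv_zpow, zpow_neg]

theorem inner_fourierLp_fourierLp (k m : ℤ) :
    inner ℂ (fourierLp 2 k : L2) (fourierLp 2 m : L2) = if k = m then 1 else 0 :=
  orthonormal_iff_ite.1 (orthonormal_fourier (T := 1)) k m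

theorem hasSum_inner_fourierLp (f : L2) :
    HasSum (fun k : ℤ => inner ℂ (fourierLp 2 k : L2) f • (fourierLp 2 k : L2)) f := by
  have := (fourierBasis (T := 1)).hasSum_repr f
  simpa only [HilbertBasis.repr_apply_apply, coe_fourierBasis] using this

/-- Fourier coefficients are continuous functionals, which gives one direction; for the other, the
Fourier series of f converges to f and only its terms with P remain. -/
theorem mem_closure_span_fourierLp (P : ℤ → Prop) (f : L2) :
    f ∈ (Submodule.span ℂ {f : L2 | ∃ k : ℤ, P k ∧ f = fourierLp 2 k}).topologicalClosure ↔
      ∀ k, ¬ P k → inner ℂ (fourierLp 2 k : L2) f = 0 := by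
  constructor
  · intro hf k hk
    have hcl : IsClosed {f : L2 | inner ℂ (fourierLp 2 k : L2) f = 0} :=
      isClosed_eq (by fun_prop) continuous_const
    refine closure_minimal (fun g hg => ?_) hcl hf
    induction hg using Submodule.span_induction with
    | mem x hx =>
      obtain ⟨m, hm, rfl⟩ := hx
      rw [Set.mem_ofPred_eq, inner_fourierLp_fourierLp, if_neg]
      rintro rfl; exact hk hm
    | zero => simp
    | add x y _ _ hx hy =>
      rw [Set.mem_ofPred_eq] at *; rw [inner_add_right, hx, hy, add_zero]
    | smul a x _ hx =>
      rw [Set.mem_ofPred_eq] at *; rw [inner_smul_right, hx, mul_zero]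
  · intro h
    refine isClosed_closure.mem_of_tendsto (hasSum_inner_fourierLp f)
      (Filter.Eventually.of_forall fun s => subset_closure ?_)
    refine Submodule.sum_mem _ fun k _ => ?_
    by_cases hk : P k
    · exact Submodule.smul_mem _ _ (Submodule.subset_span ⟨k, hk, rfl⟩)
    · rw [h k hk, zero_smul]; exact Submodule.zero_mem _

theorem mem_Lplus_iff {f : L2} :
    f ∈ Lplus ↔ ∀ k : ℤ, k < 0 → inner ℂ (fourierLp 2 k : L2) f = 0 := by
  rw [Lplus, mem_closure_span_fourierLp]; simp only [not_le]

theorem mem_Lminus_iff {f : L2} :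
    f ∈ Lminus ↔ ∀ k : ℤ, 0 ≤ k → inner ℂ (fourierLp 2 k : L2) f = 0 := by
  rw [Lminus, mem_closure_span_fourierLp]; simp only [not_lt]

theorem fourierLp_mem_Lplus {k : ℤ} (hk : 0 ≤ k) : (fourierLp 2 k : L2) ∈ Lplus :=
  subset_closure (Submodule.subset_span ⟨k, hk, rfl⟩)

theorem fourierLp_mem_Lminus {k : ℤ} (hk : k < 0) : (fourierLp 2 k : L2) ∈ Lminus :=
  subset_closure (Submodule.subset_span ⟨k, hk, rfl⟩)

theorem Lplus_le {V : Submodule ℂ L2} (hV : IsClosed (V : Set L2))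
    (h : ∀ k : ℤ, 0 ≤ k → (fourierLp 2 k : L2) ∈ V) : Lplus ≤ V :=
  Submodule.topologicalClosure_minimal _ (Submodule.span_le.2 (by
    rintro _ ⟨k, hk, rfl⟩; exact h k hk)) hV

theorem Lminus_le {V : Submodule ℂ L2} (hV : IsClosed (V : Set L2))
    (h : ∀ k : ℤ, k < 0 → (fourierLp 2 k : L2) ∈ V) : Lminus ≤ V :=
  Submodule.topologicalClosure_minimal _ (Submodule.span_le.2 (by
    rintro _ ⟨k, hk, rfl⟩; exact h k hk)) hV

theorem isClosed_Lplus : IsClosed (Lplus : Set L2) := Submodule.isClosed_topologicalClosure _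

theorem isClosed_Lminus : IsClosed (Lminus : Set L2) := Submodule.isClosed_topologicalClosure _

theorem Lplus_orthogonal : Lplusᗮ = Lminus := by
  refine le_antisymm (fun f hf => ?_) ?_
  · exact mem_Lminus_iff.2 fun k hk => hf _ (fourierLp_mem_Lplus hk)
  · refine Lminus_le (Submodule.isClosed_orthogonal _) fun k hk => ?_
    rw [Submodule.mem_orthogonal']
    intro u hu
    exact mem_Lplus_iff.1 hu k hk

theorem Lminus_orthogonal : Lminusᗮ = Lplus := by
  rw [← Lplus_orthogonal, Submodule.orthogonal_orthogonal]

theorem plusPart_add_minusPart (f : L2) : (plusPart f : L2) + minusPart f = f := by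
  have h1 : f - plusPart f ∈ Lminus := by
    rw [← Lplus_orthogonal]
    exact Submodule.sub_starProjection_mem_orthogonal f
  have h2 : f - (f - plusPart f) ∈ Lminusᗮ := by
    rw [Lminus_orthogonal, sub_sub_cancel]; exact (plusPart f).2
  have h3 : (minusPart f : L2) = f - plusPart f :=
    Submodule.eq_starProjection_of_mem_orthogonal h1 h2
  rw [h3]; abel

theorem plusPart_coe (f : Lplus) : plusPart (f : L2) = f :=
  Submodule.orthogonalProjectionOnto_mem_subspace_eq_self f

theorem minusPart_coe (f : Lminus) : minusPart (f : L2) = f :=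
  Submodule.orthogonalProjectionOnto_mem_subspace_eq_self f

theorem plusPart_Lminus {f : L2} (hf : f ∈ Lminus) : plusPart f = 0 := by
  rw [plusPart, Submodule.orthogonalProjectionOnto_eq_zero_iff, Lplus_orthogonal]; exact hf

theorem minusPart_Lplus {f : L2} (hf : f ∈ Lplus) : minusPart f = 0 := by
  rw [minusPart, Submodule.orthogonalProjectionOnto_eq_zero_iff, Lminus_orthogonal]; exact hf

theorem plusPart_of_mem {f : L2} (hf : f ∈ Lplus) : (plusPart f : L2) = f :=
  congrArg Subtype.val (plusPart_coe ⟨f, hf⟩)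

theorem minusPart_of_mem {f : L2} (hf : f ∈ Lminus) : (minusPart f : L2) = f :=
  congrArg Subtype.val (minusPart_coe ⟨f, hf⟩)

theorem norm_plusPart_le (f : L2) : ‖plusPart f‖ ≤ ‖f‖ :=
  Submodule.norm_orthogonalProjectionOnto_apply_le _ f

theorem norm_minusPart_le (f : L2) : ‖minusPart f‖ ≤ ‖f‖ :=
  Submodule.norm_orthogonalProjectionOnto_apply_le _ f

/-! ### Pull-back of half-forms by fraction-linear maps -/

theorem CircleAut.ae_comp {A : SL(2, ℂ)} (hA : CircleAut A) {f g : UnitAddCircle → ℂ}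
    (h : f =ᵐ[haar] g) : (fun t => f (circleAct A t)) =ᵐ[haar] fun t => g (circleAct A t) :=
  hA.quasiMeasurePreserving.ae_eq_comp h

theorem CircleAut.eLpNorm_pull {A : SL(2, ℂ)} (hA : CircleAut A) (f : L2) :
    eLpNorm (fun t => (den A (unitPt t))⁻¹ * f (circleAct A t)) 2 haar = eLpNorm f 2 haar := by
  have e2 : ∀ g : UnitAddCircle → ℂ, eLpNorm g 2 haar =
      (∫⁻ t, ‖g t‖ₑ ^ ((2 : NNReal) : ℝ) ∂haar) ^ (1 / ((2 : NNReal) : ℝ)) := fun g =>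
    eLpNorm_nnreal_eq_lintegral (p := 2) two_ne_zero
  rw [e2, e2]
  congr 1
  have := hA.lintegral_comp (f := fun t => ‖f t‖ₑ ^ ((2 : NNReal) : ℝ))
    ((Lp.stronglyMeasurable f).measurable.enorm.pow_const _)
  rw [← this]
  refine lintegral_congr fun t => ?_
  rw [enorm_mul, ENNReal.mul_rpow_of_nonneg _ _ (by simp)]
  congr 1
  simp

theorem CircleAut.memLp_pull {A : SL(2, ℂ)} (hA : CircleAut A) (f : L2) :
    MemLp (fun t => (den A (unitPt t))⁻¹ * f (circleAct A t)) 2 haar := by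
  refine ⟨?_, ?_⟩
  · exact (hA.continuous_inv_den.measurable.mul
      ((Lp.stronglyMeasurable f).measurable.comp (measurable_circleAct A))).aestronglyMeasurable
  · rw [hA.eLpNorm_pull]; exact (Lp.memLp f).2

/-- The pull-back of half-forms on the unit circle by a fraction-linear map that preserves it. -/
def pull {A : SL(2, ℂ)} (hA : CircleAut A) : L2 →ₗᵢ[ℂ] L2 where
  toFun f := (hA.memLp_pull f).toLp _
  map_add' f g := by
    rw [← MemLp.toLp_add]
    refine MemLp.toLp_congr _ _ ?_
    filter_upwards [hA.ae_comp (Lp.coeFn_add f g)] with t ht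
    simp only [Pi.add_apply] at ht ⊢
    rw [ht, mul_add]
  map_smul' c f := by
    rw [RingHom.id_apply, ← MemLp.toLp_const_smul]
    refine MemLp.toLp_congr _ _ ?_
    filter_upwards [hA.ae_comp (Lp.coeFn_smul c f)] with t ht
    simp only [Pi.smul_apply, smul_eq_mul] at ht ⊢
    rw [ht]; ring
  norm_map' f := by
    change ‖(hA.memLp_pull f).toLp _‖ = ‖f‖
    rw [Lp.norm_toLp, hA.eLpNorm_pull, Lp.norm_def]

theorem coeFn_pull {A : SL(2, ℂ)} (hA : CircleAut A) (f : L2) :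
    pull hA f =ᵐ[haar] fun t => (den A (unitPt t))⁻¹ * f (circleAct A t) :=
  MemLp.coeFn_toLp (hA.memLp_pull f)

/-- The two weights multiply by the cocycle rule `den_mul` to the denominator of the identity
matrix. -/
theorem pull_inv_pull {A : SL(2, ℂ)} (hA : CircleAut A) (f : L2) :
    pull hA.inv (pull hA f) = f := by
  refine Lp.ext ?_
  filter_upwards [coeFn_pull hA.inv (pull hA f), hA.inv.ae_comp (coeFn_pull hA f)] with t h1 h2
  have hz := norm_unitPt' t
  rw [h1, h2, hA.circleAct_circleAct_inv, hA.inv.unitPt_circleAct]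
  have h3 := den_mul A A⁻¹ (hA.inv.den_ne_zero hz)
  rw [mul_inv_cancel, den_one] at h3
  rw [← mul_assoc, ← mul_inv, mul_comm (den A⁻¹ _), ← h3, inv_one, one_mul]

theorem pull_pull_inv {A : SL(2, ℂ)} (hA : CircleAut A) (f : L2) :
    pull hA (pull hA.inv f) = f := by
  refine Lp.ext ?_
  filter_upwards [coeFn_pull hA (pull hA.inv f), hA.ae_comp (coeFn_pull hA.inv f)] with t h1 h2
  have hz := norm_unitPt' t
  rw [h1, h2, hA.circleAct_inv_circleAct, hA.unitPt_circleAct]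
  have h3 := den_mul A⁻¹ A (hA.den_ne_zero hz)
  rw [inv_mul_cancel, den_one] at h3
  rw [← mul_assoc, ← mul_inv, mul_comm (den A _), ← h3, inv_one, one_mul]

theorem inner_pull {A : SL(2, ℂ)} (hA : CircleAut A) (f g : L2) :
    inner ℂ f (pull hA g) = inner ℂ (pull hA.inv f) g := by
  rw [← (pull hA).inner_map_map (pull hA.inv f) g, pull_pull_inv]

theorem inner_pull_inv {A : SL(2, ℂ)} (hA : CircleAut A) (f g : L2) :
    inner ℂ f (pull hA.inv g) = inner ℂ (pull hA f) g := by
  rw [← (pull hA).inner_map_map f (pull hA.inv g), pull_pull_inv]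

theorem inner_fourierLp_pull {A : SL(2, ℂ)} (hA : CircleAut A) (k n : ℤ) :
    inner ℂ (fourierLp 2 k : L2) (pull hA (fourierLp 2 n)) =
      ∫ t, unitPt t ^ (-k) * ((den A (unitPt t))⁻¹ *
        (num A (unitPt t) / den A (unitPt t)) ^ n) ∂haar := by
  rw [inner_fourierLp]
  refine integral_congr_ae ?_
  filter_upwards [coeFn_pull hA (fourierLp 2 n), hA.ae_comp (coeFn_fourierLp_two n)] with t h1 h2
  rw [h1, h2, hA.unitPt_circleAct]

theorem isClosed_comap_pull {A : SL(2, ℂ)} (hA : CircleAut A) {V : Submodule ℂ L2}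
    (hV : IsClosed (V : Set L2)) : IsClosed (V.comap (pull hA).toLinearMap : Set L2) :=
  hV.preimage (pull hA).continuous

theorem DiskAut.den_ne_zero {A : SL(2, ℂ)} (hA : DiskAut A) {z : ℂ} (hz : ‖z‖ ≤ 1) :
    den A z ≠ 0 := norm_lt_of_diskAut hA.normSq hz

theorem DiskSwap.num_ne_zero {A : SL(2, ℂ)} (hA : DiskSwap A) {z : ℂ} (hz : ‖z‖ ≤ 1) :
    num A z ≠ 0 := by
  refine norm_lt_of_diskAut ?_ hz
  rw [hA.1, hA.2, norm_neg, norm_neg, RCLike.norm_conj, RCLike.norm_conj]; exact hA.normSq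

theorem differentiable_num (A : SL(2, ℂ)) : Differentiable ℂ (num A) := by unfold num; fun_prop

theorem differentiable_den (A : SL(2, ℂ)) : Differentiable ℂ (den A) := by unfold den; fun_prop

/-- The pull-back den⁻¹ (num/den)^n of z^n is holomorphic on the closed disk, where den has no
zeros. A coefficient of negative frequency k is the mean value of this function times z^{-k}, whose
value at 0 vanishes since -k ≥ 1. -/
theorem DiskAut.pull_mem_Lplus {A : SL(2, ℂ)} (hA : DiskAut A) {f : L2} (hf : f ∈ Lplus) :
    pull hA.circleAut f ∈ Lplus := by
  refine Lplus_le (isClosed_comap_pull hA.circleAut isClosed_Lplus) (fun n hn => ?_) hf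
  refine mem_Lplus_iff.2 fun k hk => ?_
  refine (inner_fourierLp_pull _ k n).trans ?_
  obtain ⟨n, rfl⟩ := Int.eq_ofNat_of_zero_le hn
  obtain ⟨m, hm⟩ := Int.eq_ofNat_of_zero_le (show 0 ≤ -k - 1 by omega)
  have hm' : -k = ((m + 1 : ℕ) : ℤ) := by push_cast; omega
  simp only [hm', zpow_natCast]
  rw [integral_unitPt_of_differentiable (F := fun z => z ^ (m + 1) * ((den A z)⁻¹ *
    (num A z / den A z) ^ n))]
  · simp
  · intro z hz
    have hd := hA.den_ne_zero hz
    have h1 := differentiable_num A z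
    have h2 := differentiable_den A z
    fun_prop (disch := assumption)

/-- L₂⁻ is the orthogonal complement of L₂⁺, and the adjoint of the pull-back is the pull-back by
the inverse, which preserves L₂⁺. -/
theorem DiskAut.pull_mem_Lminus {A : SL(2, ℂ)} (hA : DiskAut A) {f : L2} (hf : f ∈ Lminus) :
    pull hA.circleAut f ∈ Lminus := by
  rw [← Lplus_orthogonal] at hf ⊢
  intro g hg
  rw [inner_pull]
  exact hf _ (hA.inv.pull_mem_Lplus hg)

/-- The pull-back of z^{-p-1} is den^p / num^{p+1}, and for a swap it is the numerator that has no
zeros on the closed disk. -/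
theorem DiskSwap.pull_mem_Lplus {A : SL(2, ℂ)} (hA : DiskSwap A) {f : L2} (hf : f ∈ Lminus) :
    pull hA.circleAut f ∈ Lplus := by
  refine Lminus_le (isClosed_comap_pull hA.circleAut isClosed_Lplus) (fun n hn => ?_) hf
  refine mem_Lplus_iff.2 fun k hk => ?_
  refine (inner_fourierLp_pull _ k n).trans ?_
  obtain ⟨p, hp⟩ := Int.eq_ofNat_of_zero_le (show 0 ≤ -n - 1 by omega)
  obtain ⟨m, hm⟩ := Int.eq_ofNat_of_zero_le (show 0 ≤ -k - 1 by omega)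
  have hm' : -k = ((m + 1 : ℕ) : ℤ) := by push_cast; omega
  have hp' : n = -((p + 1 : ℕ) : ℤ) := by push_cast; omega
  simp only [hm', hp', zpow_neg, zpow_natCast]
  refine (integral_congr_ae (Filter.Eventually.of_forall fun t => ?_)).trans
    ((integral_unitPt_of_differentiable (F := fun z => z ^ (m + 1) * (den A z ^ p *
      (num A z ^ (p + 1))⁻¹)) ?_).trans ?_)
  · have hd := hA.circleAut.den_ne_zero (norm_unitPt' t)
    have hn := hA.circleAut.num_ne_zero (norm_unitPt' t)
    rw [div_pow]
    field_simp
    ring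
  · intro z hz
    have hd := pow_ne_zero (p + 1) (hA.num_ne_zero hz)
    have h1 := differentiable_num A z
    have h2 := differentiable_den A z
    fun_prop (disch := assumption)
  · simp

theorem DiskSwap.pull_mem_Lminus {A : SL(2, ℂ)} (hA : DiskSwap A) {f : L2} (hf : f ∈ Lplus) :
    pull hA.circleAut f ∈ Lminus := by
  refine Lplus_le (isClosed_comap_pull hA.circleAut isClosed_Lminus) (fun n hn => ?_) hf
  refine mem_Lminus_iff.2 fun k hk => ?_
  refine (inner_fourierLp_pull _ k n).trans ?_
  obtain ⟨n, rfl⟩ := Int.eq_ofNat_of_zero_le hn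
  obtain ⟨k, rfl⟩ := Int.eq_ofNat_of_zero_le hk
  simp only [zpow_natCast]
  -- On the circle conjugation exchanges den and num, up to the factor -1/z; the conjugated
  -- integrand is therefore holomorphic on the disk and vanishes at 0.
  rw [← map_eq_zero (starRingEnd ℂ), ← integral_conj]
  refine (integral_congr_ae (Filter.Eventually.of_forall fun t => ?_)).trans
    ((integral_unitPt_of_differentiable (F := fun z => -1 * (z ^ (k + 1) * (den A z ^ n *
      (num A z ^ (n + 1))⁻¹))) ?_).trans ?_)
  · have hz := unitPt_ne_zero t
    have hd := hA.circleAut.den_ne_zero (norm_unitPt' t)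
    have hn := hA.circleAut.num_ne_zero (norm_unitPt' t)
    have h1 : (starRingEnd ℂ) (den A (unitPt t)) = -num A (unitPt t) / unitPt t := by
      rw [hA.num_eq (norm_unitPt' t), neg_neg, mul_div_cancel_left₀ _ hz]
    have h2 : (starRingEnd ℂ) (num A (unitPt t)) = -den A (unitPt t) / unitPt t := by
      rw [hA.num_eq (norm_unitPt' t), map_neg, map_mul, Complex.conj_conj, conj_unitPt]
      field_simp
    simp only [map_mul, map_inv₀, map_pow, map_div₀, h1, h2, conj_unitPt, zpow_neg,
      zpow_natCast, inv_pow, inv_inv]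
    rw [div_div_div_cancel_right₀ hz, neg_div_neg_eq, div_pow]
    field_simp
    ring
  · intro z hz
    have hd := pow_ne_zero (n + 1) (hA.num_ne_zero hz)
    have h1 := differentiable_num A z
    have h2 := differentiable_den A z
    fun_prop (disch := assumption)
  · simp

end HalfForm
end

noncomputable section
namespace HalfForm

/-! ### Points of the Riemann sphere -/

theorem moebius_coe (A : SL(2, ℂ)) (z : ℂ) :
    moebius A (z : Sphere) = if den A z = 0 then OnePoint.infty else ((num A z / den A z : ℂ) : Sphere) := by
  unfold moebius
  rw [OnePoint.smul_some_eq_ite]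
  rfl

theorem moebius_of_den_ne_zero {A : SL(2, ℂ)} {z : ℂ} (h : den A z ≠ 0) :
    moebius A (z : Sphere) = ((num A z / den A z : ℂ) : Sphere) := by
  rw [moebius_coe, if_neg h]

theorem moebius_mul (A B : SL(2, ℂ)) (x : Sphere) :
    moebius (A * B) x = moebius A (moebius B x) := by
  unfold moebius
  rw [map_mul, mul_smul]

theorem moebius_one (x : Sphere) : moebius 1 x = x := by
  unfold moebius
  rw [map_one, one_smul]

theorem moebius_inv_moebius (A : SL(2, ℂ)) (x : Sphere) : moebius A⁻¹ (moebius A x) = x := by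
  rw [← moebius_mul, inv_mul_cancel, moebius_one]

theorem moebius_moebius_inv (A : SL(2, ℂ)) (x : Sphere) : moebius A (moebius A⁻¹ x) = x := by
  rw [← moebius_mul, mul_inv_cancel, moebius_one]

theorem moebius_injective (A : SL(2, ℂ)) : Function.Injective (moebius A) :=
  Function.LeftInverse.injective (moebius_inv_moebius A)

theorem moebius_eq_coe {A : SL(2, ℂ)} {z w : ℂ} (h : moebius A (z : Sphere) = (w : Sphere)) :
    den A z ≠ 0 ∧ num A z / den A z = w := by
  rw [moebius_coe] at h
  split_ifs at h with h0
  · exact absurd h.symm (OnePoint.coe_ne_infty w)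
  · exact ⟨h0, OnePoint.coe_injective h⟩

theorem num_den_ne_zero {A : SL(2, ℂ)} {z : ℂ} (h : den A z = 0) : num A z ≠ 0 := by
  intro h1
  have := det_num_den A z
  rw [h, h1] at this; simp at this

/-! ### Matrices recognized by their action on the unit circle -/

/-- A fraction-linear map that preserves the unit circle as a set lies in `SU(1, 1)` or in its other
coset. -/
theorem circleAut_of_norm_eq {A : SL(2, ℂ)} (h : ∀ z : ℂ, ‖z‖ = 1 → ‖num A z‖ = ‖den A z‖) :
    CircleAut A := by
  have key : ∀ z : ℂ, ‖z‖ = 1 → Complex.normSq (num A z) = Complex.normSq (den A z) := fun z hz => by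
    rw [Complex.normSq_eq_norm_sq, Complex.normSq_eq_norm_sq, h z hz]
  have k1 := key 1 (by simp)
  have k2 := key (-1) (by simp)
  have k3 := key Complex.I (by simp)
  have k4 := key (-Complex.I) (by simp)
  have hd := det_eq A
  unfold num den at k1 k2 k3 k4
  set a := A 0 0
  set b := A 0 1
  set c := A 1 0
  set d := A 1 1
  -- Comparing |az + b|² and |cz + d|² at 1 and -1 gives the real part of the cross term, at i and
  -- -i the imaginary part.
  have e1 : a * (starRingEnd ℂ) b = c * (starRingEnd ℂ) d := by
    apply Complex.ext
    · simp [Complex.normSq_apply] at k1 k2 ⊢; linarith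
    · simp [Complex.normSq_apply] at k3 k4 ⊢; linarith
  have e2 : a * (starRingEnd ℂ) a + b * (starRingEnd ℂ) b =
      c * (starRingEnd ℂ) c + d * (starRingEnd ℂ) d := by
    simp only [Complex.mul_conj]
    have : Complex.normSq a + Complex.normSq b = Complex.normSq c + Complex.normSq d := by
      simp [Complex.normSq_apply] at k1 k2 ⊢; linarith
    exact_mod_cast this
  have e1' := congrArg (starRingEnd ℂ) e1
  have hd' := congrArg (starRingEnd ℂ) hd
  simp only [map_mul, map_sub, map_one, Complex.conj_conj] at e1' hd'
  -- The factor by which the first row differs from the one that the second row would have in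
  -- SU(1,1). It is real with x² = 1, and its sign selects the coset.
  set x : ℂ := a * (starRingEnd ℂ) a - c * (starRingEnd ℂ) c with hx
  have ha : a = x * (starRingEnd ℂ) d := by
    rw [hx]; linear_combination (-a) * hd' - (starRingEnd ℂ) c * e1
  have hb : b = x * (starRingEnd ℂ) c := by
    rw [hx]; linear_combination (-b) * hd' + (starRingEnd ℂ) d * e1' - (starRingEnd ℂ) c * e2
  have hxr : (starRingEnd ℂ) x = x := by rw [hx]; simp; ring
  have e3 : (x * x - 1) * (c * (starRingEnd ℂ) c + d * (starRingEnd ℂ) d) = 0 := by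
    have h1 := e2
    rw [ha, hb] at h1
    simp only [map_mul, Complex.conj_conj, hxr] at h1
    linear_combination h1
  have e4 : c * (starRingEnd ℂ) c + d * (starRingEnd ℂ) d ≠ 0 := by
    rw [Complex.mul_conj, Complex.mul_conj]
    intro h0
    have h1 : Complex.normSq c + Complex.normSq d = 0 := by exact_mod_cast h0
    have h2 := Complex.normSq_nonneg c
    have h3 := Complex.normSq_nonneg d
    have h4 : c = 0 := Complex.normSq_eq_zero.1 (by linarith)
    have h5 : d = 0 := Complex.normSq_eq_zero.1 (by linarith)
    rw [h4, h5] at hd; simp at hd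
  have e5 : (x - 1) * (x + 1) = 0 := by
    linear_combination (mul_eq_zero.1 e3).resolve_right e4
  rcases mul_eq_zero.1 e5 with h1 | h1
  · refine Or.inl ⟨?_, ?_⟩
    · change a = _; rw [ha, sub_eq_zero.1 h1, one_mul]
    · change b = _; rw [hb, sub_eq_zero.1 h1, one_mul]
  · refine Or.inr ⟨?_, ?_⟩
    · change a = _; rw [ha, eq_neg_of_add_eq_zero_left h1, neg_one_mul]
    · change b = _; rw [hb, eq_neg_of_add_eq_zero_left h1, neg_one_mul]

/-- The image of the centre of the disk decides between the two cosets. -/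
theorem diskAut_of_norm_eq {A : SL(2, ℂ)} (h : ∀ z : ℂ, ‖z‖ = 1 → ‖num A z‖ = ‖den A z‖)
    (h0 : ‖A 0 1‖ < ‖A 1 1‖) : DiskAut A := by
  refine (circleAut_of_norm_eq h).resolve_right fun hs => ?_
  have := hs.normSq
  rw [hs.2, norm_neg, RCLike.norm_conj] at h0
  nlinarith [norm_nonneg (A 1 0), norm_nonneg (A 1 1)]

theorem diskSwap_of_norm_eq {A : SL(2, ℂ)} (h : ∀ z : ℂ, ‖z‖ = 1 → ‖num A z‖ = ‖den A z‖)
    (h0 : ‖A 1 1‖ < ‖A 0 1‖) : DiskSwap A := by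
  refine (circleAut_of_norm_eq h).resolve_left fun hs => ?_
  have := hs.normSq
  rw [hs.2, RCLike.norm_conj] at h0
  nlinarith [norm_nonneg (A 1 0), norm_nonneg (A 1 1)]

theorem DiskAut.normSq_sub {A : SL(2, ℂ)} (hA : DiskAut A) (z : ℂ) :
    ‖den A z‖ ^ 2 - ‖num A z‖ ^ 2 = 1 - ‖z‖ ^ 2 := by
  have h1 := hA.normSq
  simp only [← Complex.normSq_eq_norm_sq] at h1 ⊢
  unfold num den
  rw [hA.1, hA.2]
  generalize A 1 0 = c at *
  generalize A 1 1 = d at *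
  simp only [Complex.normSq_apply, Complex.add_re, Complex.mul_re, Complex.conj_re, Complex.conj_im,
    Complex.add_im, Complex.mul_im] at h1 ⊢
  linear_combination (1 - (z.re * z.re + z.im * z.im)) * h1

/-! ### Normal form of a pair of disjoint disks -/

/-- The map `z ↦ e ^ l / z`. -/
def tubeMat (l : ℝ) : SL(2, ℂ) :=
  ⟨!![0, Complex.I * Real.exp (l / 2); Complex.I * Real.exp (-(l / 2)), 0], by
    rw [Matrix.det_fin_two_of]
    have : (Real.exp (l / 2) : ℂ) * Real.exp (-(l / 2)) = 1 := by
      rw [← Complex.ofReal_mul, ← Real.exp_add]; simp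
    linear_combination -Complex.I * Complex.I * this - Complex.I_mul_I⟩

theorem tubeMat_entries (l : ℝ) : tubeMat l 0 0 = 0 ∧ tubeMat l 0 1 = Complex.I * Real.exp (l / 2) ∧
    tubeMat l 1 0 = Complex.I * Real.exp (-(l / 2)) ∧ tubeMat l 1 1 = 0 := by
  simp [tubeMat]

/-- The element of `SU(1, 1)` with lower row `(c, d)`. -/
def diskMat (c d : ℂ) (h : ‖d‖ ^ 2 - ‖c‖ ^ 2 = 1) : SL(2, ℂ) :=
  ⟨!![(starRingEnd ℂ) d, (starRingEnd ℂ) c; c, d], by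
    rw [Matrix.det_fin_two_of, mul_comm, mul_comm ((starRingEnd ℂ) c), Complex.mul_conj,
      Complex.mul_conj, Complex.normSq_eq_norm_sq, Complex.normSq_eq_norm_sq]
    exact_mod_cast h⟩

theorem diskMat_entries (c d : ℂ) (h : ‖d‖ ^ 2 - ‖c‖ ^ 2 = 1) :
    diskMat c d h 0 0 = (starRingEnd ℂ) d ∧ diskMat c d h 0 1 = (starRingEnd ℂ) c ∧
    diskMat c d h 1 0 = c ∧ diskMat c d h 1 1 = d := by
  simp [diskMat]

theorem diskAut_diskMat (c d : ℂ) (h : ‖d‖ ^ 2 - ‖c‖ ^ 2 = 1) : DiskAut (diskMat c d h) := by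
  obtain ⟨h1, h2, h3, h4⟩ := diskMat_entries c d h
  unfold DiskAut
  rw [h1, h2, h3, h4]; exact ⟨rfl, rfl⟩

/-- Two disjoint disks can be mapped to the unit disk and the exterior of a concentric one. -/
theorem exists_tube_decomposition {M : SL(2, ℂ)} (hM : ∀ z : ℂ, ‖z‖ ≤ 1 → ‖den M z‖ < ‖num M z‖) :
    ∃ (A B : SL(2, ℂ)) (l : ℝ), DiskAut A ∧ DiskAut B ∧ 0 < l ∧ M = A * tubeMat l * B := by
  set a := M 0 0 with ha
  set b := M 0 1 with hb
  set c := M 1 0 with hc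
  set d := M 1 1 with hd
  have hdet : a * d - b * c = 1 := det_eq M
  -- p, q, s are the coefficients of the Hermitian form |ax + by|² − |cx + dy|², to be diagonalized
  -- simultaneously with |x|² − |y|². The hypothesis makes it positive at (z, 1) for |z| ≤ 1.
  set p : ℝ := Complex.normSq a - Complex.normSq c with hp
  set s : ℝ := Complex.normSq b - Complex.normSq d with hs
  set q : ℂ := (starRingEnd ℂ) a * b - (starRingEnd ℂ) c * d with hq
  have hform : ∀ x y : ℂ, Complex.normSq (a * x + b * y) - Complex.normSq (c * x + d * y) =
      p * Complex.normSq x + 2 * (q * ((starRingEnd ℂ) x * y)).re + s * Complex.normSq y := by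
    intro x y
    rw [hp, hs, hq]
    simp only [Complex.normSq_apply, Complex.add_re, Complex.mul_re, Complex.conj_re,
      Complex.conj_im, Complex.add_im, Complex.mul_im, Complex.sub_re, Complex.sub_im]
    ring
  -- The determinant of the form: that of |x|² − |y|², multiplied by |det M|² = 1.
  have hps : p * s - Complex.normSq q = -1 := by
    have h1 : Complex.normSq (a * d - b * c) = 1 := by rw [hdet]; simp
    rw [← h1, hp, hs, hq]
    simp only [Complex.normSq_apply, Complex.mul_re, Complex.conj_re, Complex.conj_im,
      Complex.mul_im, Complex.sub_re, Complex.sub_im]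
    ring
  have hpos : ∀ z : ℂ, ‖z‖ ≤ 1 → 0 < p * Complex.normSq z + 2 * (q * (starRingEnd ℂ) z).re + s := by
    intro z hz
    have h1 := hform z 1
    rw [mul_one, mul_one, mul_one, map_one, mul_one] at h1
    rw [← h1, Complex.normSq_eq_norm_sq, Complex.normSq_eq_norm_sq]
    have h2 : ‖c * z + d‖ < ‖a * z + b‖ := hM z hz
    nlinarith [norm_nonneg (c * z + d)]
  have hq2 : Complex.normSq q = ‖q‖ ^ 2 := Complex.normSq_eq_norm_sq q
  have hs0 : 0 < s := by simpa using hpos 0 (by simp)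
  -- Positivity at the point of the unit circle where the cross term is most negative.
  have hpsq : 2 * ‖q‖ < p + s := by
    by_cases h0 : q = 0
    · have := hpos 1 (by simp)
      rw [h0] at this ⊢
      simp at this ⊢; linarith
    · have hn : ‖q‖ ≠ 0 := norm_ne_zero_iff.2 h0
      have := hpos (-q / (‖q‖ : ℝ)) (by
        rw [norm_div, norm_neg, Complex.norm_real, norm_norm, div_self hn])
      have h1 : q * (starRingEnd ℂ) (-q / (‖q‖ : ℝ)) = ((-‖q‖ : ℝ) : ℂ) := by
        rw [map_div₀, map_neg, Complex.conj_ofReal, mul_div_assoc', mul_neg, Complex.mul_conj, hq2]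
        have : (‖q‖ : ℂ) ≠ 0 := by exact_mod_cast hn
        push_cast; field_simp
      have h2 : Complex.normSq (-q / (‖q‖ : ℝ)) = 1 := by
        rw [Complex.normSq_eq_norm_sq, norm_div, norm_neg, Complex.norm_real, norm_norm,
          div_self hn, one_pow]
      rw [h1, h2, Complex.ofReal_re] at this
      linarith
  have hqn := norm_nonneg q
  -- Otherwise p > 0, the point z = -q/p lies in the closed disk, and the form has there the
  -- negative value (ps − |q|²)/p = −1/p.
  have hlt : p < s := by
    by_contra hcon
    have hp0 : 0 < p := by linarith
    have h1 : ‖-q / (p : ℂ)‖ ≤ 1 := by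
      rw [norm_div, norm_neg, Complex.norm_real, Real.norm_of_nonneg hp0.le, div_le_one hp0]
      linarith
    have h2 := hpos _ h1
    have h3 : q * (starRingEnd ℂ) (-q / (p : ℂ)) = ((-(Complex.normSq q / p) : ℝ) : ℂ) := by
      rw [map_div₀, map_neg, Complex.conj_ofReal, mul_div_assoc', mul_neg, Complex.mul_conj]
      push_cast; ring
    have h4 : Complex.normSq (-q / (p : ℂ)) = Complex.normSq q / (p * p) := by
      rw [Complex.normSq_div, Complex.normSq_neg, Complex.normSq_ofReal]
    rw [h3, h4, Complex.ofReal_re] at h2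
    have h5 : p * (Complex.normSq q / (p * p)) + 2 * -(Complex.normSq q / p) + s =
        (p * s - Complex.normSq q) / p := by field_simp; ring
    rw [h5, hps] at h2
    exact absurd h2 (not_lt.2 (div_nonpos_of_nonpos_of_nonneg (by norm_num) hp0.le))
  -- (s − p)² = (s + p)² − 4ps = (s + p)² − 4|q|² + 4 > 4.
  have hu : 2 < s - p := by nlinarith
  -- the solution of `R + 1 / R = s - p`
  set w := Real.sqrt ((s - p) ^ 2 - 4) with hw
  have hw2 : w ^ 2 = (s - p) ^ 2 - 4 := Real.sq_sqrt (by nlinarith)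
  have hw0 : 0 < w := Real.sqrt_pos.2 (by nlinarith)
  set R := (s - p + w) / 2 with hR
  have hR1 : 1 < R := by rw [hR]; linarith
  have hRinv : R⁻¹ = (s - p - w) / 2 := by
    rw [inv_eq_iff_eq_inv, eq_comm]
    refine inv_eq_of_mul_eq_one_left ?_
    rw [hR]; nlinarith
  have hRsum : R + R⁻¹ = s - p := by rw [hRinv, hR]; ring
  have hRsub : R - R⁻¹ = w := by rw [hRinv, hR]; ring
  -- The lower row (γ, D) of B has to satisfy s = R D² − |γ|²/R, p = R|γ|² − D²/R and q = (R − 1/R)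
  -- γ̄ D. With D² − |γ|² = 1 the sum of the first two gives s + p = w(2D² − 1); D is taken real and
  -- positive.
  set D := Real.sqrt (((s + p) / w + 1) / 2) with hD
  have hsp : 0 < s + p := by linarith
  have hD2 : D ^ 2 = ((s + p) / w + 1) / 2 := Real.sq_sqrt (by positivity)
  have hD0 : 0 < D := Real.sqrt_pos.2 (by positivity)
  set γ : ℂ := (starRingEnd ℂ) q / (w * D : ℝ) with hγ
  have hγ2 : ‖γ‖ ^ 2 = ((s + p) / w - 1) / 2 := by
    rw [hγ, norm_div, RCLike.norm_conj, Complex.norm_real, Real.norm_of_nonneg (by positivity),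
      div_pow, mul_pow, hD2, ← hq2]
    have hq3 : Complex.normSq q = p * s + 1 := by linarith
    rw [hq3]
    have : (s + p) / w + 1 ≠ 0 := by positivity
    have h2 : w ^ 2 * (((s + p) / w + 1) / 2) * (((s + p) / w - 1) / 2) = p * s + 1 := by
      have : w ^ 2 * (((s + p) / w + 1) / 2) * (((s + p) / w - 1) / 2) =
        ((s + p) ^ 2 - w ^ 2) / 4 := by field_simp; ring
      rw [this, hw2]; ring
    rw [div_eq_iff (by positivity), ← h2]; ring
  have hB : ‖(D : ℂ)‖ ^ 2 - ‖γ‖ ^ 2 = 1 := by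
    rw [Complex.norm_real, Real.norm_of_nonneg hD0.le, hD2, hγ2]; ring
  obtain ⟨B, hBaut, b1, b2, b3, b4⟩ : ∃ B : SL(2, ℂ), DiskAut B ∧ B 0 0 = (starRingEnd ℂ) (D : ℂ) ∧
      B 0 1 = (starRingEnd ℂ) γ ∧ B 1 0 = γ ∧ B 1 1 = D :=
    ⟨diskMat γ D hB, diskAut_diskMat γ D hB, diskMat_entries γ D hB⟩
  have hform2 : ∀ x y : ℂ, Complex.normSq (a * x + b * y) - Complex.normSq (c * x + d * y) =
      R * Complex.normSq (γ * x + D * y) -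
        R⁻¹ * Complex.normSq ((starRingEnd ℂ) (D : ℂ) * x + (starRingEnd ℂ) γ * y) := by
    intro x y
    rw [hform]
    have h1 : q = ((R - R⁻¹ : ℝ) : ℂ) * ((starRingEnd ℂ) γ * D) := by
      rw [hRsub, hγ, map_div₀, Complex.conj_conj, Complex.conj_ofReal]
      have h1 : (w : ℂ) ≠ 0 := by exact_mod_cast hw0.ne'
      have h2 : (D : ℂ) ≠ 0 := by exact_mod_cast hD0.ne'
      push_cast; field_simp
    have h2 : p = R * Complex.normSq γ - R⁻¹ * D ^ 2 := by
      rw [Complex.normSq_eq_norm_sq, hγ2, hD2, hRinv, hR]; field_simp; ring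
    have h3 : s = R * D ^ 2 - R⁻¹ * Complex.normSq γ := by
      rw [Complex.normSq_eq_norm_sq, hγ2, hD2, hRinv, hR]; field_simp; ring
    rw [h1, h2, h3]
    generalize R⁻¹ = R'
    simp only [Complex.normSq_apply, Complex.add_re, Complex.mul_re, Complex.conj_re,
      Complex.conj_im, Complex.add_im, Complex.mul_im, Complex.ofReal_re, Complex.ofReal_im]
    ring
  set l := Real.log R with hl
  have hl0 : 0 < l := Real.log_pos hR1
  have hexp : Real.exp l = R := Real.exp_log (by linarith)
  obtain ⟨t1, t2, t3, t4⟩ := tubeMat_entries l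
  obtain ⟨i1, i2, i3, i4⟩ := inv_entries (tubeMat l)
  obtain ⟨j1, j2, j3, j4⟩ := inv_entries B
  -- In the diagonalizing coordinates the remaining factor preserves the form |x|² − |y|², so it
  -- lies in SU(1,1).
  set A := M * B⁻¹ * (tubeMat l)⁻¹ with hA
  have hquad : ∀ z : ℂ, ‖num A z‖ ^ 2 - ‖den A z‖ ^ 2 = ‖z‖ ^ 2 - 1 := by
    intro z
    have hx : num (B⁻¹ * (tubeMat l)⁻¹) z = B 1 1 * (-tubeMat l 0 1) + B 0 1 * tubeMat l 1 0 * z := by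
      simp only [num, mul_entries, i1, i2, i3, i4, j1, j2, t1, t4]; ring
    have hy : den (B⁻¹ * (tubeMat l)⁻¹) z = B 1 0 * tubeMat l 0 1 - B 0 0 * tubeMat l 1 0 * z := by
      simp only [den, mul_entries, i1, i2, i3, i4, j3, j4, t1, t4]; ring
    have h1 := hform2 (num (B⁻¹ * (tubeMat l)⁻¹) z) (den (B⁻¹ * (tubeMat l)⁻¹) z)
    have hN : num A z = a * num (B⁻¹ * (tubeMat l)⁻¹) z + b * den (B⁻¹ * (tubeMat l)⁻¹) z := by
      rw [hA, mul_assoc]; simp only [num, den, mul_entries M]; ring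
    have hDn : den A z = c * num (B⁻¹ * (tubeMat l)⁻¹) z + d * den (B⁻¹ * (tubeMat l)⁻¹) z := by
      rw [hA, mul_assoc]; simp only [num, den, mul_entries M]; ring
    have hdB := det_eq B
    have h2 : γ * num (B⁻¹ * (tubeMat l)⁻¹) z + D * den (B⁻¹ * (tubeMat l)⁻¹) z =
        -(tubeMat l 1 0 * z) := by
      rw [hx, hy, ← b3, ← b4]
      linear_combination (-(tubeMat l 1 0 * z)) * hdB
    have h3 : (starRingEnd ℂ) (D : ℂ) * num (B⁻¹ * (tubeMat l)⁻¹) z +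
        (starRingEnd ℂ) γ * den (B⁻¹ * (tubeMat l)⁻¹) z = -tubeMat l 0 1 := by
      rw [hx, hy, ← b1, ← b2]
      linear_combination (-(tubeMat l 0 1)) * hdB
    rw [← hN, ← hDn, h2, h3] at h1
    simp only [Complex.normSq_eq_norm_sq] at h1
    rw [h1, t2, t3]
    simp only [norm_neg, norm_mul, Complex.norm_I, one_mul, Complex.norm_real, Real.norm_eq_abs,
      Real.abs_exp]
    have e1 : Real.exp (l / 2) ^ 2 = R := by rw [← hexp, ← Real.exp_nat_mul]; congr 1; push_cast; ring
    have e2 : Real.exp (-(l / 2)) ^ 2 = R⁻¹ := by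
      rw [Real.exp_neg, inv_pow, e1]
    rw [mul_pow, e1, e2]
    field_simp
  refine ⟨A, B, l, diskAut_of_norm_eq (fun z hz => ?_) ?_, hBaut, hl0, ?_⟩
  · have := hquad z
    rw [hz] at this
    exact (sq_eq_sq₀ (norm_nonneg _) (norm_nonneg _)).1 (by linarith)
  · have := hquad 0
    simp only [num, den, mul_zero, zero_add, norm_zero] at this
    nlinarith [norm_nonneg (A 0 1), norm_nonneg (A 1 1)]
  · rw [hA]; group

end HalfForm
end

noncomputable section
namespace HalfForm

/-! ### Bases of the spaces of half-forms that extend inside or outside -/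

theorem orthonormal_coe {V : Submodule ℂ L2} {ι : Type*} {u : ι → V}
    (h : Orthonormal ℂ fun n => (u n : L2)) : Orthonormal ℂ u :=
  (V.subtypeₗᵢ.orthonormal_comp_iff (v := u)).1 h

theorem eq_zero_of_inner_fourierLp {f : L2} (h : ∀ k : ℤ, inner ℂ (fourierLp 2 k : L2) f = 0) :
    f = 0 := by
  have := hasSum_inner_fourierLp f
  simp only [h, zero_smul] at this
  exact this.unique hasSum_zero

/-- The pull-back is unitary and preserves L₂⁻, so it carries the basis z^{-n-1}, n ≥ 0, to another
one. -/
theorem exists_minusBasis {A : SL(2, ℂ)} (hA : DiskAut A) :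
    ∃ u : HilbertBasis ℕ ℂ Lminus,
      ∀ n : ℕ, (u n : L2) = pull hA.circleAut (fourierLp 2 (-(n : ℤ) - 1)) := by
  have hmem : ∀ n : ℕ, pull hA.circleAut (fourierLp 2 (-(n : ℤ) - 1)) ∈ Lminus := fun n =>
    hA.pull_mem_Lminus (fourierLp_mem_Lminus (by omega))
  have ho : Orthonormal ℂ fun n : ℕ => (⟨_, hmem n⟩ : Lminus) := by
    refine orthonormal_coe ?_
    refine Orthonormal.comp_linearIsometry (v := fun n : ℕ => (fourierLp 2 (-(n : ℤ) - 1) : L2)) ?_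
      (pull hA.circleAut)
    exact (orthonormal_fourier (T := 1)).comp (fun n : ℕ => -(n : ℤ) - 1) fun m n h => by
      simp only at h; omega
  refine ⟨HilbertBasis.mkOfOrthogonalEqBot ho ?_, fun n => ?_⟩
  · rw [Submodule.eq_bot_iff]
    intro f hf
    have h1 : ∀ n : ℕ, inner ℂ (fourierLp 2 (-(n : ℤ) - 1) : L2)
        (pull hA.circleAut.inv (f : L2)) = 0 := fun n => by
      rw [inner_pull_inv hA.circleAut]
      exact hf _ (Submodule.subset_span ⟨n, rfl⟩)
    have h2 : pull hA.circleAut.inv (f : L2) = 0 := by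
      refine eq_zero_of_inner_fourierLp fun k => ?_
      by_cases hk : 0 ≤ k
      · exact mem_Lminus_iff.1 (hA.inv.pull_mem_Lminus f.2) k hk
      · obtain ⟨n, hn⟩ := Int.eq_ofNat_of_zero_le (show 0 ≤ -k - 1 by omega)
        have := h1 n
        rwa [show -(n : ℤ) - 1 = k by omega] at this
    have h3 := pull_pull_inv hA.circleAut (f : L2)
    rw [h2, map_zero] at h3
    exact Subtype.ext h3.symm
  · rw [HilbertBasis.coe_mkOfOrthogonalEqBot]

/-- The constant c is there to absorb the phase produced by the Cauchy kernel, so that the singular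
values come out positive. -/
theorem exists_plusBasis {A : SL(2, ℂ)} (hA : DiskAut A) {c : ℂ} (hc : ‖c‖ = 1) :
    ∃ u : HilbertBasis ℕ ℂ Lplus,
      ∀ n : ℕ, (u n : L2) = c • pull hA.circleAut (fourierLp 2 (n : ℤ)) := by
  have hmem : ∀ n : ℕ, c • pull hA.circleAut (fourierLp 2 (n : ℤ)) ∈ Lplus := fun n =>
    Submodule.smul_mem _ _ (hA.pull_mem_Lplus (fourierLp_mem_Lplus (by omega)))
  have hc0 : c ≠ 0 := by rintro rfl; simp at hc
  have ho : Orthonormal ℂ fun n : ℕ => (⟨_, hmem n⟩ : Lplus) := by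
    refine orthonormal_coe ?_
    have h1 : Orthonormal ℂ fun n : ℕ => pull hA.circleAut (fourierLp 2 (n : ℤ)) := by
      refine Orthonormal.comp_linearIsometry (v := fun n : ℕ => (fourierLp 2 (n : ℤ) : L2)) ?_
        (pull hA.circleAut)
      exact (orthonormal_fourier (T := 1)).comp (fun n : ℕ => (n : ℤ)) fun m n h => by
        simp only at h; omega
    refine ⟨fun n => ?_, fun m n hmn => ?_⟩
    · simp only
      rw [norm_smul, hc, h1.1 n, one_mul]
    · simp only
      rw [inner_smul_left, inner_smul_right, h1.2 hmn, mul_zero, mul_zero]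
  refine ⟨HilbertBasis.mkOfOrthogonalEqBot ho ?_, fun n => ?_⟩
  · rw [Submodule.eq_bot_iff]
    intro f hf
    have h1 : ∀ n : ℕ, inner ℂ (fourierLp 2 (n : ℤ) : L2)
        (pull hA.circleAut.inv (f : L2)) = 0 := fun n => by
      rw [inner_pull_inv hA.circleAut]
      have h2 : inner ℂ (c • pull hA.circleAut (fourierLp 2 (n : ℤ))) (f : L2) = 0 :=
        hf _ (Submodule.subset_span ⟨n, rfl⟩)
      rw [inner_smul_left] at h2
      exact (mul_eq_zero.1 h2).resolve_left ((map_ne_zero _).2 hc0)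
    have h2 : pull hA.circleAut.inv (f : L2) = 0 := by
      refine eq_zero_of_inner_fourierLp fun k => ?_
      by_cases hk : k < 0
      · exact mem_Lplus_iff.1 (hA.inv.pull_mem_Lplus f.2) k hk
      · obtain ⟨n, rfl⟩ := Int.eq_ofNat_of_zero_le (show 0 ≤ k by omega)
        exact h1 n
    have h3 := pull_pull_inv hA.circleAut (f : L2)
    rw [h2, map_zero] at h3
    exact Subtype.ext h3.symm
  · rw [HilbertBasis.coe_mkOfOrthogonalEqBot]

/-! ### The blocks of the operator with Cauchy kernel -/

theorem integrable_L2 (f : L2) : Integrable f haar := (Lp.memLp f).integrable (by norm_num)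

theorem integral_norm_le (f : L2) : ∫ t, ‖f t‖ ∂haar ≤ ‖f‖ := by
  have h1 : eLpNorm f 1 haar ≤ eLpNorm f 2 haar :=
    eLpNorm_le_eLpNorm_of_exponent_le (by norm_num) (Lp.aestronglyMeasurable f)
  rw [eLpNorm_one_eq_lintegral_enorm] at h1
  rw [integral_norm_eq_lintegral_enorm (Lp.aestronglyMeasurable f), Lp.norm_def]
  exact ENNReal.toReal_mono (Lp.memLp f).2.ne h1

theorem norm_le_of_forall_le {f : L2} {M : ℝ} (hM : 0 ≤ M) (h : ∀ᵐ t ∂haar, ‖f t‖ ≤ M) :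
    ‖f‖ ≤ M := by
  have := Lp.norm_le_of_ae_bound hM h
  simpa [measureUnivNNReal] using this

theorem CircleAut.integral_comp {A : SL(2, ℂ)} (hA : CircleAut A) {Φ : UnitAddCircle → ℂ}
    (hΦ : AEStronglyMeasurable Φ haar) :
    ∫ t, (((‖den A (unitPt t)‖ ^ 2)⁻¹ : ℝ) : ℂ) * Φ (circleAct A t) ∂haar = ∫ t, Φ t ∂haar := by
  have hm : Measurable fun t : UnitAddCircle => ‖(den A (unitPt t))⁻¹‖₊ ^ 2 :=
    (hA.continuous_inv_den.nnnorm.pow 2).measurable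
  have hmap := hA.map_withDensity
  conv_rhs => rw [← hmap]
  rw [integral_map (measurable_circleAct A).aemeasurable (by rw [hmap]; exact hΦ)]
  have e : (haar.withDensity fun t => ‖(den A (unitPt t))⁻¹‖ₑ ^ 2) =
      haar.withDensity fun t => ((‖(den A (unitPt t))⁻¹‖₊ ^ 2 : NNReal) : ENNReal) := by
    congr 1
  rw [e, integral_withDensity_eq_integral_smul hm]
  refine integral_congr_ae (Filter.Eventually.of_forall fun t => ?_)
  simp only [NNReal.smul_def, Complex.real_smul]
  simp

theorem integral_unitPt_zpow {k : ℤ} (hk : k ≠ 0) : ∫ t, unitPt t ^ k ∂haar = 0 := by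
  refine integral_unitPt_of_primitive (F := fun z => z ^ k) (G := fun z => (k : ℂ)⁻¹ * z ^ k) ?_
  intro z hz
  have hz0 : z ≠ 0 := by rintro rfl; simp at hz
  have hk' : (k : ℂ) ≠ 0 := by exact_mod_cast hk
  refine ((hasDerivAt_zpow k z (Or.inl hz0)).const_mul (k : ℂ)⁻¹).congr_deriv ?_
  rw [zpow_sub_one₀ hz0]; field_simp

theorem continuous_unitPt_zpow (k : ℤ) : Continuous fun t => unitPt t ^ k :=
  continuous_unitPt'.zpow₀ k fun t => Or.inl (unitPt_ne_zero t)

theorem integrable_of_continuous {f : UnitAddCircle → ℂ} (hf : Continuous f) : Integrable f haar :=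
  hf.integrable_of_hasCompactSupport (HasCompactSupport.of_compactSpace _)

theorem sub_mul_ne_zero {X Y v : ℂ} (h : ‖Y‖ < ‖X‖) (hv : ‖v‖ ≤ 1) : X - v * Y ≠ 0 := by
  intro h0
  have : ‖X‖ ≤ ‖Y‖ := by
    rw [sub_eq_zero.1 h0, norm_mul]; exact mul_le_of_le_one_left (norm_nonneg _) hv
  linarith

/-- Of the geometric series of 1/(X − vY) only the term with v^n survives; the induction splits off
one term at a time. -/
theorem integral_geometric {X Y : ℂ} (h : ‖Y‖ < ‖X‖) (n : ℕ) :
    ∫ t, unitPt t ^ (-(n : ℤ)) / (X - unitPt t * Y) ∂haar = Y ^ n / X ^ (n + 1) := by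
  have hX : X ≠ 0 := by rintro rfl; simp at h; linarith [norm_nonneg Y]
  induction n with
  | zero =>
    simp only [Nat.cast_zero, neg_zero, zpow_zero]
    rw [integral_unitPt_of_differentiable (F := fun z => 1 / (X - z * Y))]
    · simp
    · intro z hz
      have := sub_mul_ne_zero h hz
      fun_prop (disch := assumption)
  | succ n ih =>
    have hcont : Continuous fun t => unitPt t ^ (-(n : ℤ)) / (X - unitPt t * Y) :=
      (continuous_unitPt_zpow _).div (continuous_const.sub (continuous_unitPt'.mul continuous_const))
        fun t => sub_mul_ne_zero h (norm_unitPt' t).le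
    have : ∀ t, unitPt t ^ (-((n + 1 : ℕ) : ℤ)) / (X - unitPt t * Y) =
        X⁻¹ * unitPt t ^ (-((n + 1 : ℕ) : ℤ)) +
          Y / X * (unitPt t ^ (-(n : ℤ)) / (X - unitPt t * Y)) := fun t => by
      have h1 := sub_mul_ne_zero h (norm_unitPt' t).le
      have h2 := unitPt_ne_zero t
      rw [show -((n + 1 : ℕ) : ℤ) = -(n : ℤ) - 1 by push_cast; ring, zpow_sub_one₀ h2]
      field_simp
      ring
    simp only [this]
    rw [integral_add ((integrable_of_continuous (continuous_unitPt_zpow _)).const_mul _)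
      ((integrable_of_continuous hcont).const_mul _), integral_const_mul, integral_const_mul, ih,
      integral_unitPt_zpow (by omega)]
    field_simp; ring

namespace ModelCurve

variable {I : Type*} (C : ModelCurve I)

/-- The transition matrix between two charts. -/
def trans (i j : I) : SL(2, ℂ) := (C.chart i)⁻¹ * C.chart j

/-- Otherwise num/den would be the coordinate, in the chart of K i, of a point common to both disks.
-/
theorem norm_den_trans_lt {i j : I} (hij : i ≠ j) {z : ℂ} (hz : ‖z‖ ≤ 1) :
    ‖den (C.trans i j) z‖ < ‖num (C.trans i j) z‖ := by
  by_contra hcon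
  rw [not_lt] at hcon
  have hd : den (C.trans i j) z ≠ 0 := fun h0 => by
    rw [h0, norm_zero] at hcon
    exact num_den_ne_zero h0 (norm_le_zero_iff.1 hcon)
  have h1 := moebius_of_den_ne_zero hd
  refine Set.disjoint_left.1 (C.disjoint hij)
    ⟨num (C.trans i j) z / den (C.trans i j) z, ?_, rfl⟩ ⟨z, hz, ?_⟩
  · rw [Set.mem_ofPred_eq, norm_div]
    exact div_le_one_of_le₀ hcon (norm_nonneg _)
  · simp only
    rw [← h1, trans, moebius_mul, moebius_moebius_inv]

theorem cauchyDenom_eq (i j : I) (t s : UnitAddCircle) :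
    C.cauchyDenom i j t s = num (C.trans i j) (unitPt t) - unitPt s * den (C.trans i j) (unitPt t) := by
  obtain ⟨h1, h2, h3, h4⟩ := inv_entries (C.chart i)
  simp only [cauchyDenom, num, den, trans, mul_entries, h1, h2, h3, h4]
  ring

theorem exists_bound_cauchyDenom {i j : I} (hij : i ≠ j) :
    ∃ M : ℝ, 0 ≤ M ∧ ∀ t s, ‖unitPt s / C.cauchyDenom i j t s‖ ≤ M := by
  have hc : Continuous fun p : UnitAddCircle × UnitAddCircle =>
      unitPt p.2 / C.cauchyDenom i j p.1 p.2 := by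
    refine (continuous_unitPt'.comp continuous_snd).div ?_ fun p => C.cauchyDenom_ne_zero hij _ _
    have h1 := continuous_unitPt'.comp (continuous_fst (X := UnitAddCircle) (Y := UnitAddCircle))
    have h2 := continuous_unitPt'.comp (continuous_snd (X := UnitAddCircle) (Y := UnitAddCircle))
    simp only [Function.comp_def] at h1 h2
    unfold cauchyDenom
    fun_prop
  obtain ⟨M, hM⟩ := (isCompact_range hc).isBounded.exists_norm_le
  exact ⟨M, (norm_nonneg _).trans (hM _ ⟨(0, 0), rfl⟩), fun t s => hM _ ⟨(t, s), rfl⟩⟩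

theorem continuous_cauchyKernel {i j : I} (hij : i ≠ j) (t : UnitAddCircle) :
    Continuous fun s => unitPt s / C.cauchyDenom i j t s := by
  refine continuous_unitPt'.div ?_ fun p => C.cauchyDenom_ne_zero hij _ _
  have := continuous_unitPt'
  unfold cauchyDenom
  fun_prop

theorem integrable_cauchy {i j : I} (hij : i ≠ j) (f : L2) (t : UnitAddCircle) :
    Integrable (fun s => f s * unitPt s / C.cauchyDenom i j t s) haar := by
  obtain ⟨M, -, hM⟩ := C.exists_bound_cauchyDenom hij
  simp only [mul_div_assoc]
  exact (integrable_L2 f).mul_bdd (c := M)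
    (C.continuous_cauchyKernel hij t).aestronglyMeasurable
    (Filter.Eventually.of_forall (hM t))

/-- The operator with Cauchy kernel from half-forms on `∂K i` to half-forms on `∂K j`. -/
def cauchyOp {i j : I} (hij : i ≠ j) : L2 →L[ℂ] L2 :=
  LinearMap.mkContinuousOfExistsBound
    { toFun := fun f => (C.memLp_cauchyIntegral hij f).toLp _
      map_add' := fun f g => by
        rw [← MemLp.toLp_add]
        refine MemLp.toLp_congr _ _ (Filter.Eventually.of_forall fun t => ?_)
        simp only [Pi.add_apply, cauchyIntegral]
        rw [← integral_add (C.integrable_cauchy hij f t) (C.integrable_cauchy hij g t)]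
        refine integral_congr_ae ?_
        filter_upwards [Lp.coeFn_add f g] with s hs
        rw [hs, Pi.add_apply]; ring
      map_smul' := fun c f => by
        rw [RingHom.id_apply, ← MemLp.toLp_const_smul]
        refine MemLp.toLp_congr _ _ (Filter.Eventually.of_forall fun t => ?_)
        simp only [Pi.smul_apply, cauchyIntegral, smul_eq_mul]
        rw [← integral_const_mul]
        refine integral_congr_ae ?_
        filter_upwards [Lp.coeFn_smul c f] with s hs
        rw [hs, Pi.smul_apply, smul_eq_mul]; ring }
    (by
      obtain ⟨M, hM0, hM⟩ := C.exists_bound_cauchyDenom hij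
      refine ⟨M, fun f => norm_le_of_forall_le (by positivity) ?_⟩
      filter_upwards [MemLp.coeFn_toLp (C.memLp_cauchyIntegral hij f)] with t ht
      change ‖((C.memLp_cauchyIntegral hij f).toLp _ : L2) t‖ ≤ _
      rw [ht, cauchyIntegral]
      refine (norm_integral_le_integral_norm _).trans ?_
      have h1 : ∫ s, ‖f s * unitPt s / C.cauchyDenom i j t s‖ ∂haar ≤ ∫ s, M * ‖f s‖ ∂haar := by
        refine integral_mono (C.integrable_cauchy hij f t).norm
          ((integrable_L2 f).norm.const_mul M) fun s => ?_
        simp only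
        rw [mul_div_assoc, norm_mul, mul_comm]
        exact mul_le_mul_of_nonneg_right (hM t s) (norm_nonneg _)
      refine h1.trans ?_
      rw [integral_const_mul]
      exact mul_le_mul_of_nonneg_left (integral_norm_le f) hM0)

theorem coeFn_cauchyOp {i j : I} (hij : i ≠ j) (f : L2) :
    C.cauchyOp hij f =ᵐ[haar] C.cauchyIntegral i j f :=
  MemLp.coeFn_toLp (C.memLp_cauchyIntegral hij f)

open Classical in
/-- The block of the operator with Cauchy kernel as a bounded operator. -/
def block (i j : I) : Lminus →L[ℂ] Lplus :=
  if h : i = j then 0 else plusPart ∘L C.cauchyOp h ∘L Lminus.subtypeL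

theorem block_self (i : I) : C.block i i = 0 := by simp [block]

theorem block_of_ne {i j : I} (hij : i ≠ j) :
    C.block i j = plusPart ∘L C.cauchyOp hij ∘L Lminus.subtypeL := by
  rw [block, dif_neg hij]

theorem cauchyBlock_eq (i j : I) (f : Lminus) : C.cauchyBlock i j f = C.block i j f := by
  by_cases hij : i = j
  · subst hij; simp [cauchyBlock, block]
  · rw [block_of_ne C hij, cauchyBlock, dif_neg hij]; rfl

/-- Put v = A⁻¹w for the variable w of integration. The weight of the half-form, the denominator and
the factor w combine to the Jacobian times v, so v^{-n-1} becomes v^{-n} and the integral is the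
geometric one with value Y^n / X^{n+1}. The powers of e^{l/2} in X and Y give the singular value,
and i^n / i^{n+1} = -i the phase. -/
theorem cauchyIntegral_pull {i j : I} {A B : SL(2, ℂ)} {l : ℝ} (hA : DiskAut A) (hB : DiskAut B)
    (hl : 0 < l) (hM : C.trans i j = A * tubeMat l * B) (n : ℕ) (t : UnitAddCircle) :
    C.cauchyIntegral i j (pull hA.inv.circleAut (fourierLp 2 (-(n : ℤ) - 1))) t =
      Real.exp (-((n : ℝ) + 1 / 2) * l) * (-Complex.I *
        ((den B (unitPt t))⁻¹ * unitPt (circleAct B t) ^ (n : ℤ))) := by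
  set z := unitPt t with hzdef
  have hz : ‖z‖ = 1 := norm_unitPt' t
  have hdB := hB.circleAut.den_ne_zero hz
  set X := Complex.I * Real.exp (l / 2) * den B z with hX
  set Y := Complex.I * Real.exp (-(l / 2)) * num B z with hY
  obtain ⟨t1, t2, t3, t4⟩ := tubeMat_entries l
  obtain ⟨j1, j2, j3, j4⟩ := inv_entries A
  -- Up to the factor den A⁻¹ this is X − vY: A has been moved from one variable of the kernel to
  -- the other.
  have hden : ∀ s, C.cauchyDenom i j t s = X * den A⁻¹ (unitPt s) - Y * num A⁻¹ (unitPt s) := by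
    intro s
    rw [C.cauchyDenom_eq, hM, mul_assoc]
    simp only [num, den, mul_entries, t1, t2, t3, t4, j1, j2, j3, j4, hX, hY]
    ring
  have hXY : ‖Y‖ < ‖X‖ := by
    rw [hX, hY]
    simp only [norm_mul, Complex.norm_I, one_mul, Complex.norm_real, Real.norm_eq_abs,
      Real.abs_exp, hB.circleAut.norm_num hz]
    refine mul_lt_mul_of_pos_right (Real.exp_lt_exp.2 (by linarith)) (norm_pos_iff.2 hdB)
  have hΦ : Continuous fun v : UnitAddCircle => unitPt v ^ (-(n : ℤ)) / (X - unitPt v * Y) :=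
    (continuous_unitPt_zpow _).div (continuous_const.sub (continuous_unitPt'.mul continuous_const))
      fun t => sub_mul_ne_zero hXY (norm_unitPt' t).le
  have h1 := hA.inv.circleAut.integral_comp hΦ.aestronglyMeasurable
  rw [integral_geometric hXY] at h1
  have h2 : C.cauchyIntegral i j (pull hA.inv.circleAut (fourierLp 2 (-(n : ℤ) - 1))) t =
      Y ^ n / X ^ (n + 1) := by
    rw [← h1, cauchyIntegral]
    refine integral_congr_ae ?_
    filter_upwards [coeFn_pull hA.inv.circleAut (fourierLp 2 (-(n : ℤ) - 1)),
      hA.inv.circleAut.ae_comp (coeFn_fourierLp_two (-(n : ℤ) - 1))] with s e1 e2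
    have hw : ‖unitPt s‖ = 1 := norm_unitPt' s
    have hd := hA.inv.circleAut.den_ne_zero hw
    have hn := hA.inv.circleAut.num_ne_zero hw
    have hw0 := unitPt_ne_zero s
    rw [e1, e2, hden, CircleAut.inv_normSq_den (ε := 1) (by simp)
      (fun z hz => by rw [hA.inv.num_eq hz, one_mul]) hw hn, hA.inv.circleAut.unitPt_circleAct]
    have h3 : X * den A⁻¹ (unitPt s) - Y * num A⁻¹ (unitPt s) =
        den A⁻¹ (unitPt s) * (X - num A⁻¹ (unitPt s) / den A⁻¹ (unitPt s) * Y) := by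
      field_simp
    have h4 : X - num A⁻¹ (unitPt s) / den A⁻¹ (unitPt s) * Y ≠ 0 := by
      rw [← hA.inv.circleAut.unitPt_circleAct]
      exact sub_mul_ne_zero hXY (norm_unitPt' _).le
    rw [h3, zpow_sub_one₀ (div_ne_zero hn hd)]
    generalize (num A⁻¹ (unitPt s) / den A⁻¹ (unitPt s)) ^ (-(n : ℤ)) = y
    generalize X - num A⁻¹ (unitPt s) / den A⁻¹ (unitPt s) * Y = x at *
    field_simp
  rw [h2, hB.circleAut.unitPt_circleAct, zpow_natCast, hX, hY]
  have e1 : ((Real.exp (l / 2) : ℝ) : ℂ) ≠ 0 := by exact_mod_cast (Real.exp_pos _).ne'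
  have e2 : ((Real.exp (-(l / 2)) : ℝ) : ℂ) = ((Real.exp (l / 2) : ℝ) : ℂ)⁻¹ := by
    rw [Real.exp_neg]; push_cast; rfl
  have e3 : ((Real.exp (-((n : ℝ) + 1 / 2) * l) : ℝ) : ℂ) = (((Real.exp (l / 2) : ℝ) : ℂ)⁻¹) ^ (2 * n + 1) := by
    rw [← e2, ← Complex.ofReal_pow, ← Real.exp_nat_mul]
    congr 2; push_cast; ring
  rw [e2, e3, ← hzdef]
  generalize ((Real.exp (l / 2) : ℝ) : ℂ) = x at *
  rw [mul_pow, mul_pow, mul_pow, mul_pow, pow_succ Complex.I, div_pow]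
  have hI : Complex.I ^ n ≠ 0 := pow_ne_zero _ Complex.I_ne_zero
  simp only [inv_pow]
  field_simp
  rw [Complex.I_sq]
  ring

/-- The singular value decomposition of a block of the operator with Cauchy kernel. -/
theorem exists_svd {i j : I} (hij : i ≠ j) {A B : SL(2, ℂ)} {l : ℝ} (hA : DiskAut A)
    (hB : DiskAut B) (hl : 0 < l) (hM : C.trans i j = A * tubeMat l * B) :
    ∃ (u : HilbertBasis ℕ ℂ Lminus) (v : HilbertBasis ℕ ℂ Lplus),
      (∀ n : ℕ, (v n : L2) = (-Complex.I) • pull hB.circleAut (fourierLp 2 (n : ℤ))) ∧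
      ∀ n : ℕ, C.block i j (u n) = ((Real.exp (-((n : ℝ) + 1 / 2) * l) : ℝ) : ℂ) • v n := by
  obtain ⟨u, hu⟩ := exists_minusBasis hA.inv
  obtain ⟨v, hv⟩ := exists_plusBasis hB (c := -Complex.I) (by simp)
  refine ⟨u, v, hv, fun n => ?_⟩
  have h1 : C.cauchyOp hij (u n : L2) = ((Real.exp (-((n : ℝ) + 1 / 2) * l) : ℝ) : ℂ) • (v n : L2) := by
    refine Lp.ext ?_
    rw [hu n, hv n]
    filter_upwards [C.coeFn_cauchyOp hij (pull hA.inv.circleAut (fourierLp 2 (-(n : ℤ) - 1))),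
      Lp.coeFn_smul ((Real.exp (-((n : ℝ) + 1 / 2) * l) : ℝ) : ℂ)
        ((-Complex.I) • pull hB.circleAut (fourierLp 2 (n : ℤ))),
      Lp.coeFn_smul (-Complex.I) (pull hB.circleAut (fourierLp 2 (n : ℤ))),
      coeFn_pull hB.circleAut (fourierLp 2 (n : ℤ)),
      hB.circleAut.ae_comp (coeFn_fourierLp_two (n : ℤ))] with t e1 e2 e3 e4 e5
    rw [e1, e2, Pi.smul_apply, e3, Pi.smul_apply, e4, e5,
      C.cauchyIntegral_pull hA hB hl hM n t, smul_eq_mul, smul_eq_mul]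
  rw [C.block_of_ne hij]
  change plusPart (C.cauchyOp hij (u n : L2)) = _
  -- The Cauchy integral already extends inside K j, so the projection in the definition of the
  -- block changes nothing.
  rw [h1, map_smul, plusPart_coe]

end ModelCurve

end HalfForm
end

noncomputable section
namespace HalfForm

open Filter

/-! ### Fraction-linear maps are continuous -/

/-- At a pole the numerator is nonzero while the denominator tends to 0 without vanishing at nearby
points, so the quotient tends to ∞. -/
theorem tendsto_moebius_nhds_coe (A : SL(2, ℂ)) (z : ℂ) :
    Tendsto (fun w : ℂ => moebius A (w : Sphere)) (𝓝 z) (𝓝 (moebius A (z : Sphere))) := by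
  by_cases hd : den A z = 0
  · have h1 : moebius A (z : Sphere) = OnePoint.infty := by rw [moebius_coe, if_pos hd]
    have hne : ∀ᶠ w in 𝓝[≠] z, den A w ≠ 0 := by
      filter_upwards [self_mem_nhdsWithin] with w hw h0
      have h2 : A 1 0 * (w - z) = 0 := by
        have e1 := hd; have e2 := h0
        unfold den at e1 e2
        linear_combination e2 - e1
      rcases mul_eq_zero.1 h2 with h3 | h3
      · have e1 := hd
        have e2 := det_eq A
        unfold den at e1
        rw [h3, zero_mul, zero_add] at e1
        rw [e1, h3] at e2; simp at e2
      · exact hw (sub_eq_zero.1 h3)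
    have h2 : Tendsto (fun w => num A w / den A w) (𝓝[≠] z) (Bornology.cobounded ℂ) := by
      rw [← tendsto_norm_atTop_iff_cobounded]
      have e1 : Tendsto (fun w => ‖num A w‖) (𝓝[≠] z) (𝓝 ‖num A z‖) :=
        ((continuous_num A).norm.tendsto z).mono_left nhdsWithin_le_nhds
      have e2 : Tendsto (fun w => ‖den A w‖⁻¹) (𝓝[≠] z) atTop := by
        refine tendsto_inv_nhdsGT_zero.comp (tendsto_nhdsWithin_iff.2 ⟨?_, ?_⟩)
        · have := ((continuous_den A).norm.tendsto z).mono_left (nhdsWithin_le_nhds (s := {z}ᶜ))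
          rwa [hd, norm_zero] at this
        · filter_upwards [hne] with w hw
          exact norm_pos_iff.2 hw
      have e3 := e1.pos_mul_atTop (norm_pos_iff.2 (num_den_ne_zero hd)) e2
      simpa only [norm_div, div_eq_mul_inv, norm_mul, norm_inv] using e3
    rw [Metric.cobounded_eq_cocompact, ← coclosedCompact_eq_cocompact] at h2
    have h3 : Tendsto (fun w : ℂ => moebius A (w : Sphere)) (𝓝[≠] z) (𝓝 OnePoint.infty) := by
      refine (OnePoint.tendsto_coe_infty.comp h2).congr' ?_
      filter_upwards [hne] with w hw
      rw [moebius_of_den_ne_zero hw]; rfl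
    rw [h1, ← nhdsNE_sup_pure, tendsto_sup]
    refine ⟨h3, ?_⟩
    rw [tendsto_pure_left]
    intro s hs
    rw [h1]; exact mem_of_mem_nhds hs
  · rw [moebius_of_den_ne_zero hd]
    have h1 : Tendsto (fun w => num A w / den A w) (𝓝 z) (𝓝 (num A z / den A z)) :=
      ((continuous_num A).continuousAt.div (continuous_den A).continuousAt hd)
    refine ((OnePoint.continuous_coe.tendsto _).comp h1).congr' ?_
    filter_upwards [(continuous_den A).continuousAt.eventually_ne hd] with w hw
    rw [moebius_of_den_ne_zero hw]; rfl

theorem moebius_tubeMat_zero {w : ℂ} (l : ℝ) (hw : w ≠ 0) :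
    moebius (tubeMat l) (w : Sphere) = ((Real.exp l / w : ℂ) : Sphere) := by
  obtain ⟨t1, t2, t3, t4⟩ := tubeMat_entries l
  have hd : den (tubeMat l) w = Complex.I * Real.exp (-(l / 2)) * w := by
    rw [den, t3, t4, add_zero]
  have hn : num (tubeMat l) w = Complex.I * Real.exp (l / 2) := by
    rw [num, t1, t2, zero_mul, zero_add]
  have h0 : ((Real.exp (-(l / 2)) : ℝ) : ℂ) ≠ 0 := by exact_mod_cast (Real.exp_pos _).ne'
  have h1 : ((Real.exp l : ℝ) : ℂ) = Real.exp (l / 2) * (Real.exp (-(l / 2)) : ℂ)⁻¹ := by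
    rw [← Complex.ofReal_inv, ← Real.exp_neg, ← Complex.ofReal_mul, ← Real.exp_add]
    congr 2; ring
  rw [moebius_of_den_ne_zero, hn, hd]
  · congr 1
    rw [h1]
    field_simp [Complex.I_ne_zero]
  · rw [hd]; exact mul_ne_zero (mul_ne_zero Complex.I_ne_zero h0) hw

theorem moebius_tubeMat_coe_zero (l : ℝ) :
    moebius (tubeMat l) ((0 : ℂ) : Sphere) = OnePoint.infty := by
  obtain ⟨t1, t2, t3, t4⟩ := tubeMat_entries l
  rw [moebius_coe, if_pos]
  rw [den, t4, mul_zero, zero_add]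

theorem continuous_moebius (A : SL(2, ℂ)) : Continuous (moebius A) := by
  rw [continuous_iff_continuousAt]
  intro x
  induction x using OnePoint.rec with
  | coe z =>
    rw [OnePoint.continuousAt_coe]
    exact tendsto_moebius_nhds_coe A z
  | infty =>
    rw [OnePoint.continuousAt_infty', coclosedCompact_eq_cocompact, ← Metric.cobounded_eq_cocompact]
    -- For l = 0 the tube map is z ↦ 1/z, which moves the question from ∞ to 0.
    have h1 : moebius A OnePoint.infty = moebius (A * tubeMat 0) ((0 : ℂ) : Sphere) := by
      rw [moebius_mul, moebius_tubeMat_coe_zero]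
    have h2 := (tendsto_moebius_nhds_coe (A * tubeMat 0) 0).comp
      (tendsto_inv₀_cobounded (α := ℂ))
    rw [h1]
    refine h2.congr' ?_
    filter_upwards [Bornology.eventually_ne_cobounded (0 : ℂ)] with w hw
    simp only [Function.comp_apply]
    rw [moebius_mul, moebius_tubeMat_zero 0 (inv_ne_zero hw)]
    simp

/-! ### The modulus of a tube -/

theorem exists_exp_eq {w : ℂ} {L : ℝ} (h1 : 1 < ‖w‖) (h2 : ‖w‖ < Real.exp L) :
    ∃ ζ : ℂ, (0 < ζ.re ∧ ζ.re < L) ∧ Complex.exp ζ = w := by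
  have hw : w ≠ 0 := by rintro rfl; simp at h1; linarith
  refine ⟨Complex.log w, ⟨?_, ?_⟩, Complex.exp_log hw⟩
  · rw [Complex.log_re]; exact Real.log_pos h1
  · rw [Complex.log_re, Real.log_lt_iff_lt_exp (by linarith)]; exact h2

theorem convex_strip (L : ℝ) : Convex ℝ {ζ : ℂ | 0 < ζ.re ∧ ζ.re < L} :=
  (convex_halfSpace_re_gt 0).inter (convex_halfSpace_re_lt L)

theorem isOpen_strip (L : ℝ) : IsOpen {ζ : ℂ | 0 < ζ.re ∧ ζ.re < L} :=
  (isOpen_lt continuous_const Complex.continuous_re).inter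
    (isOpen_lt Complex.continuous_re continuous_const)

/-- Maximum principle for |k(w)| |w|^{-α}, which equals 1 on both boundary circles. As w^α need not
be single-valued, an interior maximum is studied on the strip, in the coordinate ζ = log w: there
the modulus would be constant, with boundary limit 1. -/
theorem norm_le_rpow_of_annulus {k : ℂ → ℂ} {L α : ℝ}
    (hc : ContinuousOn k {w | 1 ≤ ‖w‖ ∧ ‖w‖ ≤ Real.exp L})
    (hd : ∀ w, 1 < ‖w‖ → ‖w‖ < Real.exp L → DifferentiableAt ℂ k w)
    (h1 : ∀ w, ‖w‖ = 1 → ‖k w‖ = 1)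
    (h2 : ∀ w, ‖w‖ = Real.exp L → ‖k w‖ = Real.exp (α * L)) {w : ℂ} (hw1 : 1 ≤ ‖w‖)
    (hw2 : ‖w‖ ≤ Real.exp L) : ‖k w‖ ≤ ‖w‖ ^ α := by
  set K : Set ℂ := {w | 1 ≤ ‖w‖ ∧ ‖w‖ ≤ Real.exp L}
  have hK : IsCompact K := by
    have : K = Metric.closedBall 0 (Real.exp L) ∩ {w | 1 ≤ ‖w‖} := by
      ext w; simp [K, and_comm]
    rw [this]
    exact (isCompact_closedBall _ _).inter_right (isClosed_le continuous_const continuous_norm)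
  have hpos : ∀ w ∈ K, 0 < ‖w‖ := fun w hw => lt_of_lt_of_le one_pos hw.1
  set f : ℂ → ℝ := fun w => ‖k w‖ * ‖w‖ ^ (-α) with hf
  have hfc : ContinuousOn f K := hc.norm.mul
    (continuous_norm.continuousOn.rpow_const fun w hw => Or.inl (hpos w hw).ne')
  have hf1 : ∀ w, ‖w‖ = 1 → f w = 1 := fun w hw => by rw [hf]; simp [h1 w hw, hw]
  have hf2 : ∀ w, ‖w‖ = Real.exp L → f w = 1 := fun w hw => by
    rw [hf]; simp only [h2 w hw, hw]
    rw [← Real.exp_mul, ← Real.exp_add]; simp [mul_comm]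
  have hLpos : 1 ≤ Real.exp L := hw1.trans hw2
  have hone : (1 : ℂ) ∈ K := ⟨by simp, by simpa using hLpos⟩
  obtain ⟨m, hmK, hm⟩ := hK.exists_isMaxOn ⟨w, hw1, hw2⟩ hfc
  have hfm : f m ≤ 1 := by
    rcases hmK.1.eq_or_lt with e1 | e1
    · exact (hf1 m e1.symm).le
    rcases hmK.2.eq_or_lt with e2 | e2
    · exact (hf2 m e2).le
    obtain ⟨ζ₀, hζ₀, hζm⟩ := exists_exp_eq e1 e2
    have hL0 : 0 < L := hζ₀.1.trans hζ₀.2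
    set S : Set ℂ := {ζ : ℂ | 0 < ζ.re ∧ ζ.re < L}
    set G : ℂ → ℂ := fun ζ => k (Complex.exp ζ) * Complex.exp (-α * ζ) with hG
    have hexp : ∀ ζ ∈ S, 1 < ‖Complex.exp ζ‖ ∧ ‖Complex.exp ζ‖ < Real.exp L := fun ζ hζ => by
      rw [Complex.norm_exp]
      exact ⟨Real.one_lt_exp_iff.2 hζ.1, Real.exp_lt_exp.2 hζ.2⟩
    have hGf : ∀ ζ, ‖G ζ‖ = f (Complex.exp ζ) := fun ζ => by
      simp only [hG, hf, norm_mul, Complex.norm_exp]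
      rw [← Real.exp_mul]
      congr 2; simp [mul_comm]
    have hGd : DifferentiableOn ℂ G S := fun ζ hζ => by
      have := (hd _ (hexp ζ hζ).1 (hexp ζ hζ).2).comp ζ Complex.differentiableAt_exp
      exact (this.mul (by fun_prop)).differentiableWithinAt
    have hmax : IsMaxOn (norm ∘ G) S ζ₀ := fun ζ hζ => by
      simp only [Set.mem_ofPred_eq, Function.comp_apply, hGf, hζm]
      exact hm ⟨(hexp ζ hζ).1.le, (hexp ζ hζ).2.le⟩
    have hconst := Complex.norm_eqOn_of_isPreconnected_of_isMaxOn (convex_strip L).isPreconnected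
      (isOpen_strip L) hGd hζ₀ hmax
    -- approach the boundary along the real axis
    have hlim : Tendsto (fun x : ℝ => f (Complex.exp x)) (𝓝[>] 0) (𝓝 (f 1)) := by
      have h3 : ContinuousWithinAt f K 1 := hfc 1 hone
      refine h3.tendsto.comp (tendsto_nhdsWithin_iff.2 ⟨?_, ?_⟩)
      · have : Tendsto (fun x : ℝ => Complex.exp x) (𝓝 0) (𝓝 (Complex.exp (0 : ℝ))) :=
          (Complex.continuous_exp.comp Complex.continuous_ofReal).tendsto 0
        rw [Complex.ofReal_zero, Complex.exp_zero] at this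
        exact this.mono_left nhdsWithin_le_nhds
      · filter_upwards [Ioo_mem_nhdsGT hL0] with x hx
        have := hexp (x : ℂ) ⟨by simpa using hx.1, by simpa using hx.2⟩
        exact ⟨this.1.le, this.2.le⟩
    have hlim2 : Tendsto (fun x : ℝ => f (Complex.exp x)) (𝓝[>] 0) (𝓝 (f m)) := by
      refine tendsto_const_nhds.congr' ?_
      filter_upwards [Ioo_mem_nhdsGT hL0] with x hx
      have := hconst (show (x : ℂ) ∈ S from ⟨by simpa using hx.1, by simpa using hx.2⟩)
      simp only [Function.comp_apply, Function.const_apply, hGf, hζm] at this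
      exact this.symm
    rw [tendsto_nhds_unique hlim2 hlim, hf1 1 (by simp)]
  have h3 : f w ≤ 1 := (hm ⟨hw1, hw2⟩).trans hfm
  have hw0 : 0 < ‖w‖ := hpos w ⟨hw1, hw2⟩
  rw [hf] at h3
  simp only [Real.rpow_neg hw0.le] at h3
  rwa [← div_eq_mul_inv, div_le_one (Real.rpow_pos_of_pos hw0 _)] at h3

/-- A tube of length `L` cannot be mapped conformally onto a shorter one. -/
theorem tube_length_le {k : ℂ → ℂ} {L l : ℝ} (hL : 0 < L) (hl : 0 < l)
    (hc : ContinuousOn k {w | 1 ≤ ‖w‖ ∧ ‖w‖ ≤ Real.exp L})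
    (hd : ∀ w, 1 < ‖w‖ → ‖w‖ < Real.exp L → DifferentiableAt ℂ k w)
    (h0 : ∀ w, 1 ≤ ‖w‖ → ‖w‖ ≤ Real.exp L → k w ≠ 0)
    (h1 : ∀ w, ‖w‖ = 1 → ‖k w‖ = 1)
    (h2 : ∀ w, ‖w‖ = Real.exp L → ‖k w‖ = Real.exp l) : L ≤ l := by
  -- The exponent for which |w|^α agrees with |k(w)| on both circles.
  set α := l / L with hα
  have hαL : α * L = l := div_mul_cancel₀ _ hL.ne'
  have hα0 : 0 < α := div_pos hl hL
  have key : ∀ w, 1 ≤ ‖w‖ → ‖w‖ ≤ Real.exp L → ‖k w‖ = ‖w‖ ^ α := by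
    intro w hw1 hw2
    -- The lower bound is the same estimate for 1/k, with exponent -α.
    refine le_antisymm (norm_le_rpow_of_annulus hc hd h1 (by rwa [hαL]) hw1 hw2) ?_
    have := norm_le_rpow_of_annulus (k := fun w => (k w)⁻¹) (α := -α)
      (hc.inv₀ fun w hw => h0 w hw.1 hw.2)
      (fun w hw1 hw2 => (hd w hw1 hw2).inv (h0 w hw1.le hw2.le))
      (fun w hw => by rw [norm_inv, h1 w hw, inv_one])
      (fun w hw => by rw [norm_inv, h2 w hw, neg_mul, hαL, Real.exp_neg]) hw1 hw2
    rw [norm_inv, Real.rpow_neg (norm_nonneg _)] at this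
    exact (inv_le_inv₀ (norm_pos_iff.2 (h0 w hw1 hw2))
      (Real.rpow_pos_of_pos (by linarith) _)).1 this
  set S : Set ℂ := {ζ : ℂ | 0 < ζ.re ∧ ζ.re < L}
  set G : ℂ → ℂ := fun ζ => k (Complex.exp ζ) * Complex.exp (-α * ζ) with hG
  have hexp : ∀ ζ ∈ S, 1 < ‖Complex.exp ζ‖ ∧ ‖Complex.exp ζ‖ < Real.exp L := fun ζ hζ => by
    rw [Complex.norm_exp]
    exact ⟨Real.one_lt_exp_iff.2 hζ.1, Real.exp_lt_exp.2 hζ.2⟩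
  have hGn : ∀ ζ ∈ S, ‖G ζ‖ = 1 := fun ζ hζ => by
    simp only [hG, norm_mul]
    rw [key _ (hexp ζ hζ).1.le (hexp ζ hζ).2.le, Complex.norm_exp, Complex.norm_exp, ← Real.exp_mul,
      ← Real.exp_add]
    simp [mul_comm]
  have hGd : DifferentiableOn ℂ G S := fun ζ hζ => by
    have := (hd _ (hexp ζ hζ).1 (hexp ζ hζ).2).comp ζ Complex.differentiableAt_exp
    exact (this.mul (by fun_prop)).differentiableWithinAt
  have hp : ((L / 2 : ℝ) : ℂ) ∈ S := ⟨by simpa using half_pos hL, by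
    simpa using half_lt_self hL⟩
  -- The function k(e^ζ) e^{-αζ} has constant modulus, so it is constant on the strip. Its first
  -- factor has period 2πi, hence so has the second, and α is an integer.
  have hp' : ((L / 2 : ℝ) : ℂ) + 2 * Real.pi * Complex.I ∈ S := by
    refine ⟨?_, ?_⟩
    · simpa using half_pos hL
    · simpa using half_lt_self hL
  have hconst := Complex.eqOn_of_isPreconnected_of_isMaxOn_norm (convex_strip L).isPreconnected
    (isOpen_strip L) hGd hp (fun ζ hζ => by
      simp only [Set.mem_ofPred_eq, Function.comp_apply, hGn ζ hζ, hGn _ hp, le_refl]) hp'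
  simp only [hG, Function.const_apply, Complex.exp_add, Complex.exp_two_pi_mul_I, mul_one, mul_add]
    at hconst
  have hk0 : k (Complex.exp ((L / 2 : ℝ) : ℂ)) ≠ 0 :=
    h0 _ (hexp _ hp).1.le (hexp _ hp).2.le
  have h3 : Complex.exp (-α * (2 * Real.pi * Complex.I)) = 1 := by
    have h4 := mul_left_cancel₀ hk0 hconst
    exact mul_left_cancel₀ (Complex.exp_ne_zero _) (h4.trans (mul_one _).symm)
  obtain ⟨n, hn⟩ := Complex.exp_eq_one_iff.1 h3
  have h5 : (-α : ℂ) = n := by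
    have : (2 * Real.pi * Complex.I : ℂ) ≠ 0 := Complex.two_pi_I_ne_zero
    exact mul_right_cancel₀ this hn
  have h6 : -α = n := by exact_mod_cast h5
  have h7 : n < 0 := by
    have : (n : ℝ) < 0 := by rw [← h6]; linarith
    exact_mod_cast this
  -- α = -n is a positive integer, so it is at least 1; no injectivity of k is needed.
  have h8 : (n : ℝ) ≤ -1 := by exact_mod_cast (by omega : n ≤ -1)
  have h9 : 1 ≤ α := by linarith
  rw [hα, one_le_div hL] at h9
  exact h9

/-! ### The conformal distance of two circles -/

/-- The closed unit disk as a subset of the sphere. -/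
def unitDisk : Set Sphere := (fun z : ℂ => (z : Sphere)) '' {z | ‖z‖ ≤ 1}

/-- The unit circle as a subset of the sphere. -/
def unitCircle : Set Sphere := (fun z : ℂ => (z : Sphere)) '' {z | ‖z‖ = 1}

theorem DiskAut.moebius_mem {A : SL(2, ℂ)} (hA : DiskAut A) {z : ℂ} (hz : ‖z‖ ≤ 1) :
    ∃ w : ℂ, ‖w‖ ≤ 1 ∧ (‖z‖ = 1 → ‖w‖ = 1) ∧ moebius A (z : Sphere) = (w : Sphere) := by
  have hd := hA.den_ne_zero hz
  have hd' := norm_pos_iff.2 hd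
  have h1 := hA.normSq_sub z
  refine ⟨num A z / den A z, ?_, fun h => ?_, moebius_of_den_ne_zero hd⟩
  · rw [norm_div, div_le_one hd']
    have := norm_nonneg z
    have := norm_nonneg (num A z)
    nlinarith
  · rw [norm_div, hA.circleAut.norm_num h, div_self hd'.ne']

theorem DiskAut.image_unitDisk {A : SL(2, ℂ)} (hA : DiskAut A) :
    moebius A '' unitDisk = unitDisk := by
  have key : ∀ {B : SL(2, ℂ)}, DiskAut B → ∀ x ∈ unitDisk, moebius B x ∈ unitDisk := by
    rintro B hB _ ⟨z, hz, rfl⟩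
    obtain ⟨w, hw, -, h⟩ := hB.moebius_mem hz
    exact ⟨w, hw, h.symm⟩
  refine Set.Subset.antisymm ?_ fun x hx => ⟨_, key hA.inv x hx, moebius_moebius_inv A x⟩
  rintro _ ⟨x, hx, rfl⟩
  exact key hA x hx

theorem DiskAut.image_unitCircle {A : SL(2, ℂ)} (hA : DiskAut A) :
    moebius A '' unitCircle = unitCircle := by
  have key : ∀ {B : SL(2, ℂ)}, DiskAut B → ∀ x ∈ unitCircle, moebius B x ∈ unitCircle := by
    rintro B hB _ ⟨z, hz, rfl⟩
    obtain ⟨w, -, hw, h⟩ := hB.moebius_mem (le_of_eq hz)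
    exact ⟨w, hw hz, h.symm⟩
  refine Set.Subset.antisymm ?_ fun x hx => ⟨_, key hA.inv x hx, moebius_moebius_inv A x⟩
  rintro _ ⟨x, hx, rfl⟩
  exact key hA x hx

theorem mem_tubeMat_image_unitDisk {l : ℝ} (x : Sphere) :
    x ∈ moebius (tubeMat l) '' unitDisk ↔
      x = OnePoint.infty ∨ ∃ w : ℂ, Real.exp l ≤ ‖w‖ ∧ x = (w : Sphere) := by
  constructor
  · rintro ⟨_, ⟨z, hz, rfl⟩, rfl⟩
    by_cases h0 : z = 0
    · subst h0; exact Or.inl (moebius_tubeMat_coe_zero l)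
    · refine Or.inr ⟨_, ?_, moebius_tubeMat_zero l h0⟩
      rw [norm_div, Complex.norm_real, Real.norm_eq_abs, Real.abs_exp,
        le_div_iff₀ (norm_pos_iff.2 h0)]
      exact mul_le_of_le_one_right (Real.exp_pos _).le hz
  · rintro (rfl | ⟨w, hw, rfl⟩)
    · exact ⟨_, ⟨0, by simp, rfl⟩, moebius_tubeMat_coe_zero l⟩
    · have hw0 : w ≠ 0 := by
        rintro rfl
        rw [norm_zero] at hw
        linarith [Real.exp_pos l]
      have hE : ((Real.exp l : ℝ) : ℂ) ≠ 0 := by exact_mod_cast (Real.exp_pos l).ne'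
      refine ⟨_, ⟨Real.exp l / w, ?_, rfl⟩, ?_⟩
      · rw [Set.mem_ofPred_eq, norm_div, Complex.norm_real, Real.norm_eq_abs, Real.abs_exp]
        exact div_le_one_of_le₀ hw (norm_nonneg _)
      · simp only
        rw [moebius_tubeMat_zero l (div_ne_zero hE hw0), div_div_cancel₀ hE]

theorem tubeMat_image_unitCircle (l : ℝ) :
    moebius (tubeMat l) '' unitCircle = (fun z : ℂ => (z : Sphere)) '' {z | ‖z‖ = Real.exp l} := by
  have hE : ((Real.exp l : ℝ) : ℂ) ≠ 0 := by exact_mod_cast (Real.exp_pos l).ne'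
  ext x
  constructor
  · rintro ⟨_, ⟨z, hz, rfl⟩, rfl⟩
    have hz' : ‖z‖ = 1 := hz
    have h0 : z ≠ 0 := by rintro rfl; simp at hz'
    refine ⟨_, ?_, (moebius_tubeMat_zero l h0).symm⟩
    rw [Set.mem_ofPred_eq, norm_div, Complex.norm_real, Real.norm_eq_abs, Real.abs_exp, hz', div_one]
  · rintro ⟨w, hw, rfl⟩
    have hw' : ‖w‖ = Real.exp l := hw
    have hw0 : w ≠ 0 := by
      rintro rfl
      rw [norm_zero] at hw'
      linarith [Real.exp_pos l]
    refine ⟨_, ⟨Real.exp l / w, ?_, rfl⟩, ?_⟩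
    · rw [Set.mem_ofPred_eq, norm_div, Complex.norm_real, Real.norm_eq_abs, Real.abs_exp, hw',
        div_self (Real.exp_pos l).ne']
    · simp only
      rw [moebius_tubeMat_zero l (div_ne_zero hE hw0), div_div_cancel₀ hE]

namespace ModelCurve

variable {I : Type*} (C : ModelCurve I)

theorem disk_eq (i : I) : C.disk i = moebius (C.chart i) '' unitDisk := by
  rw [disk, unitDisk, Set.image_image]

theorem circle_eq (i : I) : C.circle i = moebius (C.chart i) '' unitCircle := by
  rw [circle, unitCircle, Set.image_image]

theorem image_moebius_mul (A B : SL(2, ℂ)) (s : Set Sphere) :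
    moebius (A * B) '' s = moebius A '' (moebius B '' s) := by
  rw [Set.image_image]; simp only [moebius_mul]

/-- The matrix chart i · A carries the round annulus 1 < |w| < e^l onto the region between the
disks, so l is an admissible length. Any other parametrization, read in this coordinate, is a
nonvanishing function to which `tube_length_le` applies; hence l is the maximum. -/
theorem l_eq_of_trans {i j : I} {A B : SL(2, ℂ)} {l : ℝ} (hA : DiskAut A) (hB : DiskAut B)
    (hl : 0 < l) (hM : C.trans i j = A * tubeMat l * B) : C.l i j = l := by
  set G := C.chart i * A with hG
  have hj : C.chart j = G * tubeMat l * B := by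
    rw [hG, mul_assoc, mul_assoc, ← mul_assoc A, ← hM, trans, mul_inv_cancel_left]
  have d1 : C.disk i = moebius G '' unitDisk := by
    rw [C.disk_eq, hG, image_moebius_mul, hA.image_unitDisk]
  have c1 : C.circle i = moebius G '' unitCircle := by
    rw [C.circle_eq, hG, image_moebius_mul, hA.image_unitCircle]
  have d2 : C.disk j = moebius G '' (moebius (tubeMat l) '' unitDisk) := by
    rw [C.disk_eq, hj, image_moebius_mul, hB.image_unitDisk, image_moebius_mul]
  have c2 : C.circle j = moebius G '' ((fun z : ℂ => (z : Sphere)) '' {z | ‖z‖ = Real.exp l}) := by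
    rw [C.circle_eq, hj, image_moebius_mul, hB.image_unitCircle, image_moebius_mul,
      tubeMat_image_unitCircle]
  have hU : (C.disk i ∪ C.disk j)ᶜ =
      moebius G '' ((fun z : ℂ => (z : Sphere)) '' {w | 1 < ‖w‖ ∧ ‖w‖ < Real.exp l}) := by
    have hbij : Function.Bijective (moebius G) :=
      ⟨moebius_injective G, fun x => ⟨_, moebius_moebius_inv G x⟩⟩
    rw [d1, d2, ← Set.image_union, ← Set.image_compl_eq hbij]
    congr 1
    ext x
    simp only [Set.mem_compl_iff, Set.mem_union, mem_tubeMat_image_unitDisk]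
    induction x using OnePoint.rec with
    | infty => simp
    | coe w =>
      have e1 : ((w : Sphere) ∈ unitDisk) ↔ ‖w‖ ≤ 1 := by
        refine ⟨?_, fun h => ⟨w, h, rfl⟩⟩
        rintro ⟨z, hz, h⟩
        rw [← OnePoint.coe_injective h]; exact hz
      have e2 : ((w : Sphere) = OnePoint.infty ∨ ∃ v : ℂ, Real.exp l ≤ ‖v‖ ∧
          (w : Sphere) = (v : Sphere)) ↔ Real.exp l ≤ ‖w‖ := by
        constructor
        · rintro (h | ⟨v, hv, h⟩)
          · exact absurd h (OnePoint.coe_ne_infty w)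
          · rw [OnePoint.coe_injective h]; exact hv
        · exact fun h => Or.inr ⟨w, h, rfl⟩
      rw [e1, e2]
      constructor
      · intro h
        push Not at h
        exact ⟨w, h, rfl⟩
      · rintro ⟨z, hz, h⟩
        rw [← OnePoint.coe_injective h]
        push Not; exact hz
  have hmem : IsConformalTube (C.disk i ∪ C.disk j)ᶜ (C.circle i) (C.circle j) l := by
    refine ⟨hl, fun w => moebius G (w : Sphere),
      ((continuous_moebius G).comp OnePoint.continuous_coe).continuousOn,
      ((moebius_injective G).comp OnePoint.coe_injective).injOn,
      fun w _ _ => ⟨G, id, analyticAt_id, Eventually.of_forall fun _ => rfl⟩, ?_, ?_, ?_⟩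
    · rw [hU, Set.image_image]
    · rw [c1, unitCircle, Set.image_image]
    · rw [c2, Set.image_image]
  refine IsGreatest.csSup_eq ⟨hmem, ?_⟩
  rintro L ⟨hL, h, hcont, -, hhol, himg, hin, hout⟩
  -- the map read in the coordinate in which the two circles are concentric
  have hval : ∀ w : ℂ, 1 ≤ ‖w‖ → ‖w‖ ≤ Real.exp L → ∃ v : ℂ, moebius G⁻¹ (h w) = (v : Sphere) ∧
      v ≠ 0 ∧ (‖w‖ = 1 → ‖v‖ = 1) ∧ (‖w‖ = Real.exp L → ‖v‖ = Real.exp l) := by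
    intro w hw1 hw2
    have hne1 : (1 : ℝ) ≠ Real.exp L := (Real.one_lt_exp_iff.2 hL).ne
    rcases hw1.eq_or_lt with e1 | e1
    · have : h w ∈ C.circle i := by rw [← hin]; exact ⟨w, e1.symm, rfl⟩
      rw [c1] at this
      obtain ⟨_, ⟨v, hv, rfl⟩, hv2⟩ := this
      have hv' : ‖v‖ = 1 := hv
      refine ⟨v, by rw [← hv2, moebius_inv_moebius], ?_, fun _ => hv, fun e2 => ?_⟩
      · rintro rfl; simp at hv'
      · exact absurd (e1.trans e2) hne1
    rcases hw2.eq_or_lt with e2 | e2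
    · have : h w ∈ C.circle j := by rw [← hout]; exact ⟨w, e2, rfl⟩
      rw [c2] at this
      obtain ⟨_, ⟨v, hv, rfl⟩, hv2⟩ := this
      have hv' : ‖v‖ = Real.exp l := hv
      refine ⟨v, by rw [← hv2, moebius_inv_moebius], ?_, fun e1 => ?_, fun _ => hv⟩
      · rintro rfl; rw [norm_zero] at hv'; linarith [Real.exp_pos l]
      · exact absurd (e1.symm.trans e2) hne1
    · have : h w ∈ (C.disk i ∪ C.disk j)ᶜ := by rw [← himg]; exact ⟨w, ⟨e1, e2⟩, rfl⟩
      rw [hU] at this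
      obtain ⟨_, ⟨v, hv, rfl⟩, hv2⟩ := this
      refine ⟨v, by rw [← hv2, moebius_inv_moebius], ?_, fun e => absurd e e1.ne',
        fun e => absurd e e2.ne⟩
      rintro rfl
      have := hv.1
      rw [norm_zero] at this; linarith
  choose! k hk hk0 hk1 hk2 using hval
  refine tube_length_le hL hl ?_ ?_ hk0 (fun w hw => hk1 w hw.ge ?_ hw)
    (fun w hw => hk2 w ?_ hw.le hw)
  · rw [OnePoint.isOpenEmbedding_coe.isEmbedding.continuousOn_iff]
    refine ((continuous_moebius G⁻¹).comp_continuousOn hcont).congr fun w hw => ?_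
    exact (hk w hw.1 hw.2).symm
  -- Near w the function k is the fraction num/den of G⁻¹g, composed with the local chart function
  -- u; since the values of k are finite, the denominator does not vanish.
  · intro w hw1 hw2
    obtain ⟨g, u, hu, hev⟩ := hhol w hw1 hw2
    have hnear : ∀ᶠ x in 𝓝 w, 1 < ‖x‖ ∧ ‖x‖ < Real.exp L :=
      (continuous_norm.continuousAt.eventually (lt_mem_nhds hw1)).and
        (continuous_norm.continuousAt.eventually (gt_mem_nhds hw2))
    have hkx : ∀ᶠ x in 𝓝 w, den (G⁻¹ * g) (u x) ≠ 0 ∧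
        num (G⁻¹ * g) (u x) / den (G⁻¹ * g) (u x) = k x := by
      filter_upwards [hev, hnear] with x hx hx2
      refine moebius_eq_coe ?_
      rw [moebius_mul, ← hx, hk x hx2.1.le hx2.2.le]
    have h1 : DifferentiableAt ℂ (fun x => num (G⁻¹ * g) (u x) / den (G⁻¹ * g) (u x)) w :=
      ((differentiable_num _ _).comp w hu.differentiableAt).div
        ((differentiable_den _ _).comp w hu.differentiableAt) hkx.self_of_nhds.1
    exact h1.congr_of_eventuallyEq (hkx.mono fun x hx => hx.2.symm)
  · rw [hw]; exact Real.one_le_exp hL.le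
  · rw [hw]; exact Real.one_le_exp hL.le

theorem exists_trans_eq {i j : I} (hij : i ≠ j) :
    ∃ A B : SL(2, ℂ), DiskAut A ∧ DiskAut B ∧ 0 < C.l i j ∧
      C.trans i j = A * tubeMat (C.l i j) * B := by
  obtain ⟨A, B, l, hA, hB, hl, hM⟩ := exists_tube_decomposition fun z hz =>
    C.norm_den_trans_lt hij (z := z) hz
  rw [C.l_eq_of_trans hA hB hl hM]
  exact ⟨A, B, hA, hB, hl, hM⟩

theorem l_pos {i j : I} (hij : i ≠ j) : 0 < C.l i j := by
  obtain ⟨A, B, -, -, h, -⟩ := C.exists_trans_eq hij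
  exact h

theorem DiskAut_neg {A : SL(2, ℂ)} (hA : DiskAut A) : DiskAut (-A) := by
  unfold DiskAut at *
  simp only [Matrix.SpecialLinearGroup.coe_neg, Matrix.neg_apply, map_neg, hA.1, hA.2, and_self]

/-- The inverse of A·T·B is a decomposition for the reversed pair: T⁻¹ = -T, and the sign can be
moved into SU(1,1). -/
theorem l_symm {i j : I} (hij : i ≠ j) : C.l j i = C.l i j := by
  obtain ⟨A, B, hA, hB, hl, hM⟩ := C.exists_trans_eq hij
  refine C.l_eq_of_trans (A := B⁻¹) (B := -A⁻¹) hB.inv (DiskAut_neg hA.inv) hl ?_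
  have h1 : C.trans j i = (C.trans i j)⁻¹ := by simp [trans]
  have h2 : (tubeMat (C.l i j))⁻¹ = -tubeMat (C.l i j) := by
    obtain ⟨t1, t2, t3, t4⟩ := tubeMat_entries (C.l i j)
    obtain ⟨i1, i2, i3, i4⟩ := inv_entries (tubeMat (C.l i j))
    ext a b
    fin_cases a <;> fin_cases b <;>
      simp [Matrix.SpecialLinearGroup.coe_neg, i1, i2, i3, i4, t1, t4]
  rw [h1, hM, mul_inv_rev, mul_inv_rev, h2]
  simp [mul_assoc]

/-- The singular values of the blocks of the operator with Cauchy kernel. -/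
theorem exists_block_svd {i j : I} (hij : i ≠ j) :
    ∃ (B : SL(2, ℂ)) (hB : DiskAut B) (u : HilbertBasis ℕ ℂ Lminus) (v : HilbertBasis ℕ ℂ Lplus),
      (∀ n : ℕ, (v n : L2) = (-Complex.I) • pull hB.circleAut (fourierLp 2 (n : ℤ))) ∧
      ∀ n : ℕ, C.block i j (u n) = ((Real.exp (-((n : ℝ) + 1 / 2) * C.l i j) : ℝ) : ℂ) • v n := by
  obtain ⟨A, B, hA, hB, hl, hM⟩ := C.exists_trans_eq hij
  obtain ⟨u, v, h1, h2⟩ := C.exists_svd hij hA hB hl hM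
  exact ⟨B, hB, u, v, h1, h2⟩

end ModelCurve

end HalfForm
end

noncomputable section
namespace HalfForm

open scoped ENNReal

/-! ### Hilbert-Schmidt norms -/

section HilbertSchmidt

variable {E F : Type*} [NormedAddCommGroup E] [InnerProductSpace ℂ E] [NormedAddCommGroup F]
  [InnerProductSpace ℂ F] {ι κ : Type*}

theorem enorm_sq_eq_ofReal {G : Type*} [NormedAddCommGroup G] (x : G) :
    ‖x‖ₑ ^ 2 = ENNReal.ofReal (‖x‖ ^ 2) := by
  rw [ENNReal.ofReal_pow (norm_nonneg _), ofReal_norm]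

theorem summable_sq_norm_iff {G : Type*} [NormedAddCommGroup G] {f : ι → G} :
    (Summable fun i => ‖f i‖ ^ 2) ↔ ∑' i, ‖f i‖ₑ ^ 2 ≠ ∞ := by
  simp only [enorm_sq_eq_ofReal]
  refine ⟨fun h => h.tsum_ofReal_ne_top, fun h => ?_⟩
  have := ENNReal.summable_toReal h
  simpa only [ENNReal.toReal_ofReal (sq_nonneg _)] using this

theorem hasSum_sq_norm_inner (b : HilbertBasis ι ℂ E) (x : E) :
    HasSum (fun i => ‖inner ℂ (b i) x‖ ^ 2) (‖x‖ ^ 2) := by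
  have h := b.hasSum_inner_mul_inner x x
  rw [inner_self_eq_norm_sq_to_K] at h
  rw [← Complex.hasSum_ofReal]
  have h1 : (fun i => ((‖inner ℂ (b i) x‖ ^ 2 : ℝ) : ℂ)) =
      fun i => inner ℂ x (b i) * inner ℂ (b i) x := by
    funext i
    rw [← inner_conj_symm x (b i), mul_comm, Complex.mul_conj, Complex.normSq_eq_norm_sq]
  rw [h1, Complex.ofReal_pow]
  exact h

theorem enorm_sq_eq_tsum_inner (b : HilbertBasis ι ℂ E) (x : E) :
    ‖x‖ₑ ^ 2 = ∑' i, ‖inner ℂ (b i) x‖ₑ ^ 2 := by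
  have h := hasSum_sq_norm_inner b x
  simp only [enorm_sq_eq_ofReal]
  rw [← ENNReal.ofReal_tsum_of_nonneg (fun _ => sq_nonneg _) h.summable, h.tsum_eq]

/-- By Parseval both sides are the double sum of |⟨c k, T (b i)⟩|², and in [0, ∞] the order of
summation does not matter. -/
theorem tsum_enorm_sq_eq_adjoint [CompleteSpace E] [CompleteSpace F] (b : HilbertBasis ι ℂ E)
    (c : HilbertBasis κ ℂ F) (T : E →L[ℂ] F) :
    ∑' i, ‖T (b i)‖ₑ ^ 2 = ∑' k, ‖ContinuousLinearMap.adjoint T (c k)‖ₑ ^ 2 := by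
  simp only [enorm_sq_eq_tsum_inner c (T _), enorm_sq_eq_tsum_inner b (ContinuousLinearMap.adjoint T _)]
  rw [ENNReal.tsum_comm]
  refine tsum_congr fun k => tsum_congr fun i => ?_
  rw [ContinuousLinearMap.adjoint_inner_right, ← inner_conj_symm]
  congr 1
  rw [← ofReal_norm, ← ofReal_norm, RCLike.norm_conj]

/-- The Hilbert-Schmidt norm does not depend on the basis. -/
theorem tsum_enorm_sq_eq [CompleteSpace E] [CompleteSpace F] (b : HilbertBasis ι ℂ E)
    (b' : HilbertBasis κ ℂ E) (T : E →L[ℂ] F) :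
    ∑' i, ‖T (b i)‖ₑ ^ 2 = ∑' k, ‖T (b' k)‖ₑ ^ 2 := by
  obtain ⟨w, c, -⟩ := exists_hilbertBasis ℂ F
  rw [tsum_enorm_sq_eq_adjoint b c, tsum_enorm_sq_eq_adjoint b' c]

theorem isHilbertSchmidt_iff [CompleteSpace E] [CompleteSpace F] (b : HilbertBasis ι ℂ E)
    (T : E →L[ℂ] F) : IsHilbertSchmidt T ↔ ∑' i, ‖T (b i)‖ₑ ^ 2 ≠ ∞ := by
  constructor
  · rintro ⟨w, c, h⟩
    rw [tsum_enorm_sq_eq b c]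
    exact summable_sq_norm_iff.1 h
  · intro h
    obtain ⟨w, c, -⟩ := exists_hilbertBasis ℂ E
    refine ⟨w, c, summable_sq_norm_iff.2 ?_⟩
    rwa [tsum_enorm_sq_eq c b]

/-- Square-summable columns define a bounded operator, by Cauchy–Schwarz. -/
theorem exists_clm_of_basis [CompleteSpace F] (b : HilbertBasis ι ℂ E) (y : ι → F)
    (hy : ∑' i, ‖y i‖ₑ ^ 2 ≠ ∞) : ∃ T : E →L[ℂ] F, ∀ i, T (b i) = y i := by
  have hy' := summable_sq_norm_iff.2 hy
  have hb : ∀ x : E, Summable fun i => ‖b.repr x i‖ ^ 2 := fun x => by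
    simp only [HilbertBasis.repr_apply_apply]
    exact (hasSum_sq_norm_inner b x).summable
  have hcs : ∀ x : E, (Summable fun i => ‖b.repr x i‖ * ‖y i‖) ∧
      ∑' i, ‖b.repr x i‖ * ‖y i‖ ≤ ‖x‖ * Real.sqrt (∑' i, ‖y i‖ ^ 2) := fun x => by
    have h2 : Real.HolderConjugate 2 2 := Real.HolderConjugate.two_two
    have := Real.summable_and_inner_le_Lp_mul_Lq_tsum_of_nonneg h2 (f := fun i => ‖b.repr x i‖)
      (g := fun i => ‖y i‖) (fun _ => norm_nonneg _) (fun _ => norm_nonneg _)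
      (by simpa only [Real.rpow_two] using hb x) (by simpa only [Real.rpow_two] using hy')
    refine ⟨this.1, this.2.trans ?_⟩
    simp only [Real.rpow_two, ← Real.sqrt_eq_rpow]
    simp only [HilbertBasis.repr_apply_apply]
    rw [(hasSum_sq_norm_inner b x).tsum_eq, Real.sqrt_sq (norm_nonneg _)]
  have hsum : ∀ x : E, Summable fun i => b.repr x i • y i := fun x => by
    refine Summable.of_norm ?_
    simpa only [norm_smul] using (hcs x).1
  let T : E →ₗ[ℂ] F :=
    { toFun := fun x => ∑' i, b.repr x i • y i
      map_add' := fun x z => by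
        rw [← (hsum x).tsum_add (hsum z)]
        refine tsum_congr fun i => ?_
        rw [map_add, lp.coeFn_add, Pi.add_apply, add_smul]
      map_smul' := fun c x => by
        rw [RingHom.id_apply, ← (hsum x).tsum_const_smul]
        refine tsum_congr fun i => ?_
        rw [map_smul, lp.coeFn_smul, Pi.smul_apply, smul_assoc] }
  refine ⟨T.mkContinuous (Real.sqrt (∑' i, ‖y i‖ ^ 2)) fun x => ?_, fun i => ?_⟩
  · change ‖∑' i, b.repr x i • y i‖ ≤ _
    refine (norm_tsum_le_tsum_norm ?_).trans ?_
    · simpa only [norm_smul] using (hcs x).1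
    · simp only [norm_smul]
      rw [mul_comm]; exact (hcs x).2
  · change ∑' k, b.repr (b i) k • y k = y i
    classical
    rw [tsum_eq_single i]
    · rw [HilbertBasis.repr_self]; simp
    · intro k hk
      rw [HilbertBasis.repr_self, lp.single_apply_ne _ _ _ hk, zero_smul]

end HilbertSchmidt

/-! ### Hilbert sums -/

section lpSum

variable {I : Type*} {E : Type*} [NormedAddCommGroup E]

theorem hasSum_sq_norm_lp (x : lp (fun _ : I => E) 2) :
    HasSum (fun i => ‖x i‖ ^ 2) (‖x‖ ^ 2) := by
  have := lp.hasSum_norm (p := 2) (by simp) x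
  simpa using this

theorem enorm_sq_lp (x : lp (fun _ : I => E) 2) : ‖x‖ₑ ^ 2 = ∑' i, ‖x i‖ₑ ^ 2 := by
  have h := hasSum_sq_norm_lp x
  simp only [enorm_sq_eq_ofReal]
  rw [← ENNReal.ofReal_tsum_of_nonneg (fun _ => sq_nonneg _) h.summable, h.tsum_eq]

theorem exists_lp_of_tsum {f : I → E} (hf : ∑' i, ‖f i‖ₑ ^ 2 ≠ ∞) :
    ∃ x : lp (fun _ : I => E) 2, ∀ i, x i = f i := by
  have h : Memℓp f 2 := memℓp_gen (by
    simpa using summable_sq_norm_iff.2 hf)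
  exact ⟨⟨f, h⟩, fun _ => rfl⟩

open Classical in
theorem exists_lpBasis [InnerProductSpace ℂ E] [CompleteSpace E] (e : HilbertBasis ℕ ℂ E) :
    ∃ b : HilbertBasis (I × ℕ) ℂ (lp (fun _ : I => E) 2),
      ∀ p : I × ℕ, b p = lp.single 2 p.1 (e p.2) := by
  have ho : Orthonormal ℂ fun p : I × ℕ => (lp.single 2 p.1 (e p.2) : lp (fun _ : I => E) 2) := by
    rw [orthonormal_iff_ite]
    rintro ⟨i, m⟩ ⟨j, n⟩
    rw [lp.inner_single_left]
    simp only
    by_cases hij : i = j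
    · subst hij
      rw [lp.single_apply_self, orthonormal_iff_ite.1 e.orthonormal m n]
      simp
    · rw [lp.single_apply_ne _ _ _ hij, inner_zero_right, if_neg]
      exact fun h => hij (congrArg Prod.fst h)
  refine ⟨HilbertBasis.mkOfOrthogonalEqBot ho ?_, fun p => ?_⟩
  · rw [Submodule.eq_bot_iff]
    intro x hx
    refine lp.ext (funext fun i => ?_)
    have h1 : ∀ n, inner ℂ (e n) (x i) = 0 := fun n => by
      exact (lp.inner_single_left i (e n) x).symm.trans (hx _ (Submodule.subset_span ⟨(i, n), rfl⟩))
    have h2 := hasSum_sq_norm_inner e (x i)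
    simp only [h1, norm_zero, ne_eq, OfNat.ofNat_ne_zero, not_false_eq_true, zero_pow] at h2
    have h3 := h2.unique hasSum_zero
    simpa using h3
  · rw [HilbertBasis.coe_mkOfOrthogonalEqBot]

end lpSum

theorem nonempty_basis_Lminus : Nonempty (HilbertBasis ℕ ℂ Lminus) := by
  have : DiskAut 1 := by simp [DiskAut]
  obtain ⟨u, -⟩ := exists_minusBasis this
  exact ⟨u⟩

/-- A Hilbert basis of the space of half-forms that extend outside. -/
def minusBasis : HilbertBasis ℕ ℂ Lminus := nonempty_basis_Lminus.some

/-- The square of the Hilbert-Schmidt norm of an operator. -/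
def hsSq {F : Type*} [NormedAddCommGroup F] [InnerProductSpace ℂ F] (T : Lminus →L[ℂ] F) : ℝ≥0∞ :=
  ∑' n, ‖T (minusBasis n)‖ₑ ^ 2

theorem hsSq_eq {F : Type*} [NormedAddCommGroup F] [InnerProductSpace ℂ F] [CompleteSpace F]
    (T : Lminus →L[ℂ] F) (b : HilbertBasis ℕ ℂ Lminus) : hsSq T = ∑' n, ‖T (b n)‖ₑ ^ 2 :=
  tsum_enorm_sq_eq _ _ _

/-! ### The Hilbert–Schmidt property block by block -/

namespace ModelCurve

variable {I : Type*} (C : ModelCurve I)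

theorem inv_mem_pos_of_notMem {k : I} (hk : k ∉ C.pos) : C.inv k ∈ C.pos := (C.inv_mem_pos k).2 hk

theorem inv_notMem_pos {k : I} (hk : k ∈ C.pos) : C.inv k ∉ C.pos := fun h =>
  (C.inv_mem_pos k).1 h hk

/-- The involution as a permutation. -/
def invEquiv : I ≃ I := ⟨C.inv, C.inv, C.inv_inv, C.inv_inv⟩

open Classical in
/-- The block `L₂⁻(∂K j) → L₂⁻(∂K k)` of the product of a direct sum of operators `P i` with the
operator with Cauchy kernel. -/
def rowBlock (P : I → (Lplus × Lplus →L[ℂ] Lminus × Lminus)) (k j : I) : Lminus →L[ℂ] Lminus :=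
  if k ∈ C.pos then
    ContinuousLinearMap.fst ℂ Lminus Lminus ∘L P k ∘L (C.block j k).prod (C.block j (C.inv k))
  else ContinuousLinearMap.snd ℂ Lminus Lminus ∘L P (C.inv k) ∘L
    (C.block j (C.inv k)).prod (C.block j k)

theorem rowBlock_of_mem {P : I → (Lplus × Lplus →L[ℂ] Lminus × Lminus)} {k : I} (hk : k ∈ C.pos)
    (j : I) (f : Lminus) :
    C.rowBlock P k j f = (P k (C.block j k f, C.block j (C.inv k) f)).1 := by
  rw [rowBlock, if_pos hk]; rfl

theorem rowBlock_of_notMem {P : I → (Lplus × Lplus →L[ℂ] Lminus × Lminus)} {k : I}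
    (hk : k ∉ C.pos) (j : I) (f : Lminus) :
    C.rowBlock P k j f = (P (C.inv k) (C.block j (C.inv k) f, C.block j k f)).2 := by
  rw [rowBlock, if_neg hk]; rfl

theorem rowBlock_inv {P : I → (Lplus × Lplus →L[ℂ] Lminus × Lminus)} {k : I} (hk : k ∈ C.pos)
    (j : I) (f : Lminus) :
    C.rowBlock P (C.inv k) j f = (P k (C.block j k f, C.block j (C.inv k) f)).2 := by
  rw [C.rowBlock_of_notMem (C.inv_notMem_pos hk), C.inv_inv]

open Classical in
/-- The Hilbert-Schmidt property in terms of the Hilbert-Schmidt norms of the blocks. -/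
theorem Bundle.piCauchyIsHilbertSchmidt_iff {C : ModelCurve I} (L : C.Bundle) :
    L.PiCauchyIsHilbertSchmidt ↔ ∃ P : I → (Lplus × Lplus →L[ℂ] Lminus × Lminus),
      (∀ i ∈ C.pos, L.IsGluingOperator i (P i)) ∧ ∑' k, ∑' j, hsSq (C.rowBlock P k j) ≠ ∞ := by
  obtain ⟨b, hb⟩ := exists_lpBasis (I := I) minusBasis
  constructor
  · rintro ⟨P, hP, T, hT, h⟩
    refine ⟨P, hP, ?_⟩
    have hrow : ∀ j k f, T (lp.single 2 j f) k = C.rowBlock P k j f := by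
      intro j k f
      by_cases hk : k ∈ C.pos
      · have := congrArg Prod.fst (h j f k hk)
        rw [C.rowBlock_of_mem hk, ← C.cauchyBlock_eq, ← C.cauchyBlock_eq]; exact this
      · have := congrArg Prod.snd (h j f _ (C.inv_mem_pos_of_notMem hk))
        rw [C.inv_inv] at this
        rw [C.rowBlock_of_notMem hk, ← C.cauchyBlock_eq, ← C.cauchyBlock_eq]; exact this
    rw [isHilbertSchmidt_iff b] at hT
    convert hT using 1
    simp only [hb, enorm_sq_lp, hrow, hsSq]
    rw [ENNReal.tsum_comm]
    refine Eq.trans ?_ (ENNReal.tsum_prod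
      (f := fun j n => ∑' k, ‖C.rowBlock P k j (minusBasis n)‖ₑ ^ 2)).symm
    exact tsum_congr fun j => ENNReal.tsum_comm
  · rintro ⟨P, hP, hfin⟩
    refine ⟨P, hP, ?_⟩
    have hfin' : ∑' p : I × ℕ, ∑' k, ‖C.rowBlock P k p.1 (minusBasis p.2)‖ₑ ^ 2 ≠ ∞ := by
      convert hfin using 1
      simp only [hsSq]
      refine (ENNReal.tsum_prod
        (f := fun j n => ∑' k, ‖C.rowBlock P k j (minusBasis n)‖ₑ ^ 2)).trans ?_
      exact (tsum_congr fun j => ENNReal.tsum_comm).trans ENNReal.tsum_comm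
    have hp : ∀ p : I × ℕ, ∃ y : lp (fun _ : I => Lminus) 2,
        ∀ k, y k = C.rowBlock P k p.1 (minusBasis p.2) := fun p =>
      exists_lp_of_tsum (ENNReal.ne_top_of_tsum_ne_top hfin' p)
    choose y hy using hp
    obtain ⟨T, hT⟩ := exists_clm_of_basis b y (by simpa only [enorm_sq_lp, hy] using hfin')
    refine ⟨T, ?_, ?_⟩
    · rw [isHilbertSchmidt_iff b]
      simpa only [hT, enorm_sq_lp, hy] using hfin'
    · have hrow : ∀ j k f, T (lp.single 2 j f) k = C.rowBlock P k j f := by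
        intro j k f
        -- T has been prescribed on basis vectors only; both sides are bounded, so they agree on the
        -- whole summand.
        have heq : (lp.evalCLM ℂ (fun _ : I => Lminus) 2 k) ∘L T ∘L
            (lp.singleContinuousLinearMap ℂ (fun _ : I => Lminus) 2 j) = C.rowBlock P k j := by
          refine ContinuousLinearMap.ext_on (s := Set.range minusBasis) ?_ ?_
          · exact Submodule.dense_iff_topologicalClosure_eq_top.2 minusBasis.dense_span
          · rintro _ ⟨n, rfl⟩
            have := hb (j, n)
            simp only at this
            change T (lp.single 2 j (minusBasis n)) k = _
            rw [← this, hT, hy]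
        exact congrArg (fun S : Lminus →L[ℂ] Lminus => S f) heq
      intro j f i hi
      rw [hrow, hrow, C.rowBlock_of_mem hi, C.rowBlock_inv hi, C.cauchyBlock_eq, C.cauchyBlock_eq]

end ModelCurve

end HalfForm
end

noncomputable section
namespace HalfForm

/-! ### Multiplication operators -/

theorem memLp_mul (h : C(UnitAddCircle, ℂ)) (f : L2) : MemLp (fun t => h t * f t) 2 haar :=
  (Lp.memLp f).of_le_mul (c := ‖h‖)
    (h.continuous.aestronglyMeasurable.mul (Lp.aestronglyMeasurable f))
    (Filter.Eventually.of_forall fun t => by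
      rw [norm_mul]; exact mul_le_mul_of_nonneg_right (h.norm_coe_le_norm t) (norm_nonneg _))

/-- Multiplication by a continuous function. -/
def mulOp (h : C(UnitAddCircle, ℂ)) : L2 →L[ℂ] L2 :=
  LinearMap.mkContinuous
    { toFun := fun f => (memLp_mul h f).toLp _
      map_add' := fun f g => by
        refine Lp.ext ?_
        filter_upwards [(memLp_mul h (f + g)).coeFn_toLp, (memLp_mul h f).coeFn_toLp,
          (memLp_mul h g).coeFn_toLp, Lp.coeFn_add f g,
          Lp.coeFn_add ((memLp_mul h f).toLp _) ((memLp_mul h g).toLp _)] with t h1 h2 h3 h4 h5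
        rw [h1, h5, Pi.add_apply, h2, h3, h4, Pi.add_apply, mul_add]
      map_smul' := fun c f => by
        refine Lp.ext ?_
        filter_upwards [(memLp_mul h (c • f)).coeFn_toLp, (memLp_mul h f).coeFn_toLp,
          Lp.coeFn_smul c f, Lp.coeFn_smul c ((memLp_mul h f).toLp _)] with t h1 h2 h3 h4
        rw [RingHom.id_apply, h1, h4, Pi.smul_apply, h2, h3, Pi.smul_apply, smul_eq_mul,
          smul_eq_mul, mul_left_comm] }
    ‖h‖ fun f => by
      refine Lp.norm_le_mul_norm_of_ae_le_mul ?_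
      filter_upwards [(memLp_mul h f).coeFn_toLp] with t h1
      change ‖((memLp_mul h f).toLp _ : L2) t‖ ≤ _
      rw [h1, norm_mul]
      exact mul_le_mul_of_nonneg_right (h.norm_coe_le_norm t) (norm_nonneg _)

theorem coeFn_mulOp (h : C(UnitAddCircle, ℂ)) (f : L2) :
    mulOp h f =ᵐ[haar] fun t => h t * f t := (memLp_mul h f).coeFn_toLp

theorem norm_mulOp_le (h : C(UnitAddCircle, ℂ)) (f : L2) : ‖mulOp h f‖ ≤ ‖h‖ * ‖f‖ :=
  ((mulOp h).le_opNorm f).trans (mul_le_mul_of_nonneg_right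
    (LinearMap.mkContinuous_norm_le _ (norm_nonneg _) _) (norm_nonneg _))

theorem eq_mulOp_iff {h : C(UnitAddCircle, ℂ)} {f g : L2} :
    g = mulOp h f ↔ ∀ᵐ t ∂haar, g t = h t * f t := by
  constructor
  · rintro rfl; exact coeFn_mulOp h f
  · intro H
    refine Lp.ext ?_
    filter_upwards [H, coeFn_mulOp h f] with t h1 h2
    rw [h1, h2]

theorem mulOp_mulOp (g h : C(UnitAddCircle, ℂ)) (f : L2) :
    mulOp g (mulOp h f) = mulOp (g * h) f := by
  rw [eq_mulOp_iff]
  filter_upwards [coeFn_mulOp g (mulOp h f), coeFn_mulOp h f] with t h1 h2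
  rw [h1, h2, ContinuousMap.mul_apply, mul_assoc]

theorem mulOp_one (f : L2) : mulOp 1 f = f := by
  rw [eq_comm, eq_mulOp_iff]
  exact Filter.Eventually.of_forall fun t => by simp

theorem mulOp_add (g h : C(UnitAddCircle, ℂ)) (f : L2) :
    mulOp (g + h) f = mulOp g f + mulOp h f := by
  rw [eq_comm, eq_mulOp_iff]
  filter_upwards [Lp.coeFn_add (mulOp g f) (mulOp h f), coeFn_mulOp g f, coeFn_mulOp h f]
    with t h1 h2 h3
  rw [h1, Pi.add_apply, h2, h3, ContinuousMap.add_apply, add_mul]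

theorem mulOp_smul (c : ℂ) (h : C(UnitAddCircle, ℂ)) (f : L2) :
    mulOp (c • h) f = c • mulOp h f := by
  rw [eq_comm, eq_mulOp_iff]
  filter_upwards [Lp.coeFn_smul c (mulOp h f), coeFn_mulOp h f] with t h1 h2
  rw [h1, Pi.smul_apply, h2, ContinuousMap.smul_apply, smul_eq_mul, smul_eq_mul, mul_assoc]

theorem mulOp_fourier (m k : ℤ) :
    mulOp (fourier m) (fourierLp 2 k : L2) = (fourierLp 2 (m + k) : L2) := by
  rw [eq_comm, eq_mulOp_iff]
  filter_upwards [coeFn_fourierLp_two k, coeFn_fourierLp_two (m + k)] with t h1 h2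
  rw [h1, h2, fourier_eq_zpow, zpow_add₀ (unitPt_ne_zero t)]

theorem continuous_mulOp_left (f : L2) : Continuous fun h : C(UnitAddCircle, ℂ) => mulOp h f := by
  let T : C(UnitAddCircle, ℂ) →ₗ[ℂ] L2 :=
    { toFun := fun h => mulOp h f
      map_add' := fun g h => mulOp_add g h f
      map_smul' := fun c h => mulOp_smul c h f }
  exact AddMonoidHomClass.continuous_of_bound T ‖f‖ fun h => by
    rw [mul_comm]; exact norm_mulOp_le h f

/-- The continuous functions multiplication by which preserves a subspace of half-forms. -/
def multipliers (V : Submodule ℂ L2) : Subalgebra ℂ C(UnitAddCircle, ℂ) where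
  carrier := {h | ∀ f ∈ V, mulOp h f ∈ V}
  mul_mem' := fun {g h} hg hh f hf => by rw [← mulOp_mulOp]; exact hg _ (hh f hf)
  add_mem' := fun {g h} hg hh f hf => by
    rw [mulOp_add]; exact V.add_mem (hg f hf) (hh f hf)
  algebraMap_mem' := fun c f hf => by
    rw [Algebra.algebraMap_eq_smul_one, mulOp_smul, mulOp_one]; exact V.smul_mem c hf

theorem isClosed_multipliers {V : Submodule ℂ L2} (hV : IsClosed (V : Set L2)) :
    IsClosed (multipliers V : Set C(UnitAddCircle, ℂ)) := by
  have : (multipliers V : Set C(UnitAddCircle, ℂ)) =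
      ⋂ f : V, (fun h : C(UnitAddCircle, ℂ) => mulOp h (f : L2)) ⁻¹' (V : Set L2) := by
    ext h
    rw [Set.mem_iInter]
    exact ⟨fun H f => H f f.2, fun H f hf => H ⟨f, hf⟩⟩
  rw [this]
  exact isClosed_iInter fun f => hV.preimage (continuous_mulOp_left f)

theorem fourier_mem_multipliers_Lplus {m : ℤ} (hm : 0 ≤ m) :
    (fourier m : C(UnitAddCircle, ℂ)) ∈ multipliers Lplus := by
  have h : Lplus ≤ Lplus.comap (mulOp (fourier m)).toLinearMap :=
    Lplus_le (isClosed_Lplus.preimage (mulOp (fourier m)).continuous) fun k hk => by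
      change mulOp _ _ ∈ Lplus
      rw [mulOp_fourier]; exact fourierLp_mem_Lplus (by lia)
  exact fun f hf => h hf

theorem fourier_mem_multipliers_Lminus {m : ℤ} (hm : m ≤ 0) :
    (fourier m : C(UnitAddCircle, ℂ)) ∈ multipliers Lminus := by
  have h : Lminus ≤ Lminus.comap (mulOp (fourier m)).toLinearMap :=
    Lminus_le (isClosed_Lminus.preimage (mulOp (fourier m)).continuous) fun k hk => by
      change mulOp _ _ ∈ Lminus
      rw [mulOp_fourier]; exact fourierLp_mem_Lminus (by lia)
  exact fun f hf => h hf

/-- The exponential of a continuous function. -/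
def expMap (a : C(UnitAddCircle, ℂ)) : C(UnitAddCircle, ℂ) :=
  ⟨fun t => Complex.exp (a t), Complex.continuous_exp.comp a.continuous⟩

theorem expMap_mul_neg (a : C(UnitAddCircle, ℂ)) : expMap a * expMap (-a) = 1 := by
  ext t
  change Complex.exp (a t) * Complex.exp (-a t) = 1
  rw [← Complex.exp_add, add_neg_cancel, Complex.exp_zero]

theorem expMap_neg_mul (a : C(UnitAddCircle, ℂ)) : expMap (-a) * expMap a = 1 := by
  rw [mul_comm, expMap_mul_neg]

/-- The exponential series converges uniformly and its partial sums are polynomials in a. -/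
theorem expMap_mem {S : Subalgebra ℂ C(UnitAddCircle, ℂ)}
    (hS : IsClosed (S : Set C(UnitAddCircle, ℂ))) {a : C(UnitAddCircle, ℂ)} (ha : a ∈ S) :
    expMap a ∈ S := by
  have h := NormedSpace.exp_series_hasSum_exp' (𝕂 := ℂ) a
  have he : NormedSpace.exp a = expMap a := by
    ext t
    have h1 := h.map (ContinuousMap.evalCLM ℂ t : C(UnitAddCircle, ℂ) →L[ℂ] ℂ)
      (ContinuousLinearMap.continuous _)
    have h2 := NormedSpace.exp_series_hasSum_exp' (𝕂 := ℂ) (a t)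
    rw [← Complex.exp_eq_exp_ℂ] at h2
    exact h1.unique h2
  rw [he] at h
  exact hS.mem_of_tendsto h (Filter.Eventually.of_forall fun s =>
    S.sum_mem fun n _ => S.smul_mem (S.pow_mem ha n) _)

/-! ### Factorization -/

/-- Integration by parts: for n ≠ 0 the coefficient has modulus |D_n| / (2π|n|), where D_n is the
coefficient of the derivative. Both D_n and 1/n are square-summable. -/
theorem summable_fourierCoeff_of_hasDerivAt {B : C(UnitAddCircle, ℂ)} {b : ℝ → ℂ}
    {D : C(UnitAddCircle, ℂ)} (hb : ∀ x : ℝ, HasDerivAt b (D (x : UnitAddCircle)) x) (h01 : b 1 = b 0)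
    (hB : ⇑B = AddCircle.liftIco 1 0 b) : Summable (fourierCoeff B) := by
  have hint : IntervalIntegrable (fun x : ℝ => D x) volume 0 (0 + 1) :=
    (D.continuous.comp (AddCircle.continuous_mk' 1)).intervalIntegrable _ _
  have hD : ∀ n, fourierCoeffOn (lt_add_of_pos_right 0 zero_lt_one) (fun x : ℝ => D x) n =
      fourierCoeff D n := fun n => by
    rw [fourierCoeffOn_eq_integral, fourierCoeff_eq_intervalIntegral _ _ 0]
    simp
  have hsq : Summable fun n : ℤ => ‖fourierCoeff D n‖ ^ 2 := by
    have := (hasSum_sq_fourierCoeff (ContinuousMap.toLp 2 AddCircle.haarAddCircle ℂ D)).summable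
    simpa only [fourierCoeff_toLp] using this
  have hinv : Summable fun n : ℤ => ((n : ℝ) ^ 2)⁻¹ := by
    simpa using Real.summable_one_div_int_pow (p := 2) |>.2 one_lt_two
  refine Summable.of_norm_bounded_eventually (hsq.add hinv) ?_
  have hne : ∀ᶠ n : ℤ in Filter.cofinite, n ≠ 0 := (Set.finite_singleton 0).compl_mem_cofinite
  filter_upwards [hne] with n hn
  rw [hB, fourierCoeff_liftIco_eq, fourierCoeffOn_of_hasDerivAt _ hn (fun x _ => hb x) hint, hD]
  have hn' : (0 : ℝ) < |(n : ℝ)| := abs_pos.2 (Int.cast_ne_zero.2 hn)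
  have hpi : (1 : ℝ) ≤ 2 * Real.pi := by linarith [Real.two_le_pi]
  simp only [zero_add, h01, sub_self, mul_zero, zero_sub]
  rw [norm_mul, norm_div, norm_neg]
  simp only [norm_mul, norm_neg, norm_one, Complex.norm_I, Complex.norm_real, Complex.norm_intCast,
    Real.norm_eq_abs, abs_of_pos Real.pi_pos, mul_one]
  have e1 : ‖(2 : ℂ)‖ = 2 := by simp
  have e2 : ‖((1 : ℝ) : ℂ) - ((0 : ℝ) : ℂ)‖ = 1 := by simp
  rw [e1, e2, one_mul]
  have h1 : 1 / (2 * Real.pi * |(n : ℝ)|) ≤ |(n : ℝ)|⁻¹ := by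
    rw [one_div]
    exact inv_anti₀ hn' (le_mul_of_one_le_left hn'.le hpi)
  have h2 := mul_le_mul_of_nonneg_right h1 (norm_nonneg (fourierCoeff D n))
  refine h2.trans ?_
  rw [← sq_abs (n : ℝ), ← inv_pow]
  nlinarith [sq_nonneg (|(n : ℝ)|⁻¹ - ‖fourierCoeff D n‖), sq_nonneg (|(n : ℝ)|⁻¹),
    sq_nonneg ‖fourierCoeff D n‖]

/-- The series is split at frequency 0. Both halves converge uniformly, so they stay in the closed
algebras of multipliers; the constant term goes to the inner half. -/
theorem exists_add_of_summable_fourierCoeff {B : C(UnitAddCircle, ℂ)}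
    (hB : Summable (fourierCoeff B)) :
    ∃ a b : C(UnitAddCircle, ℂ), a ∈ multipliers Lplus ∧ b ∈ multipliers Lminus ∧ B = a + b := by
  have hs : Summable fun k : ℤ => fourierCoeff B k • (fourier k : C(UnitAddCircle, ℂ)) :=
    (hasSum_fourier_series_of_summable hB).summable
  have hB' := (hasSum_fourier_series_of_summable hB).tsum_eq
  refine ⟨∑' k : {k : ℤ | 0 ≤ k}, fourierCoeff B k • (fourier (k : ℤ) : C(UnitAddCircle, ℂ)),
    ∑' k : ↑({k : ℤ | 0 ≤ k}ᶜ), fourierCoeff B k • (fourier (k : ℤ) : C(UnitAddCircle, ℂ)),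
    ?_, ?_, ?_⟩
  · exact (isClosed_multipliers isClosed_Lplus).mem_of_tendsto (hs.subtype _).hasSum
      (Filter.Eventually.of_forall fun s => Subalgebra.sum_mem _ fun k _ =>
        Subalgebra.smul_mem _ (fourier_mem_multipliers_Lplus k.2) _)
  · exact (isClosed_multipliers isClosed_Lminus).mem_of_tendsto (hs.subtype _).hasSum
      (Filter.Eventually.of_forall fun s => Subalgebra.sum_mem _ fun k _ =>
        Subalgebra.smul_mem _ (fourier_mem_multipliers_Lminus (le_of_lt (not_le.1 (fun h => k.2 h)))) _)
  · exact hB'.symm.trans (Summable.tsum_add_tsum_compl (hs.subtype _) (hs.subtype _)).symm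

theorem integral_logDeriv_eq (F : ℂ → ℂ) :
    (2 * Real.pi * Complex.I)⁻¹ * ∮ z in C((0 : ℂ), 1), logDeriv F z =
      ∫ t, unitPt t * logDeriv F (unitPt t) ∂haar := by
  rw [integral_unitPt (fun z => z * logDeriv F z), Real.circleAverage_eq_circleIntegral one_ne_zero,
    smul_eq_mul]
  congr 1
  refine circleIntegral.integral_congr zero_le_one fun z hz => ?_
  have hz0 : z ≠ 0 := by
    rintro rfl; simp at hz
  simp only [sub_zero, smul_eq_mul]
  rw [inv_mul_cancel_left₀ hz0]

theorem hasDerivAt_unitPt_coe (x : ℝ) :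
    HasDerivAt (fun x : ℝ => unitPt (x : UnitAddCircle))
      (2 * Real.pi * Complex.I * unitPt (x : UnitAddCircle)) x := by
  simp only [unitPt_coe]
  have h1 : HasDerivAt (fun x : ℝ => 2 * Real.pi * (x : ℂ) * Complex.I) (2 * Real.pi * Complex.I) x :=
    (((Complex.ofRealCLM.hasDerivAt (x := x)).const_mul (2 * Real.pi : ℂ)).mul_const
      Complex.I).congr_deriv (by simp)
  refine h1.cexp.congr_deriv ?_
  rw [mul_comm]

/-- Wiener–Hopf factorization: z^{-k}F has a continuously differentiable logarithm on the circle,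
which is split into an inner and an outer part. The exponent k is the index. -/
theorem exists_factorization {F : ℂ → ℂ} (hF : AnalyticOnNhd ℂ F {z | ‖z‖ = 1})
    (h0 : ∀ z, ‖z‖ = 1 → F z ≠ 0) :
    ∃ (k : ℤ) (a b : C(UnitAddCircle, ℂ)),
      (2 * Real.pi * Complex.I)⁻¹ * ∮ z in C((0 : ℂ), 1), logDeriv F z = k ∧
      a ∈ multipliers Lplus ∧ b ∈ multipliers Lminus ∧
      ∀ t, F (unitPt t) = unitPt t ^ k * (expMap a t * expMap b t) := by
  have hcont : Continuous fun t => unitPt t * logDeriv F (unitPt t) := by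
    refine continuous_unitPt'.mul (continuous_iff_continuousAt.2 fun t => ?_)
    have h1 := hF (unitPt t) (norm_unitPt' t)
    exact ContinuousAt.comp (f := unitPt) (h1.deriv.continuousAt.div h1.continuousAt
      (h0 _ (norm_unitPt' t))) continuous_unitPt'.continuousAt
  let D₀ : C(UnitAddCircle, ℂ) := ⟨_, hcont⟩
  have hc : Continuous fun x : ℝ => 2 * Real.pi * Complex.I * D₀ (x : UnitAddCircle) :=
    continuous_const.mul (D₀.continuous.comp (AddCircle.continuous_mk' 1))
  set A : ℝ → ℂ := fun x => ∫ y in (0 : ℝ)..x, 2 * Real.pi * Complex.I * D₀ (y : UnitAddCircle)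
    with hA
  have hA' : ∀ x : ℝ, HasDerivAt A (2 * Real.pi * Complex.I * D₀ (x : UnitAddCircle)) x := fun x =>
    intervalIntegral.integral_hasDerivAt_right (hc.intervalIntegrable _ _)
      (hc.stronglyMeasurableAtFilter _ _) hc.continuousAt
  have hA0 : A 0 = 0 := intervalIntegral.integral_same
  have hFx : ∀ x : ℝ, HasDerivAt (fun x : ℝ => F (unitPt (x : UnitAddCircle)))
      (deriv F (unitPt (x : UnitAddCircle)) *
        (2 * Real.pi * Complex.I * unitPt (x : UnitAddCircle))) x := fun x =>
    (hF _ (norm_unitPt' _)).differentiableAt.hasDerivAt.comp x (hasDerivAt_unitPt_coe x)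
  have hexp : ∀ x : ℝ, F (unitPt (x : UnitAddCircle)) = F (unitPt 0) * Complex.exp (A x) := by
    have hd : ∀ x : ℝ, HasDerivAt
        (fun x : ℝ => F (unitPt (x : UnitAddCircle)) * Complex.exp (-A x)) 0 x := fun x => by
      refine ((hFx x).mul (hA' x).neg.cexp).congr_deriv ?_
      have hne := h0 _ (norm_unitPt' (x : UnitAddCircle))
      have hlog : D₀ (x : UnitAddCircle) = unitPt (x : UnitAddCircle) *
        (deriv F (unitPt (x : UnitAddCircle)) / F (unitPt (x : UnitAddCircle))) := rfl
      rw [hlog]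
      field_simp
      ring
    intro x
    have := is_const_of_deriv_eq_zero (fun y => (hd y).differentiableAt) (fun y => (hd y).deriv) x 0
    rw [hA0, neg_zero, Complex.exp_zero, mul_one, QuotientAddGroup.mk_zero] at this
    rw [← this, mul_assoc, ← Complex.exp_add, neg_add_cancel, Complex.exp_zero, mul_one]
  have hper : ((1 : ℝ) : UnitAddCircle) = 0 := AddCircle.coe_period 1
  -- F returns to its value after one turn, so its logarithm increases by a multiple of 2πi.
  obtain ⟨k, hk⟩ : ∃ k : ℤ, A 1 = k * (2 * Real.pi * Complex.I) := by
    rw [← Complex.exp_eq_one_iff]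
    have := hexp 1
    rw [hper] at this
    exact (mul_eq_left₀ (h0 _ (norm_unitPt' 0))).1 this.symm
  have hind : (2 * Real.pi * Complex.I)⁻¹ * ∮ z in C((0 : ℂ), 1), logDeriv F z = k := by
    have h2 : A 1 = 2 * Real.pi * Complex.I * ∫ t, D₀ t ∂haar := by
      rw [hA, AddCircle.integral_haarAddCircle, ← AddCircle.intervalIntegral_preimage 1 0, zero_add]
      simp only [intervalIntegral.integral_const_mul, inv_one, one_smul]
    rw [integral_logDeriv_eq]
    have h3 : (2 * Real.pi * Complex.I : ℂ) ≠ 0 := Complex.two_pi_I_ne_zero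
    change ∫ t, D₀ t ∂haar = k
    refine mul_left_cancel₀ h3 ?_
    rw [← h2, hk, mul_comm]
  -- The linear term removes the increment, so that b is a periodic logarithm of z^{-k}F.
  let b : ℝ → ℂ := fun x => Complex.log (F (unitPt 0)) + A x - 2 * Real.pi * Complex.I * k * x
  let D : C(UnitAddCircle, ℂ) := (2 * Real.pi * Complex.I : ℂ) • (D₀ - ContinuousMap.const _ (k : ℂ))
  have hb : ∀ x : ℝ, HasDerivAt b (D (x : UnitAddCircle)) x := fun x => by
    refine (((hA' x).const_add _).sub
      ((Complex.ofRealCLM.hasDerivAt (x := x)).const_mul (2 * Real.pi * Complex.I * k))).congr_deriv ?_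
    simp only [D, ContinuousMap.smul_apply, ContinuousMap.sub_apply,
      ContinuousMap.const_apply, smul_eq_mul, Complex.ofRealCLM_apply, Complex.ofReal_one,
      mul_one]
    ring
  have hb01 : b 1 = b 0 := by
    simp only [b, hA0, hk]; push_cast; ring
  have hbc : Continuous b := continuous_iff_continuousAt.2 fun x => (hb x).continuousAt
  let B : C(UnitAddCircle, ℂ) := ⟨AddCircle.liftIco 1 0 b,
    AddCircle.liftIco_continuous (by rw [zero_add, hb01]) hbc.continuousOn⟩
  obtain ⟨p, q, hp, hq, hpq⟩ := exists_add_of_summable_fourierCoeff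
    (summable_fourierCoeff_of_hasDerivAt (B := B) hb hb01 rfl)
  refine ⟨k, p, q, hind, hp, hq, fun t => ?_⟩
  obtain ⟨x, hx, rfl⟩ : ∃ x ∈ Set.Ico (0 : ℝ) (0 + 1), (x : UnitAddCircle) = t := by
    have := AddCircle.coe_image_Ico_eq (1 : ℝ) 0
    have ht : t ∈ Set.univ := Set.mem_univ t
    rw [← this] at ht
    exact ht
  change _ = _ * (Complex.exp (p x) * Complex.exp (q x))
  rw [← Complex.exp_add, ← ContinuousMap.add_apply, ← hpq]
  change _ = _ * Complex.exp (AddCircle.liftIco 1 0 b x)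
  rw [AddCircle.liftIco_coe_apply hx, unitPt_coe, ← Complex.exp_int_mul, ← Complex.exp_add,
    ← unitPt_coe, hexp x]
  simp only [b]
  rw [show ∀ u v w : ℂ, u + (v + A x - w) = v + (A x + (u - w)) from fun _ _ _ => by ring,
    Complex.exp_add, Complex.exp_log (h0 _ (norm_unitPt' 0))]
  congr 2; ring

end HalfForm
end

noncomputable section
namespace HalfForm

/-! ### The factorization problem -/

/-- The functions `exp a₊ exp a₋`, where `a₊` and `a₋` extend inside and outside the unit circle. -/
def Factors (h : C(UnitAddCircle, ℂ)) : Prop :=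
  ∃ a b : C(UnitAddCircle, ℂ), a ∈ multipliers Lplus ∧ b ∈ multipliers Lminus ∧
    h = expMap a * expMap b

theorem Factors.ne_zero {h : C(UnitAddCircle, ℂ)} (hh : Factors h) (t : UnitAddCircle) :
    h t ≠ 0 := by
  obtain ⟨a, b, -, -, rfl⟩ := hh
  exact mul_ne_zero (Complex.exp_ne_zero _) (Complex.exp_ne_zero _)

theorem Factors.inv {h : C(UnitAddCircle, ℂ)} (hh : Factors h) :
    ∃ g : C(UnitAddCircle, ℂ), Factors g ∧ ∀ t, g t = (h t)⁻¹ := by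
  obtain ⟨a, b, ha, hb, rfl⟩ := hh
  refine ⟨expMap (-a) * expMap (-b), ⟨-a, -b, neg_mem ha, neg_mem hb, rfl⟩, fun t => ?_⟩
  change Complex.exp (-a t) * Complex.exp (-b t) = (Complex.exp (a t) * Complex.exp (b t))⁻¹
  rw [Complex.exp_neg, Complex.exp_neg, mul_inv]

theorem factors_const {c : ℂ} (hc : c ≠ 0) : Factors (ContinuousMap.const _ c) := by
  refine ⟨Complex.log c • 1, 0, Subalgebra.smul_mem _ (one_mem _) _, zero_mem _, ?_⟩
  ext t
  change c = Complex.exp (Complex.log c • 1) * Complex.exp 0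
  rw [smul_eq_mul, mul_one, Complex.exp_log hc, Complex.exp_zero, mul_one]

theorem eq_zero_of_mem {f : L2} (h1 : f ∈ Lplus) (h2 : f ∈ Lminus) : f = 0 := by
  rw [← plusPart_of_mem h1, plusPart_Lminus h2]; rfl

/-- A form of Liouville's theorem: e^b f = e^{-a} h f extends both outside and inside. -/
theorem Factors.eq_zero {h : C(UnitAddCircle, ℂ)} (hh : Factors h) {f : L2} (hf : f ∈ Lminus)
    (hg : mulOp h f ∈ Lplus) : f = 0 := by
  obtain ⟨a, b, ha, hb, rfl⟩ := hh
  have h1 : mulOp (expMap b) f ∈ Lminus := expMap_mem (isClosed_multipliers isClosed_Lminus) hb f hf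
  have h2 := expMap_mem (isClosed_multipliers isClosed_Lplus) (neg_mem ha) _ hg
  rw [mulOp_mulOp, ← mul_assoc, expMap_neg_mul, one_mul] at h2
  have h3 := eq_zero_of_mem h2 h1
  rw [← mulOp_one f, ← expMap_neg_mul b, ← mulOp_mulOp, h3, map_zero]

/-- The half-form `f` with given `f₊` and given `(exp (a + b) f)₋`. -/
def solveOp (a b : C(UnitAddCircle, ℂ)) : Lplus × Lminus →L[ℂ] L2 :=
  Lplus.subtypeL ∘L ContinuousLinearMap.fst ℂ _ _ +
    mulOp (expMap (-b)) ∘L Lminus.subtypeL ∘L minusPart ∘L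
      (mulOp (expMap (-a)) ∘L Lminus.subtypeL ∘L ContinuousLinearMap.snd ℂ _ _ -
        mulOp (expMap b) ∘L Lplus.subtypeL ∘L ContinuousLinearMap.fst ℂ _ _)

/-- If e^{a+b}(f₊ + f₋) equals x.2 up to L₂⁺, multiply by e^{-a}, which preserves L₂⁺, and take
-parts: e^b f₋ = (e^{-a} x.2 − e^b f₊)₋. -/
theorem solveOp_apply (a b : C(UnitAddCircle, ℂ)) (x : Lplus × Lminus) :
    solveOp a b x = x.1 + mulOp (expMap (-b))
      (minusPart (mulOp (expMap (-a)) x.2 - mulOp (expMap b) x.1)) := rfl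

theorem plusPart_solveOp (a : C(UnitAddCircle, ℂ)) {b : C(UnitAddCircle, ℂ)}
    (hb : b ∈ multipliers Lminus) (x : Lplus × Lminus) : plusPart (solveOp a b x) = x.1 := by
  rw [solveOp_apply, map_add, plusPart_coe, plusPart_Lminus, add_zero]
  exact expMap_mem (isClosed_multipliers isClosed_Lminus) (neg_mem hb) _ (Subtype.coe_prop _)

theorem minusPart_solveOp {a : C(UnitAddCircle, ℂ)} (ha : a ∈ multipliers Lplus)
    (b : C(UnitAddCircle, ℂ)) (x : Lplus × Lminus) :
    minusPart (mulOp (expMap a * expMap b) (solveOp a b x)) = x.2 := by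
  set y := mulOp (expMap (-a)) (x.2 : L2) - mulOp (expMap b) (x.1 : L2) with hy
  have h1 : mulOp (expMap a * expMap b) (solveOp a b x) =
      x.2 - mulOp (expMap a) (plusPart y) := by
    have h2 : (minusPart y : L2) = y - plusPart y := by
      rw [eq_sub_iff_add_eq, add_comm, plusPart_add_minusPart]
    rw [solveOp_apply, ← hy, map_add, mulOp_mulOp, mul_assoc, expMap_mul_neg, mul_one, h2,
      map_sub, hy, map_sub, mulOp_mulOp, mulOp_mulOp, expMap_mul_neg, mulOp_one, ← hy]
    abel
  rw [h1, map_sub, minusPart_coe, minusPart_Lplus, sub_zero]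
  exact expMap_mem (isClosed_multipliers isClosed_Lplus) ha _ (Subtype.coe_prop _)

theorem mem_Lminus_of_plusPart {f : L2} (hf : plusPart f = 0) : f ∈ Lminus := by
  rw [← plusPart_add_minusPart f, hf]; simp

theorem mem_Lplus_of_minusPart {f : L2} (hf : minusPart f = 0) : f ∈ Lplus := by
  rw [← plusPart_add_minusPart f, hf]; simp

theorem Factors.exists_solve {h : C(UnitAddCircle, ℂ)} (hh : Factors h) :
    ∃ S : Lplus × Lminus →L[ℂ] L2, (∀ x, plusPart (S x) = x.1) ∧
      (∀ x, minusPart (mulOp h (S x)) = x.2) ∧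
      ∀ f, S (plusPart f, minusPart (mulOp h f)) = f := by
  have hh' := hh
  obtain ⟨a, b, ha, hb, rfl⟩ := hh
  refine ⟨solveOp a b, plusPart_solveOp a hb, minusPart_solveOp ha b, fun f => ?_⟩
  set g := solveOp a b (plusPart f, minusPart (mulOp (expMap a * expMap b) f)) with hg
  refine sub_eq_zero.1 (hh'.eq_zero (mem_Lminus_of_plusPart ?_) (mem_Lplus_of_minusPart ?_))
  · rw [map_sub, hg, plusPart_solveOp a hb, sub_self]
  · rw [map_sub, map_sub, hg, minusPart_solveOp ha b, sub_self]

/-! ### The Riemann norm -/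

theorem mem_multGraph {h : C(UnitAddCircle, ℂ)} {p : WithLp 2 (L2 × L2)} :
    p ∈ multGraph h ↔ p.snd = mulOp h p.fst := eq_mulOp_iff.symm

theorem norm_sq_riemannMap {ψ : UnitAddCircle → ℂ} (p : multGraph ψ) :
    ‖riemannMap ψ p‖ ^ 2 =
      ‖plusPart (p : WithLp 2 (L2 × L2)).fst‖ ^ 2 + ‖minusPart (p : WithLp 2 (L2 × L2)).snd‖ ^ 2 :=
  WithLp.prod_norm_sq_eq_of_L2 _

theorem norm_sq_multGraph {ψ : UnitAddCircle → ℂ} (p : multGraph ψ) :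
    ‖p‖ ^ 2 = ‖(p : WithLp 2 (L2 × L2)).fst‖ ^ 2 + ‖(p : WithLp 2 (L2 × L2)).snd‖ ^ 2 :=
  WithLp.prod_norm_sq_eq_of_L2 _

/-- The pair `(f, ψ f)`. -/
def graphPt (h : C(UnitAddCircle, ℂ)) (f : L2) : multGraph h :=
  ⟨WithLp.toLp 2 (f, mulOp h f), mem_multGraph.2 rfl⟩

/-- Thus the `inverse` in the definition of the Riemann norm is a genuine inverse here, and not the
default value 0. -/
theorem Factors.exists_equiv {h : C(UnitAddCircle, ℂ)} (hh : Factors h) :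
    ∃ e : multGraph h ≃L[ℂ] WithLp 2 (Lplus × Lminus), (e : _ →L[ℂ] _) = riemannMap h := by
  obtain ⟨S, h1, h2, h3⟩ := hh.exists_solve
  let G₀ : WithLp 2 (Lplus × Lminus) →L[ℂ] WithLp 2 (L2 × L2) :=
    ((WithLp.prodContinuousLinearEquiv 2 ℂ L2 L2).symm : L2 × L2 →L[ℂ] _) ∘L
      (S.prod (mulOp h ∘L S)) ∘L
      ((WithLp.prodContinuousLinearEquiv 2 ℂ Lplus Lminus) : _ →L[ℂ] Lplus × Lminus)
  let G : WithLp 2 (Lplus × Lminus) →L[ℂ] multGraph h :=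
    G₀.codRestrict (multGraph h) fun x => mem_multGraph.2 rfl
  refine ⟨ContinuousLinearEquiv.equivOfInverse (riemannMap h) G ?_ ?_, rfl⟩
  · rintro ⟨p, hp⟩
    have hp' := mem_multGraph.1 hp
    refine Subtype.ext ?_
    have h4 : S (plusPart p.fst, minusPart p.snd) = p.fst := by rw [hp', h3]
    change WithLp.toLp 2 (S (plusPart p.fst, minusPart p.snd),
      mulOp h (S (plusPart p.fst, minusPart p.snd))) = p
    rw [h4, ← hp']
    rfl
  · intro x
    change WithLp.toLp 2 (plusPart (S (x.fst, x.snd)), minusPart (mulOp h (S (x.fst, x.snd)))) = x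
    rw [h1, h2]
    rfl

theorem riemannNorm_nonneg (ψ : UnitAddCircle → ℂ) : 0 ≤ riemannNorm ψ := by
  unfold riemannNorm; positivity

theorem Factors.norm_sq_le {h : C(UnitAddCircle, ℂ)} (hh : Factors h) (f : L2) :
    ‖f‖ ^ 2 + ‖mulOp h f‖ ^ 2 ≤
      riemannNorm h ^ 2 * (‖plusPart f‖ ^ 2 + ‖minusPart (mulOp h f)‖ ^ 2) := by
  obtain ⟨e, he⟩ := hh.exists_equiv
  have h1 := norm_sq_multGraph (graphPt h f)
  have h2 := norm_sq_riemannMap (graphPt h f)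
  have h3 : (riemannMap h).inverse (riemannMap h (graphPt h f)) = graphPt h f := by
    rw [← he, ContinuousLinearMap.inverse_equiv]
    exact e.symm_apply_apply _
  have h4 := (riemannMap h).inverse.le_opNorm (riemannMap h (graphPt h f))
  rw [h3] at h4
  have h5 := pow_le_pow_left₀ (norm_nonneg _) h4 2
  rw [mul_pow, h1, h2] at h5
  exact h5

theorem Factors.riemannNorm_le {h : C(UnitAddCircle, ℂ)} (hh : Factors h) {M : ℝ} (hM : 0 ≤ M)
    (H : ∀ f : L2, ‖f‖ ^ 2 + ‖mulOp h f‖ ^ 2 ≤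
      M ^ 2 * (‖plusPart f‖ ^ 2 + ‖minusPart (mulOp h f)‖ ^ 2)) : riemannNorm h ≤ M := by
  obtain ⟨e, he⟩ := hh.exists_equiv
  rw [riemannNorm, ← he, ContinuousLinearMap.inverse_equiv]
  refine ContinuousLinearMap.opNorm_le_bound _ hM fun y => ?_
  obtain ⟨⟨p, hp⟩, rfl⟩ := e.surjective y
  change ‖e.symm (e ⟨p, hp⟩)‖ ≤ _
  rw [e.symm_apply_apply]
  have h0 : e ⟨p, hp⟩ = riemannMap h ⟨p, hp⟩ := congrArg (fun T => T ⟨p, hp⟩) he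
  rw [h0]
  have h1 := norm_sq_multGraph ⟨p, hp⟩
  have h2 := norm_sq_riemannMap ⟨p, hp⟩
  have h3 := H p.fst
  rw [← mem_multGraph.1 hp] at h3
  refine le_of_sq_le_sq ?_ (mul_nonneg hM (norm_nonneg _))
  rw [mul_pow, h1, h2]
  exact h3

theorem norm_fourierLp (k : ℤ) : ‖(fourierLp 2 k : L2)‖ = 1 :=
  (orthonormal_fourier (T := 1)).1 k

/-- The projection p does not increase norms, so its inverse cannot have norm below 1; the pair (1,
h) is a nonzero test vector. -/
theorem Factors.one_le_riemannNorm {h : C(UnitAddCircle, ℂ)} (hh : Factors h) :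
    1 ≤ riemannNorm h := by
  have h1 := hh.norm_sq_le (fourierLp 2 0 : L2)
  have h2 := norm_plusPart_le (fourierLp 2 0 : L2)
  have h3 := norm_minusPart_le (mulOp h (fourierLp 2 0 : L2))
  rw [norm_fourierLp] at h1 h2
  by_contra hlt
  rw [not_le] at hlt
  have h0 := riemannNorm_nonneg h
  have h4 : riemannNorm h ^ 2 < 1 := by nlinarith
  have h5 := pow_le_pow_left₀ (norm_nonneg _) h2 2
  have h6 := pow_le_pow_left₀ (norm_nonneg _) h3 2
  nlinarith [sq_nonneg ‖minusPart (mulOp h (fourierLp 2 0 : L2))‖,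
    sq_nonneg ‖plusPart (fourierLp 2 0 : L2)‖, sq_nonneg ‖mulOp h (fourierLp 2 0 : L2)‖]

theorem norm_sq_parts (f : L2) : ‖f‖ ^ 2 = ‖plusPart f‖ ^ 2 + ‖minusPart f‖ ^ 2 := by
  have h1 : inner ℂ (plusPart f : L2) (minusPart f : L2) = 0 := by
    have : (minusPart f : L2) ∈ Lplusᗮ := by rw [Lplus_orthogonal]; exact Subtype.coe_prop _
    exact this _ (Subtype.coe_prop _)
  have h2 := norm_add_sq_eq_norm_sq_add_norm_sq_of_inner_eq_zero _ _ h1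
  rw [plusPart_add_minusPart] at h2
  rw [sq, sq, sq]; exact h2

theorem mulOp_const (c : ℂ) (f : L2) : mulOp (ContinuousMap.const _ c) f = c • f := by
  have h : ContinuousMap.const UnitAddCircle c = c • 1 := by
    ext t
    change c = c • 1
    rw [smul_eq_mul, mul_one]
  rw [h, mulOp_smul, mulOp_one]

/-- ‖f‖² + ‖cf‖² = (1 + |c|²)‖f₊‖² + (1 + |c|⁻²)‖c f₋‖². -/
theorem riemannNorm_const_sq_le {c : ℂ} (hc : c ≠ 0) :
    riemannNorm (fun _ => c) ^ 2 ≤ 1 + ‖c‖ ^ 2 + (‖c‖ ^ 2)⁻¹ := by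
  have hc' : 0 < ‖c‖ ^ 2 := by positivity
  have hM : 0 ≤ 1 + ‖c‖ ^ 2 + (‖c‖ ^ 2)⁻¹ := by positivity
  have := (factors_const hc).riemannNorm_le (M := Real.sqrt (1 + ‖c‖ ^ 2 + (‖c‖ ^ 2)⁻¹))
    (Real.sqrt_nonneg _) fun f => by
      rw [Real.sq_sqrt hM, mulOp_const, map_smul, norm_smul, norm_smul, mul_pow, mul_pow, norm_sq_parts f]
      have h2 := sq_nonneg ‖plusPart f‖
      have h3 := sq_nonneg ‖minusPart f‖
      have h4 : (‖c‖ ^ 2)⁻¹ * ‖c‖ ^ 2 = 1 := inv_mul_cancel₀ hc'.ne'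
      have h5 : 0 ≤ (‖c‖ ^ 2)⁻¹ := by positivity
      have h6 : (1 + ‖c‖ ^ 2 + (‖c‖ ^ 2)⁻¹) * (‖plusPart f‖ ^ 2 + ‖c‖ ^ 2 * ‖minusPart f‖ ^ 2) -
          ((‖plusPart f‖ ^ 2 + ‖minusPart f‖ ^ 2) + ‖c‖ ^ 2 * (‖plusPart f‖ ^ 2 + ‖minusPart f‖ ^ 2))
          = (‖c‖ ^ 2)⁻¹ * ‖plusPart f‖ ^ 2 + ‖c‖ ^ 2 * ‖c‖ ^ 2 * ‖minusPart f‖ ^ 2 +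
            ((‖c‖ ^ 2)⁻¹ * ‖c‖ ^ 2 - 1) * ‖minusPart f‖ ^ 2 := by ring
      rw [h4, sub_self, zero_mul, add_zero] at h6
      have h7 : 0 ≤ (‖c‖ ^ 2)⁻¹ * ‖plusPart f‖ ^ 2 + ‖c‖ ^ 2 * ‖c‖ ^ 2 * ‖minusPart f‖ ^ 2 := by
        positivity
      linarith
  calc riemannNorm (fun _ => c) ^ 2 ≤ Real.sqrt (1 + ‖c‖ ^ 2 + (‖c‖ ^ 2)⁻¹) ^ 2 :=
        pow_le_pow_left₀ (riemannNorm_nonneg _) this 2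
    _ = _ := Real.sq_sqrt hM

end HalfForm
end

noncomputable section
namespace HalfForm

/-! ### Comparable subspaces -/

/-- The obstruction T to lying in W takes finite-dimensional values on V, so its kernel, which lies
in W, has finite codimension in V. -/
theorem finiteDimensional_quotient {E F : Type*} [AddCommGroup E] [Module ℂ E] [AddCommGroup F]
    [Module ℂ F] {V W : Submodule ℂ E} (T : E →ₗ[ℂ] F) (R : Submodule ℂ F) [FiniteDimensional ℂ R]
    (h1 : ∀ x ∈ V, T x ∈ R) (h2 : ∀ x ∈ V, T x = 0 → x ∈ W) :
    FiniteDimensional ℂ (V ⧸ (V ⊓ W).submoduleOf V) := by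
  let T' : V →ₗ[ℂ] R := (T.domRestrict V).codRestrict R fun x => h1 x x.2
  have hle : LinearMap.ker T' ≤ (V ⊓ W).submoduleOf V := fun x hx =>
    ⟨x.2, h2 x x.2 (congrArg Subtype.val (LinearMap.mem_ker.1 hx))⟩
  have : FiniteDimensional ℂ (V ⧸ LinearMap.ker T') :=
    Module.Finite.equiv T'.quotKerEquivRange.symm
  exact Module.Finite.of_surjective (Submodule.factor hle) (Submodule.factor_surjective hle)

theorem inner_fourierLp_mulOp (m k : ℤ) (x : L2) :
    inner ℂ (fourierLp 2 m : L2) (mulOp (fourier k) x) = inner ℂ (fourierLp 2 (m - k) : L2) x := by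
  rw [inner_fourierLp, inner_fourierLp]
  refine integral_congr_ae ?_
  filter_upwards [coeFn_mulOp (fourier k) x] with t ht
  rw [ht, fourier_eq_zpow, ← mul_assoc, ← zpow_add₀ (unitPt_ne_zero t)]
  congr 2; ring

theorem inner_fourierLp_minusPart {m : ℤ} (hm : m < 0) (y : L2) :
    inner ℂ (fourierLp 2 m : L2) (minusPart y : L2) = inner ℂ (fourierLp 2 m : L2) y := by
  conv_rhs => rw [← plusPart_add_minusPart y]
  rw [inner_add_right, mem_Lplus_iff.1 (plusPart y).2 m hm, zero_add]

/-- The operator `f ↦ (z ^ k f)₋` on `L₂⁺` has finite rank. -/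
theorem exists_finiteDimensional_minusPart (k : ℤ) : ∃ R : Submodule ℂ L2, FiniteDimensional ℂ R ∧
    ∀ x ∈ Lplus, (minusPart (mulOp (fourier k) x) : L2) ∈ R := by
  classical
  -- Multiplication by z^k can move frequencies ≥ 0 only to the negative frequencies m with k ≤ m;
  -- for k ≥ 0 there are none.
  let s : Finset L2 := (Finset.Ico k 0).image fun m => (fourierLp 2 m : L2)
  refine ⟨Submodule.span ℂ (s : Set L2), inferInstance, fun x hx => ?_⟩
  have h := hasSum_inner_fourierLp (minusPart (mulOp (fourier k) x) : L2)
  have h0 : ∀ m ∉ Finset.Ico k 0,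
      inner ℂ (fourierLp 2 m : L2) (minusPart (mulOp (fourier k) x) : L2) •
        (fourierLp 2 m : L2) = 0 := fun m hm => by
    rw [Finset.mem_Ico, not_and_or, not_le, not_lt] at hm
    rcases lt_or_ge m 0 with h1 | h1
    · rw [inner_fourierLp_minusPart h1, inner_fourierLp_mulOp,
        mem_Lplus_iff.1 hx _ (by omega), zero_smul]
    · rw [mem_Lminus_iff.1 (Subtype.coe_prop _) m h1, zero_smul]
  rw [h.unique (hasSum_sum_of_ne_finset_zero h0)]
  refine Submodule.sum_mem _ fun m hm => Submodule.smul_mem _ _ (Submodule.subset_span ?_)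
  exact Finset.mem_coe.2 (Finset.mem_image_of_mem _ hm)

/-! ### The operators of the gluing conditions -/

theorem mem_operatorGraph {P : Lplus × Lplus →L[ℂ] Lminus × Lminus} {f g : L2} :
    (f, g) ∈ ModelCurve.operatorGraph P ↔ P (plusPart f, plusPart g) = (minusPart f, minusPart g) := by
  constructor
  · rintro ⟨⟨x, y⟩, h⟩
    have h1 : (x : L2) + (P (x, y)).1 = f := congrArg Prod.fst h
    have h2 : (y : L2) + (P (x, y)).2 = g := congrArg Prod.snd h
    rw [← h1, ← h2]
    simp only [map_add, plusPart_coe, minusPart_coe, plusPart_Lminus (Subtype.coe_prop _),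
      minusPart_Lplus (Subtype.coe_prop _), add_zero, zero_add]
  · intro h
    refine ⟨(plusPart f, plusPart g), ?_⟩
    change ((plusPart f : L2) + (P (plusPart f, plusPart g)).1,
      (plusPart g : L2) + (P (plusPart f, plusPart g)).2) = (f, g)
    rw [h]
    exact Prod.ext (plusPart_add_minusPart f) (plusPart_add_minusPart g)

theorem parts_eq {f : L2} {x : Lplus} {y : Lminus} (h : f = x + y) :
    plusPart f = x ∧ minusPart f = y := by
  subst h
  simp only [map_add, plusPart_coe, minusPart_coe, plusPart_Lminus (Subtype.coe_prop _),
      minusPart_Lplus (Subtype.coe_prop _), add_zero, zero_add, and_self]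

theorem DiskSwap.parts_pull {A : SL(2, ℂ)} (hA : DiskSwap A) (f : L2) :
    (plusPart (pull hA.circleAut f) : L2) = pull hA.circleAut (minusPart f : L2) ∧
      (minusPart (pull hA.circleAut f) : L2) = pull hA.circleAut (plusPart f : L2) := by
  have h := parts_eq (f := pull hA.circleAut f)
    (x := ⟨_, hA.pull_mem_Lplus (minusPart f).2⟩) (y := ⟨_, hA.pull_mem_Lminus (plusPart f).2⟩) (by
      rw [← map_add, add_comm, plusPart_add_minusPart])
  exact ⟨congrArg Subtype.val h.1, congrArg Subtype.val h.2⟩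

/-- For ψ = z^k h the gluing condition itself need not define an operator if k ≠ 0. Its half φ*g₊ =
(z^k h f)₋ is replaced by (z^{-k} φ*g₊)₋ = (hf)₋, which the factorization of h solves for f; the
other half then determines g₋. -/
theorem exists_gluing_operator {A : SL(2, ℂ)} (hA : DiskSwap A) {h : C(UnitAddCircle, ℂ)}
    (hh : Factors h) (k : ℤ) : ∃ P : Lplus × Lplus →L[ℂ] Lminus × Lminus, ∀ f g : L2,
      (f, g) ∈ ModelCurve.operatorGraph P ↔
        minusPart (mulOp h f) =
          minusPart (mulOp (fourier (-k)) (pull hA.circleAut (plusPart g : L2))) ∧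
        pull hA.circleAut (minusPart g : L2) = plusPart (mulOp (fourier k * h) f) := by
  obtain ⟨S, h1, h2, h3⟩ := hh.exists_solve
  let U : L2 →L[ℂ] L2 := (pull hA.circleAut).toContinuousLinearMap
  let V : L2 →L[ℂ] L2 := (pull hA.circleAut.inv).toContinuousLinearMap
  let Q : Lplus × Lplus →L[ℂ] L2 := S ∘L (ContinuousLinearMap.fst ℂ _ _).prod
    (minusPart ∘L mulOp (fourier (-k)) ∘L U ∘L Lplus.subtypeL ∘L ContinuousLinearMap.snd ℂ _ _)
  have hQ : ∀ x, Q x = S (x.1, minusPart (mulOp (fourier (-k)) (pull hA.circleAut (x.2 : L2)))) :=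
    fun _ => rfl
  refine ⟨(minusPart ∘L Q).prod (minusPart ∘L V ∘L Lplus.subtypeL ∘L plusPart ∘L
    mulOp (fourier k * h) ∘L Q), fun f g => ?_⟩
  have hV : ∀ y : Lplus, (minusPart (V y) : L2) = V y := fun y =>
    minusPart_of_mem (hA.inv.pull_mem_Lminus y.2)
  rw [mem_operatorGraph]
  change (minusPart (Q (plusPart f, plusPart g)), minusPart (V (plusPart (mulOp (fourier k * h)
    (Q (plusPart f, plusPart g)))))) = (minusPart f, minusPart g) ↔ _
  rw [Prod.mk.injEq]
  constructor
  · rintro ⟨e1, e2⟩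
    have e3 : Q (plusPart f, plusPart g) = f := by
      have e4 : plusPart (Q (plusPart f, plusPart g)) = plusPart f := by rw [hQ, h1]
      rw [← plusPart_add_minusPart (Q (plusPart f, plusPart g)), e1, e4, plusPart_add_minusPart]
    refine ⟨?_, ?_⟩
    · rw [hQ] at e3
      have := h2 (plusPart f, minusPart (mulOp (fourier (-k)) (pull hA.circleAut (plusPart g : L2))))
      rw [e3] at this
      exact this
    · rw [e3] at e2
      rw [← e2, hV]
      exact pull_pull_inv _ _
  · rintro ⟨e1, e2⟩
    have e3 : Q (plusPart f, plusPart g) = f := by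
      rw [hQ, ← e1]; exact h3 f
    rw [e3, ← e2]
    refine ⟨rfl, ?_⟩
    change minusPart (pull hA.circleAut.inv _) = _
    rw [pull_inv_pull, minusPart_coe]

/-- The gluing condition in terms of the `+`- and `-`-parts. -/
theorem pull_eq_iff {A : SL(2, ℂ)} (hA : DiskSwap A) {y g : L2} :
    pull hA.circleAut g = y ↔ pull hA.circleAut (plusPart g : L2) = minusPart y ∧
      pull hA.circleAut (minusPart g : L2) = plusPart y := by
  constructor
  · rintro rfl
    exact ⟨(hA.parts_pull g).2.symm, (hA.parts_pull g).1.symm⟩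
  · rintro ⟨h1, h2⟩
    rw [← plusPart_add_minusPart g, map_add, h1, h2, add_comm, plusPart_add_minusPart]

theorem mulOp_fourier_neg (k : ℤ) (f : L2) : mulOp (fourier k) (mulOp (fourier (-k)) f) = f := by
  rw [mulOp_mulOp]
  have : (fourier k * fourier (-k) : C(UnitAddCircle, ℂ)) = 1 := by
    ext t
    rw [ContinuousMap.mul_apply, fourier_eq_zpow, fourier_eq_zpow, ← zpow_add₀ (unitPt_ne_zero t),
      add_neg_cancel, zpow_zero]
    rfl
  rw [this, mulOp_one]

theorem eq_sub_parts (f : L2) : (minusPart f : L2) = f - plusPart f := by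
  rw [eq_sub_iff_add_eq, add_comm, plusPart_add_minusPart]

/-- The two subspaces share the condition φ*g₋ = (ψf)₊. In the other one, the discrepancy is (z^{±k}
y)₋ with y in L₂⁺, which ranges over a finite-dimensional space. -/
theorem exists_comparable_operator {A : SL(2, ℂ)} (hA : DiskSwap A) {h : C(UnitAddCircle, ℂ)}
    (hh : Factors h) (k : ℤ) {W : Submodule ℂ (L2 × L2)}
    (hW : ∀ f g, (f, g) ∈ W ↔ pull hA.circleAut g = mulOp (fourier k * h) f) :
    ∃ P : Lplus × Lplus →L[ℂ] Lminus × Lminus, (k = 0 → ModelCurve.operatorGraph P = W) ∧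
      Comparable (ModelCurve.operatorGraph P) W := by
  obtain ⟨P, hP⟩ := exists_gluing_operator hA hh k
  set U : L2 →L[ℂ] L2 := (pull hA.circleAut).toContinuousLinearMap with hU
  have hU' : ∀ x, pull hA.circleAut x = U x := fun _ => rfl
  refine ⟨P, ?_, ?_, ?_⟩
  · rintro rfl
    ext ⟨f, g⟩
    have h1 : (fourier 0 : C(UnitAddCircle, ℂ)) = 1 := by
      ext t; rw [fourier_eq_zpow, zpow_zero]; rfl
    rw [hP, hW, neg_zero, h1, one_mul, mulOp_one, pull_eq_iff hA (g := g) (y := mulOp h f)]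
    refine and_congr_left fun _ => ?_
    rw [← minusPart_of_mem (hA.pull_mem_Lminus (plusPart g).2), Subtype.coe_inj, eq_comm]
    rw [minusPart_coe]
  · obtain ⟨R, hR, hR'⟩ := exists_finiteDimensional_minusPart k
    let T : L2 × L2 →L[ℂ] L2 := U ∘L Lplus.subtypeL ∘L plusPart ∘L ContinuousLinearMap.snd ℂ _ _ -
      Lminus.subtypeL ∘L minusPart ∘L mulOp (fourier k * h) ∘L ContinuousLinearMap.fst ℂ _ _
    have hT : ∀ f g, T (f, g) = U (plusPart g) - minusPart (mulOp (fourier k * h) f) :=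
      fun _ _ => rfl
    refine finiteDimensional_quotient T.toLinearMap R ?_ ?_
    · rintro ⟨f, g⟩ hfg
      change T (f, g) ∈ R
      rw [hP, hU', hU'] at hfg
      have h1 : mulOp (fourier k * h) f = mulOp (fourier k) (mulOp h f) := (mulOp_mulOp _ _ _).symm
      set y := mulOp (fourier (-k)) (U (plusPart g)) with hy
      have h2 : mulOp (fourier k) y = U (plusPart g) := mulOp_fourier_neg _ _
      have h3 : mulOp h f = y + (plusPart (mulOp h f) - plusPart y : Lplus) := by
        conv_lhs => rw [← plusPart_add_minusPart (mulOp h f), hfg.1, eq_sub_parts y]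
        rw [Submodule.coe_sub]; abel
      rw [hT, h1, h3, map_add, map_add, h2, Submodule.coe_add]
      have h4 : (minusPart (U (plusPart g : L2)) : L2) = U (plusPart g) :=
        minusPart_of_mem (hA.pull_mem_Lminus (plusPart g).2)
      rw [h4, sub_add_cancel_left]
      exact R.neg_mem (hR' _ (Subtype.coe_prop _))
    · rintro ⟨f, g⟩ hfg h0
      have h0' : U (plusPart g) - minusPart (mulOp (fourier k * h) f) = 0 := h0
      rw [hW, pull_eq_iff hA]
      exact ⟨sub_eq_zero.1 h0', ((hP f g).1 hfg).2⟩
  · rw [inf_comm]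
    obtain ⟨R, hR, hR'⟩ := exists_finiteDimensional_minusPart (-k)
    let T : L2 × L2 →L[ℂ] L2 := Lminus.subtypeL ∘L minusPart ∘L mulOp (fourier (-k)) ∘L U ∘L
      Lminus.subtypeL ∘L minusPart ∘L ContinuousLinearMap.snd ℂ _ _
    refine finiteDimensional_quotient T.toLinearMap R ?_ ?_
    · rintro ⟨f, g⟩ hfg
      exact hR' _ (hA.pull_mem_Lplus (minusPart g).2)
    · rintro ⟨f, g⟩ hfg h0
      have h0' : (minusPart (mulOp (fourier (-k)) (U (minusPart g : L2))) : L2) = 0 := h0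
      rw [hW] at hfg
      rw [hP]
      refine ⟨?_, ((pull_eq_iff hA).1 hfg).2⟩
      have h1 : mulOp h f = mulOp (fourier (-k)) (U g) := by
        have := mulOp_fourier_neg (-k) (mulOp h f)
        rw [neg_neg, mulOp_mulOp (fourier k), ← hfg] at this
        exact this.symm
      rw [h1]
      conv_lhs => rw [← plusPart_add_minusPart g, map_add, map_add, map_add]
      rw [Subtype.ext_iff.2 (h0'.trans (Submodule.coe_zero).symm), add_zero]
      rfl

end HalfForm
end

/-! ### Gluing conditions of a curve in the charts of its disks -/

noncomputable section
namespace HalfForm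

namespace ModelCurve

variable {I : Type*} (C : ModelCurve I)

/-- The map `φ i` in the charts of the disks. -/
def glue (i : I) : SL(2, ℂ) := (C.chart (C.inv i))⁻¹ * C.φ i * C.chart i

theorem chart_glue (i : I) (x : Sphere) : moebius (C.chart (C.inv i)) (moebius (C.glue i) x) =
    moebius (C.φ i) (moebius (C.chart i) x) := by
  rw [glue, moebius_mul, moebius_mul, moebius_moebius_inv]

/-- `φ_circle` gives invariance of the unit circle; by `φ_disk` the centre is sent outside the
closed disk, which leaves only the swap coset. -/
theorem diskSwap_glue (i : I) : DiskSwap (C.glue i) := by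
  refine diskSwap_of_norm_eq (fun z hz => ?_) ?_
  · have h1 : moebius (C.φ i) (moebius (C.chart i) (z : Sphere)) ∈
        (fun z : ℂ => moebius (C.chart (C.inv i)) (z : Sphere)) '' {z | ‖z‖ = 1} := by
      rw [← C.φ_circle]
      exact ⟨_, ⟨z, hz, rfl⟩, rfl⟩
    obtain ⟨w, hw, h2⟩ := h1
    rw [← C.chart_glue] at h2
    obtain ⟨h3, h4⟩ := moebius_eq_coe (moebius_injective _ h2).symm
    have hw' : ‖w‖ = 1 := hw
    rw [← h4, norm_div, div_eq_one_iff_eq (norm_ne_zero_iff.2 h3)] at hw'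
    exact hw'
  · have h1 : moebius (C.φ i) (moebius (C.chart i) ((0 : ℂ) : Sphere)) ∈
        ((fun z : ℂ => moebius (C.chart (C.inv i)) (z : Sphere)) '' {z | ‖z‖ ≤ 1})ᶜ := by
      rw [← C.φ_disk]
      exact ⟨_, ⟨0, by simp, rfl⟩, rfl⟩
    by_contra hlt
    rw [not_lt] at hlt
    have hd : den (C.glue i) 0 ≠ 0 := by
      intro h0
      have h2 : C.glue i 1 1 = 0 := by simpa [den] using h0
      rw [h2, norm_zero] at hlt
      have h3 := norm_le_zero_iff.1 hlt
      have := det_eq (C.glue i)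
      rw [h2, h3] at this
      simp at this
    refine h1 ⟨num (C.glue i) 0 / den (C.glue i) 0, ?_, ?_⟩
    · change ‖_‖ ≤ 1
      rw [norm_div]
      refine div_le_one_of_le₀ ?_ (norm_nonneg _)
      simpa [num, den] using hlt
    · rw [← C.chart_glue, moebius_of_den_ne_zero hd]

theorem circlePt_eq_iff (i : I) (s t : UnitAddCircle) :
    C.circlePt (C.inv i) s = moebius (C.φ i) (C.circlePt i t) ↔ s = circleAct (C.glue i) t := by
  have hA := (C.diskSwap_glue i).circleAut
  rw [circlePt, circlePt, ← C.chart_glue, (moebius_injective _).eq_iff,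
    moebius_of_den_ne_zero (hA.den_ne_zero (norm_unitPt' t)), ← hA.unitPt_circleAct,
    OnePoint.coe_eq_coe, unitPt_injective.eq_iff]

namespace Bundle

variable {C} (L : C.Bundle)

theorem onCircle_ne_zero (i : I) (t : UnitAddCircle) : L.onCircle i t ≠ 0 :=
  L.ne_zero i _ ⟨unitPt t, norm_unitPt' t, rfl⟩

theorem onCircle_inv (i : I) (t : UnitAddCircle) :
    L.onCircle (C.inv i) (circleAct (C.glue i) t) = (L.onCircle i t)⁻¹ := by
  have h := (C.circlePt_eq_iff i (circleAct (C.glue i) t) t).2 rfl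
  rw [onCircle, h]
  exact L.inv_eq i _ ⟨unitPt t, norm_unitPt' t, rfl⟩

theorem exists_factor (i : I) : ∃ (k : ℤ) (h : C(UnitAddCircle, ℂ)), L.index i = k ∧ Factors h ∧
    L.onCircle i = ⇑(fourier k * h : C(UnitAddCircle, ℂ)) := by
  obtain ⟨k, a, b, h1, h2, h3, h4⟩ := exists_factorization (L.analytic i)
    fun z hz => L.ne_zero i _ ⟨z, hz, rfl⟩
  refine ⟨k, expMap a * expMap b, h1, ⟨a, b, h2, h3, rfl⟩, funext fun t => ?_⟩
  rw [ContinuousMap.mul_apply, fourier_eq_zpow]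
  exact h4 t

theorem fourier_zero_mul (h : C(UnitAddCircle, ℂ)) : fourier 0 * h = h := by
  ext t
  rw [ContinuousMap.mul_apply, fourier_eq_zpow, zpow_zero, one_mul]

theorem exists_factor_of_index_eq_zero {i : I} (hi : L.index i = 0) :
    ∃ h : C(UnitAddCircle, ℂ), Factors h ∧ L.onCircle i = h := by
  obtain ⟨k, h, h1, h2, h3⟩ := L.exists_factor i
  rw [hi] at h1
  have hk : k = 0 := by exact_mod_cast h1.symm
  subst hk
  exact ⟨h, h2, by rw [h3, fourier_zero_mul]⟩

/-- A relation holding everywhere for suitable representatives amounts to one holding almost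
everywhere, because the circle map respects null sets in both directions. -/
theorem mem_gluedPairs {i : I} {h : C(UnitAddCircle, ℂ)} (hψ : L.onCircle i = h) (f g : L2) :
    (f, g) ∈ L.gluedPairs i ↔ pull (C.diskSwap_glue i).circleAut g = mulOp h f := by
  have hA := (C.diskSwap_glue i).circleAut
  constructor
  · rintro ⟨f₀, g₀, hf, hg, H⟩
    rw [eq_mulOp_iff]
    filter_upwards [coeFn_pull hA g, hf, hA.ae_comp hg] with t h1 h2 h3
    have := H t _ ((C.circlePt_eq_iff i _ t).2 rfl)
    change f t = f₀ t at h2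
    change g _ = g₀ _ at h3
    rw [h1, h3, h2, ← hψ, ← this, mul_comm]
    rfl
  · intro H
    rw [eq_mulOp_iff] at H
    -- Keep f and solve the relation pointwise for the representative of g.
    refine ⟨f, fun s => h (circleAct (C.glue i)⁻¹ s) * f (circleAct (C.glue i)⁻¹ s) *
      den (C.glue i) (unitPt (circleAct (C.glue i)⁻¹ s)), Filter.EventuallyEq.rfl, ?_, ?_⟩
    · have H2 : (fun t => (den (C.glue i) (unitPt t))⁻¹ * g (circleAct (C.glue i) t)) =ᵐ[haar]
          fun t => h t * f t := (coeFn_pull hA g).symm.trans H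
      filter_upwards [hA.inv.ae_comp H2] with s h1
      rw [hA.circleAct_circleAct_inv] at h1
      rw [← h1, mul_comm, mul_inv_cancel_left₀ (hA.den_ne_zero (norm_unitPt' _))]
    · intro t s hs
      rw [C.circlePt_eq_iff] at hs
      subst hs
      change h (circleAct (C.glue i)⁻¹ (circleAct (C.glue i) t)) *
        f (circleAct (C.glue i)⁻¹ (circleAct (C.glue i) t)) * den (C.glue i)
          (unitPt (circleAct (C.glue i)⁻¹ (circleAct (C.glue i) t))) *
        (den (C.glue i) (unitPt t))⁻¹ = _
      rw [hA.circleAct_inv_circleAct, hψ]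
      exact mul_inv_cancel_right₀ (hA.den_ne_zero (norm_unitPt' t)) _

theorem exists_isGluingOperator (i : I) : ∃ P, L.IsGluingOperator i P := by
  obtain ⟨k, h, h1, h2, h3⟩ := L.exists_factor i
  obtain ⟨P, hP, hP'⟩ := exists_comparable_operator (C.diskSwap_glue i) h2 k (L.mem_gluedPairs h3)
  refine ⟨P, fun h0 => hP ?_, fun _ => hP'⟩
  rw [h1] at h0
  exact_mod_cast h0

theorem isGluingOperator_iff {i : I} {h : C(UnitAddCircle, ℂ)} (hi : L.index i = 0)
    (hψ : L.onCircle i = h) {P : Lplus × Lplus →L[ℂ] Lminus × Lminus} (hP : L.IsGluingOperator i P)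
    (x : Lplus × Lplus) :
    pull (C.diskSwap_glue i).circleAut ((x.2 : L2) + (P x).2) = mulOp h ((x.1 : L2) + (P x).1) := by
  rw [← L.mem_gluedPairs hψ, ← hP.1 hi]
  exact ⟨x, rfl⟩

/-- Up to the unitary φ*, P sends (f₊, (ψf)₋) to (f₋, (ψf)₊). The Riemann norm bounds all four parts
by the first two. -/
theorem norm_sq_le {i : I} (hi : L.index i = 0) {P : Lplus × Lplus →L[ℂ] Lminus × Lminus}
    (hP : L.IsGluingOperator i P) (x : Lplus × Lplus) :
    ‖(P x).1‖ ^ 2 + ‖(P x).2‖ ^ 2 ≤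
      riemannNorm (L.onCircle i) ^ 2 * (‖x.1‖ ^ 2 + ‖x.2‖ ^ 2) := by
  obtain ⟨h, hh, hψ⟩ := L.exists_factor_of_index_eq_zero hi
  have hA := C.diskSwap_glue i
  have h1 := L.isGluingOperator_iff hi hψ hP x
  obtain ⟨e1, e2⟩ := parts_eq (x := x.1) (y := (P x).1) rfl
  obtain ⟨e3, e4⟩ := parts_eq (x := x.2) (y := (P x).2) rfl
  set f := (x.1 : L2) + (P x).1
  set g := (x.2 : L2) + (P x).2
  have h2 := hh.norm_sq_le f
  have h3 := (pull_eq_iff hA).1 h1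
  rw [e3, e4] at h3
  have h4 : ‖x.2‖ = ‖minusPart (mulOp h f)‖ :=
    (LinearIsometry.norm_map (pull hA.circleAut) (x.2 : L2)).symm.trans (congrArg norm h3.1)
  have h5 : ‖(P x).2‖ = ‖plusPart (mulOp h f)‖ :=
    (LinearIsometry.norm_map (pull hA.circleAut) ((P x).2 : L2)).symm.trans (congrArg norm h3.2)
  rw [norm_sq_parts f, norm_sq_parts (mulOp h f), e1, e2, ← h4, ← h5] at h2
  rw [hψ]
  linarith [sq_nonneg ‖x.1‖, sq_nonneg ‖x.2‖]

/-- With g = (φ⁻¹)*(ψf) one has ψ' g = (φ⁻¹)* f, where ψ' = ψ_{i'}. As φ interchanges + and -, the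
pair (g, ψ' g) has the same relevant norms as (ψf, f). -/
theorem riemannNorm_le_inv {i : I} (hi : L.index i = 0) (hi' : L.index (C.inv i) = 0) :
    riemannNorm (L.onCircle i) ≤ riemannNorm (L.onCircle (C.inv i)) := by
  obtain ⟨h, hh, hψ⟩ := L.exists_factor_of_index_eq_zero hi
  obtain ⟨h', hh', hψ'⟩ := L.exists_factor_of_index_eq_zero hi'
  have hA := C.diskSwap_glue i
  rw [hψ, hψ']
  refine hh.riemannNorm_le (riemannNorm_nonneg _) fun f => ?_
  set g := pull hA.circleAut.inv (mulOp h f) with hg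
  have hg' : mulOp h' g = pull hA.circleAut.inv f := by
    rw [← pull_inv_pull hA.circleAut (mulOp h' g)]
    congr 1
    refine Lp.ext ?_
    have h1 : pull hA.circleAut g = mulOp h f := pull_pull_inv _ _
    have h2 := eq_mulOp_iff.1 h1
    filter_upwards [coeFn_pull hA.circleAut (mulOp h' g), hA.circleAut.ae_comp (coeFn_mulOp h' g),
      coeFn_pull hA.circleAut g, h2] with t h3 h4 h5 h6
    rw [h3, h4, mul_left_comm, ← h5, h6, ← hψ, ← hψ', L.onCircle_inv,
      inv_mul_cancel_left₀ (L.onCircle_ne_zero i t)]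
  have h1 := hh'.norm_sq_le g
  have e1 : ‖g‖ = ‖mulOp h f‖ := LinearIsometry.norm_map _ _
  have e2 : ‖mulOp h' g‖ = ‖f‖ := by rw [hg']; exact LinearIsometry.norm_map _ _
  have e3 : ‖plusPart g‖ = ‖minusPart (mulOp h f)‖ :=
    (congrArg norm (hA.inv.parts_pull _).1).trans (LinearIsometry.norm_map _ _)
  have e4 : ‖minusPart (mulOp h' g)‖ = ‖plusPart f‖ := by
    rw [hg']
    exact (congrArg norm (hA.inv.parts_pull _).2).trans (LinearIsometry.norm_map _ _)
  rw [e1, e2, e3, e4] at h1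
  linarith

theorem one_le_riemannNorm {i : I} (hi : L.index i = 0) : 1 ≤ riemannNorm (L.onCircle i) := by
  obtain ⟨h, hh, hψ⟩ := L.exists_factor_of_index_eq_zero hi
  rw [hψ]; exact hh.one_le_riemannNorm

theorem index_dual (i : I) : L.dual.index i = -L.index i := by
  rw [index, index, ← mul_neg]
  congr 1
  rw [← neg_one_smul ℂ, ← circleIntegral.integral_smul]
  refine circleIntegral.integral_congr zero_le_one fun z hz => ?_
  have hz' : ‖z‖ = 1 := by simpa using hz
  have h1 := (L.analytic i z hz').differentiableAt
  have h2 := L.ne_zero i _ ⟨z, hz', rfl⟩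
  change logDeriv (fun z : ℂ => (L.ψ i (moebius (C.chart i) (z : Sphere)))⁻¹) z = _
  rw [neg_one_smul]
  simp only [logDeriv_apply]
  rw [(h1.hasDerivAt.fun_inv h2).deriv]
  field_simp

end Bundle

end ModelCurve

end HalfForm
end

noncomputable section
namespace HalfForm

open scoped ENNReal

/-! ### Summability of the squares of the Hilbert-Schmidt norms -/

section Sums

variable {ι : Type*}

theorem tsum_indicator_ne_top {s : Set ι} (hs : s.Finite) {a : ι → ℝ≥0∞} (ha : ∀ i ∈ s, a i ≠ ∞) :
    ∑' i, s.indicator a i ≠ ∞ := by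
  rw [tsum_eq_sum (s := hs.toFinset)]
  · exact ENNReal.sum_ne_top.2 fun i hi => by
      have hi' := hs.mem_toFinset.1 hi
      rw [Set.indicator_of_mem hi']; exact ha i hi'
  · intro i hi
    exact Set.indicator_of_notMem (fun h => hi (hs.mem_toFinset.2 h)) _

theorem tsum_ne_top_of_le_of_finite {s : Set ι} (hs : s.Finite) {a b : ι → ℝ≥0∞}
    (ha : ∑' i, a i ≠ ∞) (hb : ∀ i ∈ s, b i ≠ ∞) (h : ∀ i ∉ s, b i ≤ a i) : ∑' i, b i ≠ ∞ := by
  refine ne_top_of_le_ne_top (ENNReal.add_ne_top.2 ⟨ha, tsum_indicator_ne_top hs hb⟩)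
    ((ENNReal.tsum_le_tsum fun i => ?_).trans_eq ENNReal.tsum_add)
  by_cases hi : i ∈ s
  · rw [Set.indicator_of_mem hi]; exact le_add_self
  · exact (h i hi).trans le_self_add

/-- Only finitely many a i reach 1/2, and for these the finiteness of b i suffices. -/
theorem tsum_ne_top_of_small {a b : ι → ℝ≥0∞} (ha : ∑' i, a i ≠ ∞) (hb : ∀ i, b i ≠ ∞)
    (h : ∀ i, a i ≤ 1 / 2 → b i ≤ 2 * a i) : ∑' i, b i ≠ ∞ := by
  have hfin := ENNReal.finite_const_le_of_tsum_ne_top ha (ε := 1 / 2) (by simp)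
  refine tsum_ne_top_of_le_of_finite hfin (a := fun i => 2 * a i) ?_ (fun i _ => hb i)
    fun i hi => h i (not_le.1 hi).le
  rw [ENNReal.tsum_mul_left]
  exact ENNReal.mul_ne_top (by simp) ha

end Sums

theorem hsSq_le {F G H : Type*} [NormedAddCommGroup F] [InnerProductSpace ℂ F]
    [NormedAddCommGroup G] [InnerProductSpace ℂ G] [NormedAddCommGroup H] [InnerProductSpace ℂ H]
    {S : Lminus →L[ℂ] F} {A : Lminus →L[ℂ] G} {B : Lminus →L[ℂ] H} {c : ℝ} (hc : 0 ≤ c)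
    (h : ∀ f, ‖S f‖ ^ 2 ≤ c * (‖A f‖ ^ 2 + ‖B f‖ ^ 2)) :
    hsSq S ≤ ENNReal.ofReal c * (hsSq A + hsSq B) := by
  rw [hsSq, hsSq, hsSq, ← ENNReal.tsum_add, ← ENNReal.tsum_mul_left]
  refine ENNReal.tsum_le_tsum fun n => ?_
  simp only [enorm_sq_eq_ofReal]
  rw [← ENNReal.ofReal_add (sq_nonneg _) (sq_nonneg _), ← ENNReal.ofReal_mul hc]
  exact ENNReal.ofReal_le_ofReal (h _)

/-! ### Norms of the Cauchy blocks and sums of exp(-l) -/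

namespace ModelCurve

variable {I : Type*} (C : ModelCurve I)

open Classical in
/-- `exp (-l i j)` for `i ≠ j`, and `0` for `i = j`. -/
def expDist (i j : I) : ℝ≥0∞ := if i = j then 0 else ENNReal.ofReal (Real.exp (-C.l i j))

theorem expDist_self (i : I) : C.expDist i i = 0 := if_pos rfl

theorem expDist_of_ne {i j : I} (hij : i ≠ j) :
    C.expDist i j = ENNReal.ofReal (Real.exp (-C.l i j)) := if_neg hij

theorem expDist_symm (i j : I) : C.expDist i j = C.expDist j i := by
  by_cases hij : i = j
  · rw [hij]
  · rw [C.expDist_of_ne hij, C.expDist_of_ne (Ne.symm hij), C.l_symm hij]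

theorem expDist_lt_one (i j : I) : C.expDist i j < 1 := by
  by_cases hij : i = j
  · rw [hij, expDist_self]; exact one_pos
  · rw [C.expDist_of_ne hij, ← ENNReal.ofReal_one]
    refine (ENNReal.ofReal_lt_ofReal_iff one_pos).2 ?_
    rw [Real.exp_lt_one_iff]
    linarith [C.l_pos hij]

theorem expDist_ne_top (i j : I) : C.expDist i j ≠ ∞ := ((C.expDist_lt_one i j).trans ENNReal.one_lt_top).ne

/-- The squared singular values q^{2n+1}, q = e^{-l}, form a geometric series. -/
theorem hsSq_block (i j : I) :
    hsSq (C.block i j) = C.expDist i j * (1 - C.expDist i j ^ 2)⁻¹ := by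
  by_cases hij : i = j
  · subst hij
    rw [expDist_self, zero_mul, block_self]
    simp [hsSq, enorm_sq_eq_ofReal]
  · obtain ⟨-, -, u, v, -, h⟩ := C.exists_block_svd hij
    rw [hsSq_eq _ u, ← ENNReal.tsum_geometric, ← ENNReal.tsum_mul_left]
    refine tsum_congr fun n => ?_
    rw [h, enorm_smul, C.expDist_of_ne hij]
    have h1 : ‖v n‖ₑ = 1 := by
      rw [← ofReal_norm, v.orthonormal.1, ENNReal.ofReal_one]
    have h2 : ‖((Real.exp (-((n : ℝ) + 1 / 2) * C.l i j) : ℝ) : ℂ)‖ₑ =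
        ENNReal.ofReal (Real.exp (-((n : ℝ) + 1 / 2) * C.l i j)) := by
      rw [← ofReal_norm, Complex.norm_real, Real.norm_of_nonneg (Real.exp_pos _).le]
    rw [h1, h2, mul_one, ← ENNReal.ofReal_pow (Real.exp_pos _).le,
      ← ENNReal.ofReal_pow (Real.exp_pos _).le, ← ENNReal.ofReal_pow (by positivity),
      ← ENNReal.ofReal_mul (Real.exp_pos _).le]
    congr 1
    rw [← Real.exp_nat_mul, ← Real.exp_nat_mul, ← Real.exp_nat_mul, ← Real.exp_add]
    congr 1
    push_cast; ring

theorem hsSq_block_symm (i j : I) : hsSq (C.block i j) = hsSq (C.block j i) := by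
  rw [hsSq_block, hsSq_block, expDist_symm]

theorem expDist_le_hsSq (i j : I) : C.expDist i j ≤ hsSq (C.block i j) := by
  rw [hsSq_block]
  refine le_mul_of_one_le_right' (ENNReal.one_le_inv.2 tsub_le_self)

theorem hsSq_block_ne_top (i j : I) : hsSq (C.block i j) ≠ ∞ := by
  rw [hsSq_block]
  refine ENNReal.mul_ne_top (C.expDist_ne_top i j) (ENNReal.inv_ne_top.2 ?_)
  rw [← pos_iff_ne_zero, tsub_pos_iff_lt]
  exact pow_lt_one₀ zero_le (C.expDist_lt_one i j) two_ne_zero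

theorem hsSq_block_le {i j : I} (h : C.expDist i j ≤ 1 / 2) :
    hsSq (C.block i j) ≤ 2 * C.expDist i j := by
  rw [hsSq_block, mul_comm]
  refine mul_le_mul_left ?_ _
  rw [ENNReal.inv_le_iff_inv_le, ← one_div]
  refine ENNReal.le_sub_of_add_le_left ?_ ?_
  · exact ENNReal.pow_ne_top (C.expDist_ne_top i j)
  · have h1 : C.expDist i j ^ 2 ≤ 1 / 2 := by
      rw [sq]
      exact (mul_le_of_le_one_right' (C.expDist_lt_one i j).le).trans h
    exact (add_le_add_left h1 _).trans_eq (ENNReal.add_halves 1)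

/-- Weighted sums of `exp (-l i j)` dominate those of the squares of Hilbert-Schmidt norms. -/
theorem tsum_hsSq_ne_top {w : I → ℝ≥0∞} (hw : ∀ i, w i = 0 ∨ 1 ≤ w i) (hw' : ∀ i, w i ≠ ∞)
    (h : ∑' i, ∑' j, w i * C.expDist i j ≠ ∞) : ∑' i, ∑' j, w i * hsSq (C.block i j) ≠ ∞ := by
  rw [← ENNReal.tsum_prod (f := fun i j => _)] at h ⊢
  refine tsum_ne_top_of_small h (fun p => ENNReal.mul_ne_top (hw' _) (C.hsSq_block_ne_top _ _))
    fun p hp => ?_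
  rcases hw p.1 with h0 | h1
  · simp [h0]
  · rw [mul_left_comm]
    -- A weight of at least 1 makes the smallness of the weighted term imply that of exp(-l) itself.
    exact mul_le_mul_right (C.hsSq_block_le ((le_mul_of_one_le_left' h1).trans hp)) _

open Classical in
/-- A finite number of exceptional indices is irrelevant for the summability of `exp (-l i j)`. -/
theorem tsum_expDist_ne_top {E : Set I} (hE : E.Finite)
    (h : ∑' i, ∑' j, (if i ∈ E then 0 else 1) * C.expDist i j ≠ ∞) :
    ∑' i, ∑' j, C.expDist i j ≠ ∞ := by
  -- By symmetry of l the pairs whose second index is not exceptional are controlled too; what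
  -- remains is the finite set E × E.
  have h2 : ∑' i, ∑' j, (if j ∈ E then 0 else 1) * C.expDist i j ≠ ∞ := by
    rw [ENNReal.tsum_comm]
    simpa only [C.expDist_symm] using h
  rw [← ENNReal.tsum_prod (f := fun i j => _)] at h h2 ⊢
  have h3 : ∑' p : I × I, ((if p.1 ∈ E then 0 else 1) * C.expDist p.1 p.2 +
      (if p.2 ∈ E then 0 else 1) * C.expDist p.1 p.2) ≠ ∞ := by
    rw [ENNReal.tsum_add]
    exact ENNReal.add_ne_top.2 ⟨h, h2⟩
  refine tsum_ne_top_of_le_of_finite (hE.prod hE) h3 (fun p _ => C.expDist_ne_top _ _) fun p hp => ?_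
  by_cases hp1 : p.1 ∈ E
  · have hp2 : p.2 ∉ E := fun h => hp ⟨hp1, h⟩
    rw [if_neg hp2, one_mul]; exact le_add_self
  · rw [if_neg hp1, one_mul]; exact le_self_add

-- Real sums over restricted pairs are traded for unrestricted double sums in [0, ∞], the omitted
-- pairs having weight or `expDist` zero.
open Classical in
theorem summable_iff {S : I × I → Prop} {Q : I → Prop} (hS : ∀ p, S p ↔ p.1 ≠ p.2 ∧ Q p.1)
    {w : I → ℝ} (hw : ∀ i, 0 ≤ w i) :
    (Summable fun p : {p : I × I // S p} => w p.1.1 * Real.exp (-C.l p.1.1 p.1.2)) ↔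
      ∑' i, ∑' j, (if Q i then ENNReal.ofReal (w i) else 0) * C.expDist i j ≠ ∞ := by
  have h0 : ∀ p : {p : I × I // S p}, 0 ≤ w p.1.1 * Real.exp (-C.l p.1.1 p.1.2) := fun p =>
    mul_nonneg (hw _) (Real.exp_pos _).le
  have h1 : (Summable fun p : {p : I × I // S p} => w p.1.1 * Real.exp (-C.l p.1.1 p.1.2)) ↔
      ∑' p : {p : I × I // S p}, ENNReal.ofReal (w p.1.1 * Real.exp (-C.l p.1.1 p.1.2)) ≠ ∞ := by
    refine ⟨fun h => h.tsum_ofReal_ne_top, fun h => ?_⟩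
    have := ENNReal.summable_toReal h
    simpa only [ENNReal.toReal_ofReal (h0 _)] using this
  have h2 : ∑' p : {p : I × I // S p}, ENNReal.ofReal (w p.1.1 * Real.exp (-C.l p.1.1 p.1.2)) =
      ∑' i, ∑' j, (if Q i then ENNReal.ofReal (w i) else 0) * C.expDist i j := by
    rw [← ENNReal.tsum_prod (f := fun i j => (if Q i then ENNReal.ofReal (w i) else 0) * C.expDist i j)]
    refine (tsum_subtype {p | S p} fun p : I × I =>
      ENNReal.ofReal (w p.1 * Real.exp (-C.l p.1 p.2))).trans (tsum_congr fun p => ?_)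
    by_cases hp : S p
    · obtain ⟨hne, hq⟩ := (hS p).1 hp
      rw [Set.indicator_of_mem (show p ∈ {p | S p} from hp), if_pos hq, C.expDist_of_ne hne,
        ENNReal.ofReal_mul (hw _)]
    · rw [Set.indicator_of_notMem (show p ∉ {p | S p} from hp)]
      by_cases hne : p.1 = p.2
      · rw [hne, expDist_self, mul_zero]
      · rw [if_neg fun hq => hp ((hS p).2 ⟨hne, hq⟩), zero_mul]
  rw [h1, h2]

end ModelCurve

end HalfForm
end

noncomputable section
namespace HalfForm

open scoped ENNReal

namespace ModelCurve

variable {I : Type*} {C : ModelCurve I}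

/-! ### The criterion in terms of the Riemann norm -/

/-- The product carries the maximum norm, so each component is bounded separately; hence the factor
2. -/
theorem norm_sq_fst_add_norm_sq_snd_le (P : Lplus × Lplus →L[ℂ] Lminus × Lminus) (x : Lplus × Lplus) :
    ‖(P x).1‖ ^ 2 + ‖(P x).2‖ ^ 2 ≤ 2 * ‖P‖ ^ 2 * (‖x.1‖ ^ 2 + ‖x.2‖ ^ 2) := by
  have h1 := P.le_opNorm x
  have h2 := pow_le_pow_left₀ (norm_nonneg _) ((norm_fst_le (P x)).trans h1) 2
  have h3 := pow_le_pow_left₀ (norm_nonneg _) ((norm_snd_le (P x)).trans h1) 2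
  have h4 : ‖x‖ ^ 2 ≤ ‖x.1‖ ^ 2 + ‖x.2‖ ^ 2 := by
    rcases max_choice ‖x.1‖ ‖x.2‖ with h | h <;>
    · rw [Prod.norm_def, h]
      nlinarith [sq_nonneg ‖x.1‖, sq_nonneg ‖x.2‖]
  have h5 := mul_le_mul_of_nonneg_left h4 (sq_nonneg ‖P‖)
  rw [mul_pow] at h2 h3
  linarith

theorem norm_sq_rowBlock_le {P : I → (Lplus × Lplus →L[ℂ] Lminus × Lminus)} {k : I} {c : ℝ}
    (h1 : k ∈ C.pos → ∀ x, ‖(P k x).1‖ ^ 2 + ‖(P k x).2‖ ^ 2 ≤ c * (‖x.1‖ ^ 2 + ‖x.2‖ ^ 2))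
    (h2 : k ∉ C.pos → ∀ x,
      ‖(P (C.inv k) x).1‖ ^ 2 + ‖(P (C.inv k) x).2‖ ^ 2 ≤ c * (‖x.1‖ ^ 2 + ‖x.2‖ ^ 2))
    (j : I) (f : Lminus) :
    ‖C.rowBlock P k j f‖ ^ 2 ≤ c * (‖C.block j k f‖ ^ 2 + ‖C.block j (C.inv k) f‖ ^ 2) := by
  by_cases hk : k ∈ C.pos
  · have := h1 hk (C.block j k f, C.block j (C.inv k) f)
    rw [C.rowBlock_of_mem hk]
    simp only at this
    linarith [sq_nonneg ‖(P k (C.block j k f, C.block j (C.inv k) f)).2‖]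
  · have := h2 hk (C.block j (C.inv k) f, C.block j k f)
    rw [C.rowBlock_of_notMem hk]
    simp only at this
    linarith [sq_nonneg ‖(P (C.inv k) (C.block j (C.inv k) f, C.block j k f)).1‖]

namespace Bundle

variable (L : C.Bundle)

-- A row of Π𝐊 is bounded by a constant times the rows k and k' of 𝐊. Off finitely many rows the
-- constant is the squared Riemann norm; in the others any finite constant will do.
open Classical in
theorem piCauchyIsHilbertSchmidt_of_tsum {E : Set I} (hE : E.Finite)
    (hE0 : ∀ i ∉ E, L.index i = 0)
    (h : ∑' i, ∑' j, (if i ∈ E then 0 else ENNReal.ofReal (riemannNorm (L.onCircle i) ^ 2)) *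
      C.expDist i j ≠ ∞) : L.PiCauchyIsHilbertSchmidt := by
  rw [piCauchyIsHilbertSchmidt_iff]
  choose P hP using L.exists_isGluingOperator
  refine ⟨P, fun i _ => hP i, ?_⟩
  have hone : ∀ i ∉ E, 1 ≤ ENNReal.ofReal (riemannNorm (L.onCircle i) ^ 2) := fun i hi => by
    rw [← ENNReal.ofReal_one]
    exact ENNReal.ofReal_le_ofReal (one_le_pow₀ (L.one_le_riemannNorm (hE0 i hi)))
  have hsum := C.tsum_hsSq_ne_top (fun i => ?_) (fun i => ?_) h
  rotate_left
  · by_cases hi : i ∈ E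
    · exact Or.inl (if_pos hi)
    · rw [if_neg hi]; exact Or.inr (hone i hi)
  · split_ifs <;> simp
  -- Weights of at least 1 can be dropped, and the finitely many exceptional indices can be
  -- restored.
  have hall : ∑' i, ∑' j, C.expDist i j ≠ ∞ := by
    refine C.tsum_expDist_ne_top hE (ne_top_of_le_ne_top h (ENNReal.tsum_le_tsum fun i =>
      ENNReal.tsum_le_tsum fun j => mul_le_mul_left ?_ _))
    split_ifs with hi
    · exact le_rfl
    · exact hone i hi
  have hκ : ∀ k, ∑' j, hsSq (C.block k j) ≠ ∞ := fun k => by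
    have := C.tsum_hsSq_ne_top (w := fun _ => 1) (fun _ => Or.inr le_rfl) (fun _ => by simp)
      (by simpa only [one_mul] using hall)
    simp only [one_mul] at this
    exact ENNReal.ne_top_of_tsum_ne_top this k
  -- Each gluing operator serves both k and k', so the exceptional set is made invariant under the
  -- involution.
  set E' : Set I := E ∪ C.inv ⁻¹' E with hE'
  have hE'f : E'.Finite := hE.union (hE.preimage C.invEquiv.injective.injOn)
  have hE'inv : ∀ k ∉ E', C.inv k ∉ E' := fun k hk => by
    simp only [hE', Set.mem_union, Set.mem_preimage, C.inv_inv] at hk ⊢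
    tauto
  have hE'E : ∀ k ∉ E', k ∉ E := fun k hk hk' => hk (Or.inl hk')
  have hR : ∀ k ∉ E', riemannNorm (L.onCircle (C.inv k)) = riemannNorm (L.onCircle k) := fun k hk => by
    have h1 := hE0 _ (hE'E k hk)
    have h2 := hE0 _ (hE'E _ (hE'inv k hk))
    refine le_antisymm ?_ (L.riemannNorm_le_inv h1 h2)
    have := L.riemannNorm_le_inv h2 (by rwa [C.inv_inv])
    rwa [C.inv_inv] at this
  have hc : ∀ k, ∃ c : ℝ, 0 ≤ c ∧ (k ∉ E' → c = riemannNorm (L.onCircle k) ^ 2) ∧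
      ∀ j f, ‖C.rowBlock P k j f‖ ^ 2 ≤
        c * (‖C.block j k f‖ ^ 2 + ‖C.block j (C.inv k) f‖ ^ 2) := fun k => by
    by_cases hk : k ∈ E'
    · by_cases hp : k ∈ C.pos
      · exact ⟨2 * ‖P k‖ ^ 2, by positivity, fun h => absurd hk h,
          norm_sq_rowBlock_le (fun _ => norm_sq_fst_add_norm_sq_snd_le _) (fun h => absurd hp h)⟩
      · exact ⟨2 * ‖P (C.inv k)‖ ^ 2, by positivity, fun h => absurd hk h,
          norm_sq_rowBlock_le (fun h => absurd h hp) (fun _ => norm_sq_fst_add_norm_sq_snd_le _)⟩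
    · refine ⟨_, by positivity, fun _ => rfl, norm_sq_rowBlock_le
        (fun _ => L.norm_sq_le (hE0 _ (hE'E k hk)) (hP k)) fun _ => ?_⟩
      rw [← hR k hk]
      exact L.norm_sq_le (hE0 _ (hE'E _ (hE'inv k hk))) (hP _)
  choose c hc0 hcR hcle using hc
  -- Changing the weights to finite values on a finite set of rows is harmless, since each row of 𝐊
  -- is square-summable.
  have key : ∀ W : I → ℝ≥0∞, (∀ k, W k ≠ ∞) →
      (∀ k ∉ E', W k = ENNReal.ofReal (riemannNorm (L.onCircle k) ^ 2)) →
      ∑' k, ∑' j, W k * hsSq (C.block k j) ≠ ∞ := fun W hW hW' => by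
    refine tsum_ne_top_of_le_of_finite hE'f hsum (fun k _ => ?_) fun k hk => le_of_eq ?_
    · rw [ENNReal.tsum_mul_left]
      exact ENNReal.mul_ne_top (hW k) (hκ k)
    · rw [hW' k hk, if_neg (hE'E k hk)]
  have hA := key (fun k => ENNReal.ofReal (c k)) (fun _ => ENNReal.ofReal_ne_top)
    fun k hk => by rw [hcR k hk]
  have hB := key (fun k => ENNReal.ofReal (c (C.inv k))) (fun _ => ENNReal.ofReal_ne_top)
    fun k hk => by rw [hcR _ (hE'inv k hk), hR k hk]
  -- The bound for row k also contains the block into k' with weight c k; reindexing by the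
  -- involution accounts for these terms.
  rw [← C.invEquiv.tsum_eq] at hB
  refine ne_top_of_le_ne_top (ENNReal.add_ne_top.2 ⟨hA, hB⟩) ?_
  rw [← ENNReal.tsum_add]
  refine ENNReal.tsum_le_tsum fun k => ?_
  rw [← ENNReal.tsum_add]
  refine ENNReal.tsum_le_tsum fun j => ?_
  refine (hsSq_le (hc0 k) (hcle k j)).trans_eq ?_
  have h1 : C.invEquiv k = C.inv k := rfl
  rw [h1, C.inv_inv, mul_add, C.hsSq_block_symm j k, C.hsSq_block_symm j (C.inv k)]

open Classical in
theorem isHilbertSchmidt_of_tsum {E : Set I} (hE : E.Finite) (hE0 : ∀ i ∉ E, L.index i = 0)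
    (h : ∑' i, ∑' j, (if i ∈ E then 0 else ENNReal.ofReal (riemannNorm (L.onCircle i) ^ 2 +
      riemannNorm (L.dual.onCircle i) ^ 2)) * C.expDist i j ≠ ∞) : L.IsHilbertSchmidt := by
  refine ⟨L.piCauchyIsHilbertSchmidt_of_tsum hE hE0 (ne_top_of_le_ne_top h ?_),
    L.dual.piCauchyIsHilbertSchmidt_of_tsum hE
      (fun i hi => by rw [index_dual, hE0 i hi, neg_zero]) (ne_top_of_le_ne_top h ?_)⟩ <;>
  · refine ENNReal.tsum_le_tsum fun i => ENNReal.tsum_le_tsum fun j => mul_le_mul_left ?_ _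
    split_ifs with hi
    · exact le_rfl
    · exact ENNReal.ofReal_le_ofReal (by
        linarith [sq_nonneg (riemannNorm (L.onCircle i)),
          sq_nonneg (riemannNorm (L.dual.onCircle i))])

theorem isHilbertSchmidt_of_summable_riemannNorm (hL : L.FiniteDegree)
    (h : Summable fun p : {p : I × I // p.1 ≠ p.2 ∧ L.index p.1 = 0} =>
      (riemannNorm (L.onCircle p.1.1) ^ 2 + riemannNorm (L.dual.onCircle p.1.1) ^ 2) *
        Real.exp (-C.l p.1.1 p.1.2)) : L.IsHilbertSchmidt := by
  rw [C.summable_iff (Q := fun i => L.index i = 0) (fun _ => Iff.rfl) (w := fun i =>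
    riemannNorm (L.onCircle i) ^ 2 + riemannNorm (L.dual.onCircle i) ^ 2)
    (fun i => by positivity)] at h
  refine L.isHilbertSchmidt_of_tsum (E := {i | L.index i ≠ 0}) hL (fun i hi => not_not.1 hi) ?_
  convert h using 6 with i j
  by_cases hi : L.index i = 0 <;> simp [hi]

end Bundle

end ModelCurve

end HalfForm
end

noncomputable section
namespace HalfForm

open scoped ENNReal

namespace ModelCurve

variable {I : Type*} {C : ModelCurve I}

/-! ### Almost everywhere constant gluing functions -/

namespace Bundle

variable (L : C.Bundle)

variable {L} in
theorem IsConstAt.eq_constVal {i : I} (hi : L.IsConstAt i) {x : Sphere} (hx : x ∈ C.circle i) :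
    L.ψ i x = L.constVal i := by
  obtain ⟨c, hc⟩ := hi
  rw [hc x hx, constVal, onCircle, hc]
  exact ⟨unitPt 0, norm_unitPt' 0, rfl⟩

variable {L} in
theorem IsConstAt.onCircle_eq {i : I} (hi : L.IsConstAt i) :
    L.onCircle i = fun _ => L.constVal i :=
  funext fun t => hi.eq_constVal ⟨unitPt t, norm_unitPt' t, rfl⟩

theorem constVal_ne_zero (i : I) : L.constVal i ≠ 0 := L.onCircle_ne_zero i 0

variable {L} in
theorem IsConstAt.inv_eq_inv {i : I} (hi : L.IsConstAt i) {y : Sphere}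
    (hy : y ∈ C.circle (C.inv i)) : L.ψ (C.inv i) y = (L.constVal i)⁻¹ := by
  rw [circle, ← C.φ_circle] at hy
  obtain ⟨x, hx, rfl⟩ := hy
  rw [L.inv_eq i x hx, hi.eq_constVal hx]

variable {L} in
theorem IsConstAt.inv {i : I} (hi : L.IsConstAt i) : L.IsConstAt (C.inv i) :=
  ⟨_, fun _ hy => hi.inv_eq_inv hy⟩

variable {L} in
theorem IsConstAt.constVal_inv {i : I} (hi : L.IsConstAt i) :
    L.constVal (C.inv i) = (L.constVal i)⁻¹ :=
  hi.inv_eq_inv ⟨unitPt 0, norm_unitPt' 0, rfl⟩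

variable {L} in
theorem IsConstAt.dual {i : I} (hi : L.IsConstAt i) : L.dual.IsConstAt i := by
  obtain ⟨c, hc⟩ := hi
  exact ⟨c⁻¹, fun x hx => congrArg (fun c : ℂ => c⁻¹) (hc x hx)⟩

theorem constVal_dual (i : I) : L.dual.constVal i = (L.constVal i)⁻¹ := rfl

-- Only constancy on the circle is given, but the derivative of an analytic function there is
-- determined by its derivative along the circle.
variable {L} in
theorem IsConstAt.index_eq_zero {i : I} (hi : L.IsConstAt i) : L.index i = 0 := by
  set F : ℂ → ℂ := fun z : ℂ => L.ψ i (moebius (C.chart i) (z : Sphere)) with hF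
  have h1 : ∀ x : ℝ, deriv F (unitPt (x : UnitAddCircle)) = 0 := fun x => by
    have h2 := ((L.analytic i _ (norm_unitPt' (x : UnitAddCircle))).differentiableAt.hasDerivAt).comp x
      (hasDerivAt_unitPt_coe x)
    have h3 : (F ∘ fun x : ℝ => unitPt (x : UnitAddCircle)) = fun _ => L.constVal i :=
      funext fun x => congrFun hi.onCircle_eq (x : UnitAddCircle)
    rw [← hF, h3] at h2
    have h4 := h2.unique (hasDerivAt_const x _)
    exact (mul_eq_zero.1 h4).resolve_right
      (mul_ne_zero Complex.two_pi_I_ne_zero (unitPt_ne_zero _))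
  rw [index, circleIntegral.integral_congr (g := fun _ => 0) zero_le_one]
  · simp [circleIntegral]
  · intro z hz
    have hz' : ‖z‖ = 1 := by simpa using hz
    have h2 := h1 (Complex.arg z / (2 * Real.pi))
    have h3 : unitPt ((Complex.arg z / (2 * Real.pi) : ℝ) : UnitAddCircle) = z :=
      unitPt_circleParam hz'
    rw [h3] at h2
    change logDeriv F z = 0
    rw [logDeriv_apply, h2, zero_div]

-- The condition splits into φ*g₊ = c f₋ and φ*g₋ = c f₊, and φ* preserves norms.
variable {L} in
theorem IsConstAt.norm_eq {i : I} (hi : L.IsConstAt i)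
    {P : Lplus × Lplus →L[ℂ] Lminus × Lminus} (hP : L.IsGluingOperator i P) (x : Lplus × Lplus) :
    ‖(P x).1‖ = ‖L.constVal i‖⁻¹ * ‖x.2‖ ∧ ‖(P x).2‖ = ‖L.constVal i‖ * ‖x.1‖ := by
  have hA := C.diskSwap_glue i
  have hc : 0 < ‖L.constVal i‖ := norm_pos_iff.2 (L.constVal_ne_zero i)
  have h1 := L.isGluingOperator_iff (h := ContinuousMap.const _ (L.constVal i)) hi.index_eq_zero
    hi.onCircle_eq hP x
  obtain ⟨e1, e2⟩ := parts_eq (x := x.1) (y := (P x).1) rfl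
  obtain ⟨e3, e4⟩ := parts_eq (x := x.2) (y := (P x).2) rfl
  have h3 := (pull_eq_iff hA).1 h1
  rw [e3, e4, mulOp_const, map_smul, map_smul, e1, e2] at h3
  have h4 : ‖x.2‖ = ‖L.constVal i • (P x).1‖ :=
    (LinearIsometry.norm_map (pull hA.circleAut) (x.2 : L2)).symm.trans (congrArg norm h3.1)
  have h5 : ‖(P x).2‖ = ‖L.constVal i • x.1‖ :=
    (LinearIsometry.norm_map (pull hA.circleAut) ((P x).2 : L2)).symm.trans (congrArg norm h3.2)
  rw [norm_smul] at h4 h5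
  exact ⟨by rw [h4, inv_mul_cancel_left₀ hc.ne'], h5⟩

-- If k lies in I₊ this is the first component of its own operator, otherwise the second component
-- of that of k'; both give the same formula because ψ at k' is the inverse constant.
variable {L} in
theorem IsConstAt.norm_rowBlock {P : I → (Lplus × Lplus →L[ℂ] Lminus × Lminus)}
    (hP : ∀ i ∈ C.pos, L.IsGluingOperator i (P i)) {k : I} (hk : L.IsConstAt k) (j : I)
    (f : Lminus) : ‖C.rowBlock P k j f‖ = ‖L.constVal k‖⁻¹ * ‖C.block j (C.inv k) f‖ := by
  by_cases hp : k ∈ C.pos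
  · rw [C.rowBlock_of_mem hp]
    exact (hk.norm_eq (hP k hp) _).1
  · rw [C.rowBlock_of_notMem hp]
    have := (hk.inv.norm_eq (hP _ (C.inv_mem_pos_of_notMem hp))
      (C.block j (C.inv k) f, C.block j k f)).2
    rw [this, hk.constVal_inv, norm_inv]

-- Row k' of Π𝐊 has the norms of the blocks into k multiplied by |c_k|, and a block has squared
-- Hilbert–Schmidt norm at least exp(-l).
open Classical in
theorem tsum_constVal_ne_top (h : L.PiCauchyIsHilbertSchmidt) :
    ∑' k, ∑' j, (if L.IsConstAt k then ENNReal.ofReal (‖L.constVal k‖ ^ 2) else 0) *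
      C.expDist k j ≠ ∞ := by
  obtain ⟨P, hP, hfin⟩ := L.piCauchyIsHilbertSchmidt_iff.1 h
  rw [← C.invEquiv.tsum_eq] at hfin
  refine ne_top_of_le_ne_top hfin (ENNReal.tsum_le_tsum fun k => ENNReal.tsum_le_tsum fun j => ?_)
  split_ifs with hk
  · rw [C.expDist_symm]
    refine (mul_le_mul_right (C.expDist_le_hsSq j k) _).trans ?_
    rw [hsSq, hsSq, ← ENNReal.tsum_mul_left]
    refine ENNReal.tsum_le_tsum fun n => le_of_eq ?_
    have h1 := hk.inv.norm_rowBlock hP j (minusBasis n)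
    rw [C.inv_inv, hk.constVal_inv, norm_inv, _root_.inv_inv] at h1
    change _ = ‖C.rowBlock P (C.inv k) j (minusBasis n)‖ₑ ^ 2
    rw [enorm_sq_eq_ofReal, enorm_sq_eq_ofReal, h1, mul_pow, ENNReal.ofReal_mul (sq_nonneg _)]
  · simp

theorem isHilbertSchmidt_iff_summable_constVal (hL : {i | ¬ L.IsConstAt i}.Finite) :
    L.IsHilbertSchmidt ↔ Summable fun p : {p : I × I // p.1 ≠ p.2 ∧ L.IsConstAt p.1} =>
      (‖L.constVal p.1.1‖ ^ 2 + (‖L.constVal p.1.1‖ ^ 2)⁻¹) * Real.exp (-C.l p.1.1 p.1.2) := by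
  classical
  rw [C.summable_iff (Q := fun i => L.IsConstAt i) (fun _ => Iff.rfl) (w := fun i =>
    ‖L.constVal i‖ ^ 2 + (‖L.constVal i‖ ^ 2)⁻¹) (fun i => by positivity)]
  constructor
  · rintro ⟨h1, h2⟩
    refine ne_top_of_le_ne_top
      (ENNReal.add_ne_top.2 ⟨L.tsum_constVal_ne_top h1, L.dual.tsum_constVal_ne_top h2⟩) ?_
    rw [← ENNReal.tsum_add]
    refine ENNReal.tsum_le_tsum fun k => ?_
    rw [← ENNReal.tsum_add]
    refine ENNReal.tsum_le_tsum fun j => ?_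
    rw [← add_mul]
    refine mul_le_mul_left ?_ _
    by_cases hk : L.IsConstAt k
    · rw [if_pos hk, if_pos hk, if_pos hk.dual, constVal_dual, norm_inv, inv_pow,
        ENNReal.ofReal_add (by positivity) (by positivity)]
    · rw [if_neg hk]; exact zero_le
  · intro h
    refine L.isHilbertSchmidt_of_tsum hL (fun i hi => (not_not.1 hi).index_eq_zero) ?_
    -- With x = |c|² the squared Riemann norms of c and 1/c add up to at most 2 + 2(x + 1/x) ≤ 4(x +
    -- 1/x).
    refine ne_top_of_le_ne_top (ENNReal.mul_ne_top (ENNReal.ofNat_ne_top (n := 4)) h) ?_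
    rw [← ENNReal.tsum_mul_left]
    refine ENNReal.tsum_le_tsum fun k => ?_
    rw [← ENNReal.tsum_mul_left]
    refine ENNReal.tsum_le_tsum fun j => ?_
    rw [← mul_assoc]
    refine mul_le_mul_left ?_ _
    by_cases hk : L.IsConstAt k
    · rw [if_neg (show k ∉ {i | ¬ L.IsConstAt i} from fun h => h hk), if_pos hk]
      have h4 : (4 : ℝ≥0∞) = ENNReal.ofReal 4 := by simp
      rw [h4, ← ENNReal.ofReal_mul (by norm_num)]
      refine ENNReal.ofReal_le_ofReal ?_
      have hc := L.constVal_ne_zero k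
      have h1 := riemannNorm_const_sq_le hc
      have h2 := riemannNorm_const_sq_le (inv_ne_zero hc)
      rw [norm_inv, inv_pow, _root_.inv_inv] at h2
      rw [hk.onCircle_eq, hk.dual.onCircle_eq, constVal_dual]
      have h3 : 0 < ‖L.constVal k‖ ^ 2 := by have := norm_pos_iff.2 hc; positivity
      set x := ‖L.constVal k‖ ^ 2
      have h5 : 1 ≤ x + x⁻¹ := by
        have h6 : x * x⁻¹ = 1 := mul_inv_cancel₀ h3.ne'
        have h7 : 0 < x⁻¹ := inv_pos.2 h3
        nlinarith [sq_nonneg (x - x⁻¹)]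
      linarith
    · rw [if_pos (show k ∈ {i | ¬ L.IsConstAt i} from hk)]; exact zero_le

end Bundle

theorem trivialBundle_isConstAt (C : ModelCurve I) (i : I) : C.trivialBundle.IsConstAt i :=
  ⟨1, fun _ _ => rfl⟩

open Classical in
theorem isHilbertSchmidt_iff_tsum (C : ModelCurve I) :
    C.IsHilbertSchmidt ↔ ∑' i, ∑' j, C.expDist i j ≠ ∞ := by
  rw [IsHilbertSchmidt, Bundle.isHilbertSchmidt_iff_summable_constVal _
    (by simp [C.trivialBundle_isConstAt])]
  rw [C.summable_iff (Q := fun i => C.trivialBundle.IsConstAt i) (fun _ => Iff.rfl) (w := fun i =>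
    ‖C.trivialBundle.constVal i‖ ^ 2 + (‖C.trivialBundle.constVal i‖ ^ 2)⁻¹)
    (fun i => by positivity)]
  have h1 : ∀ i, C.trivialBundle.constVal i = 1 := fun _ => rfl
  have h2 : ENNReal.ofReal (1 ^ 2 + (1 ^ 2)⁻¹) = 2 := by norm_num
  simp only [C.trivialBundle_isConstAt, if_true, h1, norm_one, h2, ENNReal.tsum_mul_left]
  refine ⟨fun h h' => h ?_, fun h => ENNReal.mul_ne_top (by simp) h⟩
  rw [h', ENNReal.mul_top (by simp)]

theorem isHilbertSchmidt_iff_summable (C : ModelCurve I) : C.IsHilbertSchmidt ↔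
    Summable fun p : {p : I × I // p.1 ≠ p.2} => Real.exp (-C.l p.1.1 p.1.2) := by
  have h := C.summable_iff (S := fun p => p.1 ≠ p.2) (Q := fun _ => True) (fun _ => by simp)
    (w := fun _ => 1) (fun _ => zero_le_one)
  simp only [one_mul, if_true, ENNReal.ofReal_one] at h
  rw [h, isHilbertSchmidt_iff_tsum]

end ModelCurve

end HalfForm
end

noncomputable section
namespace HalfForm

open scoped ENNReal

/-! ### A bilinear form -/

/-- The bilinear form `∫ f g dt`. -/
def bilin (f g : L2) : ℂ := ∫ t, f t * g t ∂haar

theorem integrable_bilin (f g : L2) : Integrable (fun t => f t * g t) haar :=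
  (Lp.memLp f).integrable_mul (Lp.memLp g)

theorem bilin_comm (f g : L2) : bilin f g = bilin g f := by simp only [bilin, mul_comm]

theorem bilin_add_left (f f' g : L2) : bilin (f + f') g = bilin f g + bilin f' g := by
  rw [bilin, bilin, bilin, ← integral_add (integrable_bilin f g) (integrable_bilin f' g)]
  refine integral_congr_ae ?_
  filter_upwards [Lp.coeFn_add f f'] with t ht
  rw [ht, Pi.add_apply, add_mul]

theorem bilin_add_right (f g g' : L2) : bilin f (g + g') = bilin f g + bilin f g' := by
  rw [bilin_comm, bilin_add_left, bilin_comm g, bilin_comm g']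

theorem bilin_smul_left (c : ℂ) (f g : L2) : bilin (c • f) g = c * bilin f g := by
  rw [bilin, bilin, ← integral_const_mul]
  refine integral_congr_ae ?_
  filter_upwards [Lp.coeFn_smul c f] with t ht
  rw [ht, Pi.smul_apply, smul_eq_mul, mul_assoc]

theorem bilin_smul_right (c : ℂ) (f g : L2) : bilin f (c • g) = c * bilin f g := by
  rw [bilin_comm, bilin_smul_left, bilin_comm]

theorem norm_bilin_le (f g : L2) : ‖bilin f g‖ ≤ ‖f‖ * ‖g‖ := by
  have h1 : bilin f g = inner ℂ (star f) g := by
    rw [L2.inner_def]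
    refine integral_congr_ae ?_
    filter_upwards [Lp.coeFn_star f] with t ht
    rw [ht, RCLike.inner_apply, Pi.star_apply, RCLike.star_def, RCLike.conj_conj, mul_comm]
  have h2 : ‖star f‖ ≤ ‖f‖ := Lp.norm_le_norm_of_ae_le (by
    filter_upwards [Lp.coeFn_star f] with t ht
    rw [ht, Pi.star_apply, norm_star])
  rw [h1]
  exact (norm_inner_le_norm _ _).trans (mul_le_mul_of_nonneg_right h2 (norm_nonneg _))

theorem bilin_fourierLp (k : ℤ) (g : L2) :
    bilin (fourierLp 2 k : L2) g = inner ℂ (fourierLp 2 (-k) : L2) g := by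
  rw [inner_fourierLp, bilin, neg_neg]
  refine integral_congr_ae ?_
  filter_upwards [coeFn_fourierLp_two k] with t ht
  rw [ht]

/-- Frequencies at most -1 add up to at most -2, so the product has no constant term. -/
theorem bilin_Lminus {f g : L2} (hf : f ∈ Lminus) (hg : g ∈ Lminus) : bilin f g = 0 := by
  let V : L2 →ₗ[ℂ] ℂ :=
    { toFun := fun f => bilin f g
      map_add' := fun f f' => bilin_add_left f f' g
      map_smul' := fun c f => bilin_smul_left c f g }
  let V' : L2 →L[ℂ] ℂ := V.mkContinuous ‖g‖ fun f => by
    rw [mul_comm]; exact norm_bilin_le f g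
  have h : Lminus ≤ LinearMap.ker V'.toLinearMap := Lminus_le V'.isClosed_ker fun k hk => by
    change bilin _ g = 0
    rw [bilin_fourierLp]
    exact mem_Lminus_iff.1 hg _ (by lia)
  exact h hf

/-- Integration against dt is not invariant under fraction-linear maps, but an identity between
products is; it can be pulled back before integrating. -/
theorem CircleAut.pull_mul_eq {A : SL(2, ℂ)} (hA : CircleAut A) {f f' g g' : L2}
    (h : ∀ᵐ t ∂haar, f t * f' t = g t * g' t) :
    ∀ᵐ t ∂haar, pull hA f t * pull hA f' t = pull hA g t * pull hA g' t := by
  have h' : (fun t => f t * f' t) =ᵐ[haar] fun t => g t * g' t := h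
  filter_upwards [hA.ae_comp h', coeFn_pull hA f, coeFn_pull hA f', coeFn_pull hA g,
    coeFn_pull hA g'] with t h0 h1 h2 h3 h4
  rw [h1, h2, h3, h4, mul_mul_mul_comm, h0, mul_mul_mul_comm]

/-- In the coordinate given by B, y and y' are c plus terms of negative frequency, so the integral
of y y' is c². For a a' the product of the two -parts integrates to 0, and every other term contains
a small +-part. -/
theorem sq_norm_le_of_mul_eq {B : SL(2, ℂ)} (hB : DiskAut B) {y y' a a' : L2} {c : ℂ} {ε : ℝ}
    (h : ∀ᵐ t ∂haar, y t * y' t = a t * a' t)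
    (hy : (plusPart y : L2) = c • pull hB.circleAut (fourierLp 2 0 : L2))
    (hy' : (plusPart y' : L2) = c • pull hB.circleAut (fourierLp 2 0 : L2))
    (h1 : ‖minusPart a‖ ≤ ‖c‖) (h1' : ‖minusPart a'‖ ≤ ‖c‖)
    (h2 : ‖plusPart a‖ ≤ ε) (h2' : ‖plusPart a'‖ ≤ ε) : ‖c‖ ^ 2 ≤ 6 * ε ^ 2 := by
  set V := pull hB.circleAut.inv with hV
  have hsplit : ∀ x : L2, V x = V (plusPart x) + V (minusPart x) := fun x => by
    rw [← map_add, plusPart_add_minusPart]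
  have hminus : ∀ x : L2, V (minusPart x) ∈ Lminus := fun x => hB.inv.pull_mem_Lminus (minusPart x).2
  have hzero : ∀ x : L2, bilin (fourierLp 2 0 : L2) (V (minusPart x)) = 0 := fun x => by
    rw [bilin_fourierLp]
    exact mem_Lminus_iff.1 (hminus x) _ (by lia)
  have e1 : bilin (V y) (V y') = c ^ 2 := by
    rw [hsplit y, hsplit y', hy, hy', map_smul, pull_inv_pull, bilin_add_left, bilin_add_right,
      bilin_add_right, bilin_smul_left, bilin_smul_right, bilin_smul_left,
      bilin_comm (V (minusPart y)) (c • _), bilin_smul_left, hzero, hzero,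
      bilin_Lminus (hminus y) (hminus y'), bilin_fourierLp, neg_zero, inner_fourierLp_fourierLp,
      if_pos rfl]
    ring
  have e2 : bilin (V y) (V y') = bilin (V a) (V a') :=
    integral_congr_ae (hB.circleAut.inv.pull_mul_eq h)
  have e3 : bilin (V a) (V a') = bilin (V (plusPart a)) (V (plusPart a')) +
      bilin (V (plusPart a)) (V (minusPart a')) + bilin (V (minusPart a)) (V (plusPart a')) := by
    rw [hsplit a, hsplit a', bilin_add_left, bilin_add_right, bilin_add_right,
      bilin_Lminus (hminus a) (hminus a')]
    ring
  have hn : ∀ x : L2, ‖V x‖ = ‖x‖ := V.norm_map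
  have n1 := norm_bilin_le (V (plusPart a)) (V (plusPart a'))
  have n2 := norm_bilin_le (V (plusPart a)) (V (minusPart a'))
  have n3 := norm_bilin_le (V (minusPart a)) (V (plusPart a'))
  rw [hn, hn] at n1 n2 n3
  change _ ≤ ‖plusPart a‖ * ‖plusPart a'‖ at n1
  change _ ≤ ‖plusPart a‖ * ‖minusPart a'‖ at n2
  change _ ≤ ‖minusPart a‖ * ‖plusPart a'‖ at n3
  have hε : 0 ≤ ε := (norm_nonneg _).trans h2
  have m1 := mul_le_mul h2 h2' (norm_nonneg _) hε
  have m2 := mul_le_mul h2 h1' (norm_nonneg _) hε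
  have m3 := mul_le_mul h1 h2' (norm_nonneg _) (norm_nonneg c)
  have e4 : ‖c‖ ^ 2 ≤ ε * ε + ε * ‖c‖ + ‖c‖ * ε := by
    rw [← norm_pow, ← e1, e2, e3]
    refine (norm_add₃_le).trans ?_
    linarith
  -- From |c|² ≤ ε² + 2ε|c| and 2ε|c| ≤ |c|²/2 + 2ε².
  nlinarith [sq_nonneg (‖c‖ - 2 * ε)]

/-! ### From a Hilbert–Schmidt bundle to the curve -/

namespace ModelCurve

variable {I : Type*} (C : ModelCurve I)

namespace Bundle

variable {C} (L : C.Bundle)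

/-- Both operators are applied to the same x, so that the prescribed +-parts agree and only the
-parts, measured by P x and P' x, depend on ψ. -/
theorem sq_norm_le_of_isGluingOperator {i : I} (hi : L.index i = 0)
    {P P' : Lplus × Lplus →L[ℂ] Lminus × Lminus} (hP : L.IsGluingOperator i P)
    (hP' : L.dual.IsGluingOperator i P') {B : SL(2, ℂ)} (hB : DiskAut B) {c : ℂ} {x : Lplus × Lplus}
    (hx : ((x.1 : L2) = c • pull hB.circleAut (fourierLp 2 0 : L2) ∧ ‖x.2‖ ≤ ‖c‖) ∨
      ((x.2 : L2) = c • pull hB.circleAut (fourierLp 2 0 : L2) ∧ ‖x.1‖ ≤ ‖c‖)) :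
    ‖c‖ ^ 2 ≤ 6 * ((‖(P x).1‖ ^ 2 + ‖(P x).2‖ ^ 2) + (‖(P' x).1‖ ^ 2 + ‖(P' x).2‖ ^ 2)) := by
  obtain ⟨h, hh, hψ⟩ := L.exists_factor_of_index_eq_zero hi
  obtain ⟨h', hh', hhinv⟩ := hh.inv
  have hA := C.diskSwap_glue i
  have hψ' : L.dual.onCircle i = h' := funext fun t => by
    rw [hhinv, ← hψ]; rfl
  have h1 := L.isGluingOperator_iff hi hψ hP x
  have h2 := L.dual.isGluingOperator_iff (by rw [index_dual, hi, neg_zero]) hψ' hP' x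
  obtain ⟨e1, e2⟩ := parts_eq (x := x.1) (y := (P x).1) rfl
  obtain ⟨e3, e4⟩ := parts_eq (x := x.2) (y := (P x).2) rfl
  obtain ⟨e1', e2'⟩ := parts_eq (x := x.1) (y := (P' x).1) rfl
  obtain ⟨e3', e4'⟩ := parts_eq (x := x.2) (y := (P' x).2) rfl
  set f := (x.1 : L2) + (P x).1
  set g := (x.2 : L2) + (P x).2
  set f' := (x.1 : L2) + (P' x).1
  set g' := (x.2 : L2) + (P' x).2
  -- The factors ψ and ψ⁻¹ cancel; this is where the bundle and its dual are used together.
  have hmul : ∀ᵐ t ∂haar, f t * f' t = pull hA.circleAut g t * pull hA.circleAut g' t := by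
    filter_upwards [eq_mulOp_iff.1 h1, eq_mulOp_iff.1 h2] with t k1 k2
    rw [k1, k2, hhinv, mul_mul_mul_comm, mul_inv_cancel₀ (hh.ne_zero t), one_mul]
  set S := (‖(P x).1‖ ^ 2 + ‖(P x).2‖ ^ 2) + (‖(P' x).1‖ ^ 2 + ‖(P' x).2‖ ^ 2) with hS
  have hS0 : 0 ≤ S := by positivity
  rw [← Real.sq_sqrt hS0]
  have s1 := sq_nonneg ‖(P x).1‖
  have s2 := sq_nonneg ‖(P x).2‖
  have s3 := sq_nonneg ‖(P' x).1‖
  have s4 := sq_nonneg ‖(P' x).2‖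
  have b1 : ‖(P x).1‖ ≤ √S := Real.le_sqrt_of_sq_le (by linarith)
  have b2 : ‖(P x).2‖ ≤ √S := Real.le_sqrt_of_sq_le (by linarith)
  have b3 : ‖(P' x).1‖ ≤ √S := Real.le_sqrt_of_sq_le (by linarith)
  have b4 : ‖(P' x).2‖ ≤ √S := Real.le_sqrt_of_sq_le (by linarith)
  have hnorm : ∀ (A : SL(2, ℂ)) (hA : DiskSwap A) (z : L2),
      ‖plusPart (pull hA.circleAut z)‖ = ‖minusPart z‖ ∧
        ‖minusPart (pull hA.circleAut z)‖ = ‖plusPart z‖ := fun A hA z =>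
    ⟨(congrArg norm (hA.parts_pull z).1).trans (LinearIsometry.norm_map _ _),
      (congrArg norm (hA.parts_pull z).2).trans (LinearIsometry.norm_map _ _)⟩
  rcases hx with ⟨hx1, hx2⟩ | ⟨hx1, hx2⟩
  · refine sq_norm_le_of_mul_eq hB hmul (by rw [e1, hx1]) (by rw [e1', hx1]) ?_ ?_ ?_ ?_
    · rw [(hnorm _ hA _).2, e3]; exact hx2
    · rw [(hnorm _ hA _).2, e3']; exact hx2
    · rw [(hnorm _ hA _).1, e4]; exact b2
    · rw [(hnorm _ hA _).1, e4']; exact b4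
  -- If the distinguished vector lies on ∂K i', the identity is transported there and its two sides
  -- exchange roles.
  · have hmul' := hA.circleAut.inv.pull_mul_eq hmul
    simp only [pull_inv_pull] at hmul'
    refine sq_norm_le_of_mul_eq hB (hmul'.mono fun t ht => ht.symm) (by rw [e3, hx1])
      (by rw [e3', hx1]) ?_ ?_ ?_ ?_
    · rw [(hnorm _ hA.inv _).2, e1]; exact hx2
    · rw [(hnorm _ hA.inv _).2, e1']; exact hx2
    · rw [(hnorm _ hA.inv _).1, e2]; exact b1
    · rw [(hnorm _ hA.inv _).1, e2']; exact b3

end Bundle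

/-- The largest singular value is e^{-l/2}, at n = 0. -/
theorem enorm_sq_block_le (j k : I) (f : Lminus) :
    ‖C.block j k f‖ₑ ^ 2 ≤ C.expDist j k * ‖f‖ₑ ^ 2 := by
  by_cases hjk : j = k
  · subst hjk
    rw [block_self, expDist_self, zero_mul, zero_apply, enorm_sq_eq_ofReal,
      norm_zero]
    simp
  obtain ⟨-, -, u, v, -, h⟩ := C.exists_block_svd hjk
  have h1 : ∀ n, inner ℂ (v n) (C.block j k f) =
      ((Real.exp (-((n : ℝ) + 1 / 2) * C.l j k) : ℝ) : ℂ) * inner ℂ (u n) f := fun n => by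
    have h2 : (innerSL ℂ (v n)) ∘L C.block j k =
        ((Real.exp (-((n : ℝ) + 1 / 2) * C.l j k) : ℝ) : ℂ) • innerSL ℂ (u n) := by
      refine ContinuousLinearMap.ext_on (s := Set.range u)
        (Submodule.dense_iff_topologicalClosure_eq_top.2 u.dense_span) ?_
      rintro _ ⟨m, rfl⟩
      change inner ℂ (v n) (C.block j k (u m)) = _ * inner ℂ (u n) (u m)
      rw [h]
      refine (inner_smul_right (v n) (v m) _).trans ?_
      rw [orthonormal_iff_ite.1 v.orthonormal, orthonormal_iff_ite.1 u.orthonormal]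
      split_ifs with hnm
      · rw [hnm]
      · simp
    exact congrArg (fun T : Lminus →L[ℂ] ℂ => T f) h2
  rw [enorm_sq_eq_tsum_inner v, enorm_sq_eq_tsum_inner u f, ← ENNReal.tsum_mul_left]
  refine ENNReal.tsum_le_tsum fun n => ?_
  rw [h1, enorm_mul, mul_pow]
  refine mul_le_mul_left ?_ _
  rw [enorm_sq_eq_ofReal, C.expDist_of_ne hjk, Complex.norm_real,
    Real.norm_of_nonneg (Real.exp_pos _).le, ← Real.exp_nat_mul]
  refine ENNReal.ofReal_le_ofReal (Real.exp_le_exp.2 ?_)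
  have := mul_nonneg (Nat.cast_nonneg (α := ℝ) n) (C.l_pos hjk).le
  push_cast
  linarith

/-- The top singular vector; its image is a multiple of a pulled-back constant, the shape that the
bilinear form detects. -/
theorem exists_max_vector {j k : I} (hjk : j ≠ k) :
    ∃ (B : SL(2, ℂ)) (hB : DiskAut B) (c : ℂ) (u : HilbertBasis ℕ ℂ Lminus),
      (C.block j k (u 0) : L2) = c • pull hB.circleAut (fourierLp 2 0 : L2) ∧
      ‖c‖ₑ ^ 2 = C.expDist j k := by
  obtain ⟨B, hB, u, v, hv, h⟩ := C.exists_block_svd hjk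
  refine ⟨B, hB, ((Real.exp (-(((0 : ℕ) : ℝ) + 1 / 2) * C.l j k) : ℝ) : ℂ) * (-Complex.I), u, ?_, ?_⟩
  · rw [h 0, Submodule.coe_smul, hv 0, smul_smul]
    rfl
  · rw [enorm_sq_eq_ofReal, norm_mul, norm_neg, Complex.norm_I, mul_one, Complex.norm_real,
      Real.norm_of_nonneg (Real.exp_pos _).le, ← Real.exp_nat_mul, C.expDist_of_ne hjk]
    congr 2
    push_cast; ring

namespace Bundle

variable {C} (L : C.Bundle)

/-- The estimate for a single vector x = 𝐊u, with u a top singular vector, is enough, because u can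
be completed to the basis in which the Hilbert–Schmidt norms are computed. -/
theorem expDist_le_hsSq_rowBlock {P P' : I → (Lplus × Lplus →L[ℂ] Lminus × Lminus)} {i : I}
    (hpos : i ∈ C.pos) (hi : L.index i = 0) (hP : L.IsGluingOperator i (P i))
    (hP' : L.dual.IsGluingOperator i (P' i)) (j : I) :
    max (C.expDist j i) (C.expDist j (C.inv i)) ≤
      6 * ((hsSq (C.rowBlock P i j) + hsSq (C.rowBlock P (C.inv i) j)) +
        (hsSq (C.rowBlock P' i j) + hsSq (C.rowBlock P' (C.inv i) j))) := by
  have key : ∀ (u : HilbertBasis ℕ ℂ Lminus) (B : SL(2, ℂ)) (hB : DiskAut B) (c : ℂ),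
      ((C.block j i (u 0) : L2) = c • pull hB.circleAut (fourierLp 2 0 : L2) ∧
        ‖C.block j (C.inv i) (u 0)‖ ≤ ‖c‖) ∨
      ((C.block j (C.inv i) (u 0) : L2) = c • pull hB.circleAut (fourierLp 2 0 : L2) ∧
        ‖C.block j i (u 0)‖ ≤ ‖c‖) →
      ‖c‖ₑ ^ 2 ≤ 6 * ((hsSq (C.rowBlock P i j) + hsSq (C.rowBlock P (C.inv i) j)) +
        (hsSq (C.rowBlock P' i j) + hsSq (C.rowBlock P' (C.inv i) j))) := by
    intro u B hB c hx
    have h1 := L.sq_norm_le_of_isGluingOperator hi hP hP' hB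
      (x := (C.block j i (u 0), C.block j (C.inv i) (u 0))) hx
    rw [← C.rowBlock_of_mem hpos, ← C.rowBlock_inv hpos, ← C.rowBlock_of_mem hpos,
      ← C.rowBlock_inv hpos] at h1
    have h2 : ∀ (Q : I → (Lplus × Lplus →L[ℂ] Lminus × Lminus)) (k : I),
        ENNReal.ofReal (‖C.rowBlock Q k j (u 0)‖ ^ 2) ≤ hsSq (C.rowBlock Q k j) := fun Q k => by
      rw [← enorm_sq_eq_ofReal, hsSq_eq _ u]
      exact ENNReal.le_tsum (f := fun n => ‖C.rowBlock Q k j (u n)‖ₑ ^ 2) 0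
    rw [enorm_sq_eq_ofReal]
    refine (ENNReal.ofReal_le_ofReal h1).trans ?_
    rw [ENNReal.ofReal_mul (by norm_num), ENNReal.ofReal_add (by positivity) (by positivity),
      ENNReal.ofReal_add (by positivity) (by positivity),
      ENNReal.ofReal_add (by positivity) (by positivity)]
    have h6 : ENNReal.ofReal 6 = 6 := by simp
    rw [h6]
    exact mul_le_mul_right (add_le_add (add_le_add (h2 _ _) (h2 _ _))
      (add_le_add (h2 _ _) (h2 _ _))) _
  have hle : ∀ (k : I) (u : HilbertBasis ℕ ℂ Lminus) (c : ℂ), C.expDist j k ≤ ‖c‖ₑ ^ 2 →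
      ‖C.block j k (u 0)‖ ≤ ‖c‖ := fun k u c hc => by
    have h1 := C.enorm_sq_block_le j k (u 0)
    rw [enorm_sq_eq_ofReal (u 0), u.orthonormal.1, one_pow, ENNReal.ofReal_one, mul_one] at h1
    have h2 := h1.trans hc
    rw [enorm_sq_eq_ofReal, enorm_sq_eq_ofReal, ENNReal.ofReal_le_ofReal_iff (sq_nonneg _)] at h2
    exact le_of_sq_le_sq h2 (norm_nonneg _)
  -- Taking the larger of the two blocks ensures that the other component of 𝐊u has norm at most
  -- |c|.
  rcases le_total (C.expDist j (C.inv i)) (C.expDist j i) with hmax | hmax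
  · rw [max_eq_left hmax]
    by_cases hji : j = i
    · rw [hji, expDist_self]; exact zero_le
    obtain ⟨B, hB, c, u, h1, h2⟩ := C.exists_max_vector hji
    rw [← h2]
    exact key u B hB c (Or.inl ⟨h1, hle _ u c (by rwa [h2])⟩)
  · rw [max_eq_right hmax]
    by_cases hji : j = C.inv i
    · rw [hji, expDist_self]; exact zero_le
    obtain ⟨B, hB, c, u, h1, h2⟩ := C.exists_max_vector hji
    rw [← h2]
    exact key u B hB c (Or.inr ⟨h1, hle _ u c (by rwa [h2])⟩)

/-- For index 0 at both k and k', exp(-l) is dominated by the blocks of both operators in rows k and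
k', whose sum converges. The remaining finitely many indices are handled by `tsum_expDist_ne_top`.
-/
theorem curve_isHilbertSchmidt (hL : L.FiniteDegree) (h : L.IsHilbertSchmidt) :
    C.IsHilbertSchmidt := by
  classical
  obtain ⟨P, hP, hfin⟩ := L.piCauchyIsHilbertSchmidt_iff.1 h.1
  obtain ⟨P', hP', hfin'⟩ := L.dual.piCauchyIsHilbertSchmidt_iff.1 h.2
  rw [isHilbertSchmidt_iff_tsum]
  set E : Set I := {i | L.index i ≠ 0} ∪ C.inv ⁻¹' {i | L.index i ≠ 0} with hE
  have hEf : E.Finite := Set.Finite.union hL (Set.Finite.preimage C.invEquiv.injective.injOn hL)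
  have hE1 : ∀ k ∉ E, L.index k = 0 := fun k hk => not_not.1 fun h => hk (Or.inl h)
  have hE2 : ∀ k ∉ E, L.index (C.inv k) = 0 := fun k hk => not_not.1 fun h => hk (Or.inr h)
  have hfin2 := hfin
  have hfin2' := hfin'
  rw [← C.invEquiv.tsum_eq] at hfin2 hfin2'
  have hsum : ∑' k, ∑' j, 6 * ((hsSq (C.rowBlock P k j) + hsSq (C.rowBlock P (C.inv k) j)) +
      (hsSq (C.rowBlock P' k j) + hsSq (C.rowBlock P' (C.inv k) j))) ≠ ∞ := by
    simp only [ENNReal.tsum_mul_left, ENNReal.tsum_add]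
    exact ENNReal.mul_ne_top (by simp) (ENNReal.add_ne_top.2
      ⟨ENNReal.add_ne_top.2 ⟨hfin, hfin2⟩, ENNReal.add_ne_top.2 ⟨hfin', hfin2'⟩⟩)
  refine C.tsum_expDist_ne_top hEf (ne_top_of_le_ne_top hsum
    (ENNReal.tsum_le_tsum fun k => ENNReal.tsum_le_tsum fun j => ?_))
  by_cases hk : k ∈ E
  · rw [if_pos hk, zero_mul]; exact zero_le
  rw [if_neg hk, one_mul, expDist_symm]
  by_cases hp : k ∈ C.pos
  · exact (le_max_left _ _).trans
      (L.expDist_le_hsSq_rowBlock hp (hE1 k hk) (hP k hp) (hP' k hp) j)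
  · have hp' := C.inv_mem_pos_of_notMem hp
    have := L.expDist_le_hsSq_rowBlock hp' (hE2 k hk) (hP _ hp') (hP' _ hp') j
    rw [C.inv_inv, add_comm (hsSq (C.rowBlock P (C.inv k) j)),
      add_comm (hsSq (C.rowBlock P' (C.inv k) j))] at this
    exact (le_max_right _ _).trans this

end Bundle

end ModelCurve

end HalfForm
end

theorem mainTheorem10 {I : Type*} (C : HalfForm.ModelCurve I) :
    -- the criterion in terms of the Riemann norm
    (∀ L : C.Bundle, L.FiniteDegree →
      (Summable fun p : {p : I × I // p.1 ≠ p.2 ∧ L.index p.1 = 0} =>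
        (HalfForm.riemannNorm (L.onCircle p.1.1) ^ 2 +
          HalfForm.riemannNorm (L.dual.onCircle p.1.1) ^ 2) * Real.exp (-C.l p.1.1 p.1.2)) →
      L.IsHilbertSchmidt) ∧
    -- the criterion for almost everywhere constant gluing functions
    (∀ L : C.Bundle, {i | ¬ L.IsConstAt i}.Finite →
      (L.IsHilbertSchmidt ↔
        Summable fun p : {p : I × I // p.1 ≠ p.2 ∧ L.IsConstAt p.1} =>
          (‖L.constVal p.1.1‖ ^ 2 + (‖L.constVal p.1.1‖ ^ 2)⁻¹) *
            Real.exp (-C.l p.1.1 p.1.2))) ∧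
    -- the criterion for curves
    (C.IsHilbertSchmidt ↔
      Summable fun p : {p : I × I // p.1 ≠ p.2} => Real.exp (-C.l p.1.1 p.1.2)) ∧
    -- a curve that carries a Hilbert-Schmidt bundle
    ((∃ L : C.Bundle, L.FiniteDegree ∧ L.IsHilbertSchmidt) → C.IsHilbertSchmidt) ∧
    -- the singular values of the blocks of the operator with Cauchy kernel
    (∀ i j, i ≠ j →
      ∃ (u : HilbertBasis ℕ ℂ HalfForm.Lminus) (v : HilbertBasis ℕ ℂ HalfForm.Lplus),
        ∀ n : ℕ, C.cauchyBlock i j (u n) =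
          ((Real.exp (-((n : ℝ) + 1 / 2) * C.l i j) : ℝ) : ℂ) • v n) := by
  refine ⟨fun L => L.isHilbertSchmidt_of_summable_riemannNorm,
    fun L => L.isHilbertSchmidt_iff_summable_constVal, C.isHilbertSchmidt_iff_summable,
    fun ⟨L, hL, h⟩ => L.curve_isHilbertSchmidt hL h, fun i j hij => ?_⟩
  obtain ⟨-, -, u, v, -, h⟩ := C.exists_block_svd hij
  exact ⟨u, v, fun n => (C.cauchyBlock_eq i j (u n)).trans (h n)⟩
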